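/- **Setting.** Let $\mathcal X\subset\mathbb R^n$ be nonempty, convex and compact, let $f:\mathcal X\times\mathbb R^m\to\mathbb R$ be continuous and let $g:\mathcal X\times\mathbb R^m\to\mathbb R$ be twice continuously differentiable and bounded below by $\underline g$. Let $\nabla^2_{yy}g$ be Lipschitz on $\mathcal X\times\mathbb R^m$ with constant $M>0$. Fix $y_0\in\mathbb R^m$, and let $\mathcal Y\subset\mathbb R^m$ be a compact set that contains $\{y:g(x,y)\le g(x,y_0)\}$ for all $x\in\mathcal X$, and $\mathcal Y'$ a compact set with $\mathcal Y\subset\operatorname{int}\mathcal Y'$. Let $f$ be Lipschitz with constant $L_f$ on $\{(x,y):x\in\mathcal X,\ g(x,y)\le g(x,y_0)\}$. Let $\widetilde{\mathcal X}$ be the set of $x\in\mathcal X$ for which $g(x,\cdot)$ is not Morse, i.e. for which there is $y$ with $\nabla_yg(x,y)=0$ and $\det\nabla^2_{yy}g(x,y)=0$, and let $\widetilde{\mathcal X}_\delta=\{x\in\mathcal X:\operatorname{dist}(x,\widetilde{\mathcal X})\le\delta\}$. Suppose that the upper Minkowski dimension of $\widetilde{\mathcal X}$ equals $d<n$ (the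 empty set having dimension $0$). Let $\overline g_0$ be an upper bound of $g(\cdot,y_0)$ on $\mathcal X$ and $\overline f$ an upper bound of $|f(x,y)|$ over $x\in\mathcal X$, $g(x,y)\le g(x,y_0)$. Let $\mu(\delta)>0$ (for $\delta>0$) be such that $|\lambda|\ge\mu(\delta)$ for every eigenvalue $\lambda$ of $\nabla^2_{yy}g(x,y)$ whenever $x\in\mathcal X\setminus\widetilde{\mathcal X}_\delta$, $y\in\mathcal Y'$ and $\nabla_yg(x,y)=0$. Let $\alpha(\delta,r)>0$ (for $\delta,r>0$) be such that $\|\nabla_yg(x,y)\|\ge\alpha(\delta,r)$ whenever $x\in\mathcal X\setminus\widetilde{\mathcal X}_\delta$ and $y\in\mathcal Y$ is at distance more than $r$ from the set of stationary points of $g(x,\cdot)$ in $\mathcal Y'$. *Lower level.* For each $x\in\mathcal X$ let $(y_k(x))_{k\ge0}$ be generated by the cubic-regularized Newton method from $y_0$: $y_{k+1}=y_k+s_k$, with $s_k$ a global minimizer of $s\mapsto\langle\nabla_yg(x,y_k),s\rangle+\frac12\langle\nabla_{yy}^2g(x,y_k)s,s\rangle+\frac M6\|s\|^3$. The output $\hat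 y_K(x)$ of $K$ steps is an iterate $y_k(x)$, $0\le k\le K$, with the smallest value of $\max\{\sqrt{\|\nabla_yg(x,y_k)\|/M},\,-\frac2{3M}\lambda_{\min}(\nabla^2_{yy}g(x,y_k))\}$ (all choices being measurable in $x$). Let $\hat S(x)$ be the set of those accumulation points of $(y_k(x))_k$ that have the smallest value of $g(x,\cdot)$ among all accumulation points, and let $y^{\rm cd}(x)$ be a minimizer of $f(x,\cdot)$ over $\hat S(x)$. Suppose that the set of discontinuity points of $y^{\rm cd}$ on $\mathcal X\setminus\widetilde{\mathcal X}$ has Lebesgue measure zero. *Smoothing and sampling.* Redefine $f(x,\cdot):=\overline f$ for $x\notin\mathcal X$. Fix $\xi>0$, let $h_\xi(z)=(2\pi\xi^2)^{-n/2}e^{-\|z\|^2/(2\xi^2)}$ and $$\phi_\xi(x)=\int_{\mathbb R^n}h_\xi(x-z)f(z,y^{\rm cd}(z))\,dz,\qquad \nabla^K\phi_\xi(x)=\int_{\mathbb R^n}\nabla_xh_\xi(x-z)f(z,\hat y_K(z))\,dz,$$ $$\hat\nabla^{K,N}\phi_\xi(x)=\frac1{N\xi}\sum_{i=1}^Nu^{(i)}f\big(x+\xi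 u^{(i)},\hat y_K(x+\xi u^{(i)})\big),\qquad u^{(1)},\dots,u^{(N)}\ \text{i.i.d. }\mathcal N(0,I_n).$$ For $\rho,\delta>0$ let $$\kappa(\rho,\delta)=\max\left\{\frac{256(\overline g_0-\underline g)M^{1/2}}{9\big(\min\{\alpha(\delta,\frac{\mu(\delta)}{2M}),\frac{\mu(\delta)^2}{4M}\}\big)^{3/2}},\frac{768(\overline g_0-\underline g)M^2}{\mu(\delta)^3}\right\}+\frac{256(\overline g_0-\underline g)M^{1/2}}{9(\mu(\delta)\rho)^{3/2}}.$$ The algorithm starts at any $x_0\in\mathbb R^n$ and iterates $x_{t+1}=\mathrm{proj}_{\mathcal X}\big(x_t-\beta_t\hat\nabla^{K_t,N_t}\phi_\xi(x_t)\big)$, $t\ge0$, with fresh independent samples at each iteration. Put $\widetilde\Phi_{\mathcal X,t}=\frac1{\beta_t}\big(x_t-\mathrm{proj}_{\mathcal X}(x_t-\beta_t\hat\nabla^{K_t,N_t}\phi_\xi(x_t))\big)$ and $\overline L=\overline f/\xi^2$. **Theorem.** Constants $\overline g_0,\overline f$ and functions $\mu,\alpha$ as above exist. For each admissible $\overline f$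 there are constants $C_1,C_2>0$, depending only on $n,\xi$ and the problem data $(\mathcal X,f,g,y_0,\mathcal Y,\mathcal Y',M,L_f,\underline g,d,\overline f)$, such that for all admissible $\overline g_0,\mu,\alpha$, $(y_k)$, $\hat y_K$ and $y^{\rm cd}$, writing $\Delta(\rho,\delta)=C_1\rho+C_2\delta^{(n-d)/2}$ and $\sigma^2(N)=\frac{n\overline f^2}{N\xi^2}$, the function $\phi_\xi$ is differentiable and: 1. (Bias) For all $\rho,\delta>0$, all integers $K>\kappa(\rho,\delta)$ and $N\ge1$, and all $x\in\mathbb R^n$, $$\big\|\mathbb E[\hat\nabla^{K,N}\phi_\xi(x)]-\nabla\phi_\xi(x)\big\|=\big\|\nabla^K\phi_\xi(x)-\nabla\phi_\xi(x)\big\|\le\Delta(\rho,\delta),$$ and in fact $\mathbb E[\hat\nabla^{K,N}\phi_\xi(x)]=\nabla^K\phi_\xi(x)$. 2. (Variance) For all $K\ge0$, $N\ge1$ and $x\in\mathbb R^n$, $\mathbb E\big\|\hat\nabla^{K,N}\phi_\xi(x)-\nabla^K\phi_\xi(x)\big\|^2\le\sigma^2(N)$. 3. (Convergence) Let $\rho_t,\delta_t>0$,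 integers $N_t\ge1$, $K_t>\kappa(\rho_t,\delta_t)$ and $\beta_t>0$ with $\overline L\beta_t<1$ for all $t\ge0$. Let $T\ge1$ and let $R$ be a random index, independent of all samples, with $\mathrm{Prob}\{R=t\}=\frac{\beta_t-\overline L\beta_t^2}{\sum_{s=1}^T(\beta_s-\overline L\beta_s^2)}$ for $t=1,\dots,T$. Then $$\mathbb E\|\widetilde\Phi_{\mathcal X,R}\|^2\le\frac{2\overline f+\sum_{t=1}^T\sqrt{\frac2\pi}\frac{\overline f}{\xi}\Delta(\rho_t,\delta_t)\beta_t+\sum_{t=1}^T\big(\sigma^2(N_t)+\Delta(\rho_t,\delta_t)^2\big)\beta_t}{\sum_{t=1}^T(\beta_t-\overline L\beta_t^2)}.$$ 4. (Rate) If $\rho_t=\frac1{t+1}$, $\delta_t=(t+1)^{-2/(n-d)}$, $N_t=t+1$, $\beta_t=\beta>0$ with $\overline L\beta<1$, and $K_t>\kappa(\rho_t,\delta_t)$ for all $t\ge 0$, then $\mathbb E\|\widetilde\Phi_{\mathcal X,R}\|^2\le C_3\,\frac{\log T}{T}$ for all $T\ge2$, with $C_3$ depending only on $\beta$ and on the same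 data as $C_1,C_2$; that is, $\mathbb E\|\widetilde\Phi_{\mathcal X,R}\|^2=\mathcal O(\log T/T)$. -/

import Mathlib

open MeasureTheory ProbabilityTheory Filter Topology

noncomputable section

namespace Scinbio

/-- Euclidean space `ℝ^k`. -/
abbrev Euc (k : ℕ) : Type := EuclideanSpace ℝ (Fin k)

variable {n m : ℕ}

/-! ### The lower-level problem and its bifurcation set -/

/-- The partial gradient `∇_y g(x, y)`. -/
def gradY (g : Euc n → Euc m → ℝ) (x : Euc n) (y : Euc m) : Euc m :=
  gradient (g x) y

/-- The partial Hessian `∇²_{yy} g(x, y)`, as a linear operator on `ℝ^m`. -/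
def hessY (g : Euc n → Euc m → ℝ) (x : Euc n) (y : Euc m) : Euc m →L[ℝ] Euc m :=
  fderiv ℝ (gradY g x) y

/-- `g(x, ·)` is a Morse function: every stationary point is non-degenerate. -/
def IsMorseAt (g : Euc n → Euc m → ℝ) (x : Euc n) : Prop :=
  ∀ y : Euc m, gradY g x y = 0 → LinearMap.det (hessY g x y : Euc m →ₗ[ℝ] Euc m) ≠ 0

/-- The bifurcation point set: the points of `X` at which `g(x, ·)` is not Morse. -/
def bifurcationSet (X : Set (Euc n)) (g : Euc n → Euc m → ℝ) : Set (Euc n) :=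
  {x ∈ X | ¬ IsMorseAt g x}

/-- The points of `X` at distance at most `δ` from the bifurcation point set
(no point, if that set is empty). -/
def bifurcationNhd (X : Set (Euc n)) (g : Euc n → Euc m → ℝ) (δ : ℝ) : Set (Euc n) :=
  X ∩ Metric.cthickening δ (bifurcationSet X g)

/-- Upper Minkowski (box-counting) dimension
`limsup_{r → 0+} log N(A, r) / (- log r)` of a bounded set, where `N(A, r)` is the least number of
closed balls of radius `r` that cover `A`. The empty set gets dimension `0`, as `log 0 = 0`. -/
def upperMinkowskiDim (A : Set (Euc n)) : EReal :=
  limsup (fun r : ℝ =>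
    ((Real.log ((Metric.externalCoveringNumber r.toNNReal A).toNat : ℝ) / (-Real.log r) : ℝ) :
      EReal)) (𝓝[>] (0 : ℝ))

/-- `μ(δ)` is a positive lower bound for the modulus of all eigenvalues of the Hessian at the
stationary points in `Y'`, for parameters outside the `δ`-neighbourhood of the bifurcation set. -/
def IsEigenvalueBound (X : Set (Euc n)) (Y' : Set (Euc m)) (g : Euc n → Euc m → ℝ)
    (μ : ℝ → ℝ) : Prop :=
  ∀ δ : ℝ, 0 < δ → 0 < μ δ ∧
    ∀ x ∈ X \ bifurcationNhd X g δ, ∀ y ∈ Y', gradY g x y = 0 →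
      ∀ l : ℝ, Module.End.HasEigenvalue (hessY g x y : Euc m →ₗ[ℝ] Euc m) l → μ δ ≤ |l|

/-- The stationary points of `g(x, ·)` in `Y'`. -/
def critSet (Y' : Set (Euc m)) (g : Euc n → Euc m → ℝ) (x : Euc n) : Set (Euc m) :=
  {y ∈ Y' | gradY g x y = 0}

/-- `α(δ, r)` is a positive lower bound for `‖∇_y g(x, y)‖` over the points `y ∈ Y` at distance
more than `r` from the stationary points in `Y'`, for parameters `x` outside the
`δ`-neighbourhood of the bifurcation set. -/
def IsGradientBound (X : Set (Euc n)) (Y Y' : Set (Euc m)) (g : Euc n → Euc m → ℝ)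
    (α : ℝ → ℝ → ℝ) : Prop :=
  ∀ δ r : ℝ, 0 < δ → 0 < r → 0 < α δ r ∧
    ∀ x ∈ X \ bifurcationNhd X g δ, ∀ y ∈ Y \ Metric.cthickening r (critSet Y' g x),
      α δ r ≤ ‖gradY g x y‖

/-! ### The cubic-regularized Newton method -/

/-- The cubic model `⟨∇_y g, s⟩ + ½ ⟨∇²_{yy} g s, s⟩ + (M/6) ‖s‖³` at `(x, y)`. -/
def cubicModel (g : Euc n → Euc m → ℝ) (M : ℝ) (x : Euc n) (y s : Euc m) : ℝ :=
  inner ℝ (gradY g x y) s + 1 / 2 * inner ℝ (hessY g x y s) s + M / 6 * ‖s‖ ^ 3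

/-- For every `x ∈ X`, `k ↦ y k x` is a sequence produced from `y₀` by the method: each step
is a global minimizer of the cubic model. -/
def IsCubicNewtonSeq (X : Set (Euc n)) (g : Euc n → Euc m → ℝ) (M : ℝ) (y₀ : Euc m)
    (y : ℕ → Euc n → Euc m) : Prop :=
  ∀ x ∈ X, y 0 x = y₀ ∧
    ∀ k : ℕ, ∀ s : Euc m,
      cubicModel g M x (y k x) (y (k + 1) x - y k x) ≤ cubicModel g M x (y k x) s

/-- The smallest eigenvalue of an operator on `ℝ^m`. -/
def minEigenvalue (H : Euc m →L[ℝ] Euc m) : ℝ :=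
  sInf {l : ℝ | Module.End.HasEigenvalue (H : Euc m →ₗ[ℝ] Euc m) l}

/-- The measure of (second-order) stationarity by which the method selects its output. -/
def stationarity (g : Euc n → Euc m → ℝ) (M : ℝ) (x : Euc n) (y : Euc m) : ℝ :=
  max (Real.sqrt (1 / M * ‖gradY g x y‖)) (-(2 / (3 * M)) * minEigenvalue (hessY g x y))

/-- For every `x ∈ X` and every `K`, `yhat K x` is an iterate of index `0 ≤ k ≤ K` of smallest
stationarity measure: an output of `K` steps of the method. -/
def IsCubicNewtonOutput (X : Set (Euc n)) (g : Euc n → Euc m → ℝ) (M : ℝ)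
    (y yhat : ℕ → Euc n → Euc m) : Prop :=
  ∀ x ∈ X, ∀ K : ℕ, ∃ k ≤ K, yhat K x = y k x ∧
    ∀ j ≤ K, stationarity g M x (y k x) ≤ stationarity g M x (y j x)

/-- The lower bound required for the number of lower-level steps, with `D = g₀ - glow`. -/
def stepThreshold (D M : ℝ) (μ : ℝ → ℝ) (α : ℝ → ℝ → ℝ) (ρ δ : ℝ) : ℝ :=
  max
      (256 * D * Real.sqrt M /
        (9 * (min (α δ (μ δ / (2 * M))) ((μ δ) ^ 2 / (4 * M))) ^ (3 / 2 : ℝ)))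
      (768 * D * M ^ 2 / (μ δ) ^ 3)
    + 256 * D * Real.sqrt M / (9 * (μ δ * ρ) ^ (3 / 2 : ℝ))

/-! ### The correspondence-driven hyperfunction and its smoothing -/

/-- The accumulation points of the sequence `k ↦ y k x` that attain the smallest lower-level
value among all its accumulation points. -/
def attainableSet (g : Euc n → Euc m → ℝ) (y : ℕ → Euc n → Euc m) (x : Euc n) : Set (Euc m) :=
  {z | MapClusterPt z atTop (fun k => y k x) ∧
    ∀ w, MapClusterPt w atTop (fun k => y k x) → g x z ≤ g x w}

/-- `ycd x` minimizes `f(x, ·)` over the attainable set, for every `x ∈ X`. -/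
def IsCorrespondence (X : Set (Euc n)) (f g : Euc n → Euc m → ℝ) (y : ℕ → Euc n → Euc m)
    (ycd : Euc n → Euc m) : Prop :=
  ∀ x ∈ X, ycd x ∈ attainableSet g y x ∧ ∀ z ∈ attainableSet g y x, f x (ycd x) ≤ f x z

open scoped Classical in
/-- `x ↦ f(x, r(x))` on `X`, extended by the constant `fbar` outside `X`. -/
def extendedValue (X : Set (Euc n)) (f : Euc n → Euc m → ℝ) (fbar : ℝ) (r : Euc n → Euc m)
    (x : Euc n) : ℝ :=
  if x ∈ X then f x (r x) else fbar

/-- The Gaussian kernel `h_ξ`. -/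
def gaussKernel (ξ : ℝ) (z : Euc n) : ℝ :=
  1 / (2 * Real.pi * ξ ^ 2) ^ ((n : ℝ) / 2) * Real.exp (-‖z‖ ^ 2 / (2 * ξ ^ 2))

/-- The smoothed hyperfunction: the convolution of `φ` with the Gaussian kernel. -/
def smoothed (ξ : ℝ) (φ : Euc n → ℝ) (x : Euc n) : ℝ :=
  ∫ z, gaussKernel ξ (x - z) * φ z

/-- The inexact gradient `∫ ∇_x h_ξ(x - z) φ(z) dz`. -/
def inexactGrad (ξ : ℝ) (φ : Euc n → ℝ) (x : Euc n) : Euc n :=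
  ∫ z, φ z • gradient (fun x' => gaussKernel ξ (x' - z)) x

/-! ### The stochastic algorithm -/

/-- The Monte Carlo estimator `(1 / (N ξ)) ∑ᵢ φ(x + ξ uᵢ) uᵢ`. -/
def estimator (ξ : ℝ) (φ : Euc n → ℝ) (N : ℕ) (x : Euc n) (u : Fin N → Euc n) : Euc n :=
  (1 / (N * ξ)) • ∑ i, φ (x + ξ • u i) • u i

open scoped Classical in
/-- The nearest point of `X` to `z` (it exists and is unique for `X` nonempty, closed, convex). -/
def proj (X : Set (Euc n)) (z : Euc n) : Euc n :=
  if h : ∃ p ∈ X, ∀ q ∈ X, ‖z - p‖ ≤ ‖z - q‖ then h.choose else z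

/-- Iterates of the projected stochastic method, as a function of the array `U` of samples
(`U t i` is the `i`-th sample drawn at iteration `t`); `φ t` is the function evaluated at
iteration `t`. -/
def sgd (X : Set (Euc n)) (ξ : ℝ) (φ : ℕ → Euc n → ℝ) (N : ℕ → ℕ) (β : ℕ → ℝ) (x₀ : Euc n)
    (U : ℕ → ℕ → Euc n) : ℕ → Euc n
  | 0 => x₀
  | t + 1 =>
      proj X (sgd X ξ φ N β x₀ U t -
        β t • estimator ξ (φ t) (N t) (sgd X ξ φ N β x₀ U t) (fun i => U t i))

/-- The stochastic projected gradient mapping at iteration `t`. -/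
def projGradMap (X : Set (Euc n)) (ξ : ℝ) (φ : ℕ → Euc n → ℝ) (N : ℕ → ℕ) (β : ℕ → ℝ)
    (x₀ : Euc n) (U : ℕ → ℕ → Euc n) (t : ℕ) : Euc n :=
  (1 / β t) • (sgd X ξ φ N β x₀ U t -
    proj X (sgd X ξ φ N β x₀ U t -
      β t • estimator ξ (φ t) (N t) (sgd X ξ φ N β x₀ U t) (fun i => U t i)))

/-- On the probability space `(Ω, P)`: the samples `u t i` are i.i.d. standard Gaussian vectors,
and the random index `R ∈ {1, …, T}` is independent of them and has the probability mass function
`t ↦ (β t - L (β t)²) / ∑ₛ (β s - L (β s)²)`. -/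
structure IsSampling {Ω : Type*} [MeasurableSpace Ω] (P : Measure Ω) (L : ℝ) (β : ℕ → ℝ) (T : ℕ)
    (u : ℕ → ℕ → Ω → Euc n) (R : Ω → ℕ) : Prop where
  measurable_sample : ∀ t i, Measurable (u t i)
  map_sample : ∀ t i, P.map (u t i) = stdGaussian (Euc n)
  indep_sample : iIndepFun (fun (p : ℕ × ℕ) (ω : Ω) => u p.1 p.2 ω) P
  measurable_index : Measurable R
  index_law : ∀ t ∈ Finset.Icc 1 T, P.real (R ⁻¹' {t}) =
    (β t - L * β t ^ 2) / ∑ s ∈ Finset.Icc 1 T, (β s - L * β s ^ 2)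
  indep_index : IndepFun R (fun (ω : Ω) (p : ℕ × ℕ) => u p.1 p.2 ω) P

end Scinbio

end

namespace Scinbio

variable {n m : ℕ}

/-! The upper level is smooth because the Gaussian is: for a bounded measurable `φ`, the first-order
Taylor remainder of the kernel in direction `v` has `L¹` norm at most `‖v‖²/ξ²`. So the smoothing of
`φ` differs from its linearization by at most `F/ξ²·‖v‖²` (`abs_smoothed_sub_le`). This gives
differentiability, identifies the gradient with `inexactGrad`, and is the descent inequality with
constant `F/ξ²`. The substitution `z = x + ξu` makes `inexactGrad` the mean of the Monte Carlo
estimator; its variance follows from independence and `E‖u‖² = n`.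

The bias reduces to comparing the value of `f` at the output with its value at `ycd`. A Newton step
`s` lowers `g(x, ·)` by at least `M‖s‖³/12` and leaves a stationarity measure at most `‖s‖`, so the
best of `K` steps has measure `O(K^(-1/3))`. If `x` is off the `δ`-neighbourhood of the bifurcation
set and `K` exceeds the threshold, then the output is close to a stationary point `z`. The Hessian
at `z` has all eigenvalues above `-μ` and of modulus at least `μ`, hence at least `μ`. Thus `z` is a
nondegenerate minimizer near which the method contracts, so all iterates converge to `z`: the
attainable set is `{z}`, `ycd x = z`, and the output is within `2ρ` of it
(`exists_attainableSet_eq_singleton`). On the neighbourhood itself the values differ by at most `2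
fbar`, and its volume is `O(δ^((n-d)/2))` by a covering argument (`exists_volume_cthickening_le`).
Boundedness of the kernel's gradient turns these two estimates into the bias bound.

For convergence, the descent inequality for the projected step is telescoped. Replacing the
stochastic gradient mapping by the one at the exact gradient costs the squared error, by
nonexpansiveness of the projection; what remains is linear in the error with a coefficient that
depends only on the past. Independence of past and fresh samples and Fubini's theorem then leave
bias and variance (`integral_noise_le`). The random index converts the weighted sum into an
expectation, and a harmonic sum gives the rate. -/

/-! ### The Gaussian kernel, the standard Gaussian measure and its moments. -/

lemma gaussKernel_nonneg (ξ : ℝ) (z : Euc n) : 0 ≤ gaussKernel ξ z := by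
  unfold gaussKernel; positivity

lemma continuous_gaussKernel (ξ : ℝ) : Continuous (gaussKernel ξ : Euc n → ℝ) := by
  unfold gaussKernel; fun_prop

lemma gaussKernel_neg (ξ : ℝ) (z : Euc n) : gaussKernel ξ (-z) = gaussKernel ξ z := by
  simp [gaussKernel]

lemma gaussKernel_smul {ξ : ℝ} (hξ : 0 < ξ) (u : Euc n) :
    gaussKernel ξ (ξ • u) = (ξ ^ n)⁻¹ * gaussKernel 1 u := by
  unfold gaussKernel
  have h1 : (2 * Real.pi * ξ ^ 2) ^ ((n : ℝ) / 2) = (2 * Real.pi * 1 ^ 2) ^ ((n : ℝ) / 2) * ξ ^ n := by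
    rw [Real.mul_rpow (by positivity) (by positivity)]
    congr 1
    · simp
    · rw [← Real.rpow_natCast ξ 2, ← Real.rpow_mul hξ.le, ← Real.rpow_natCast ξ n]
      congr 1
      push_cast; ring
  have h2 : -‖ξ • u‖ ^ 2 / (2 * ξ ^ 2) = -‖u‖ ^ 2 / (2 * 1 ^ 2) := by
    rw [norm_smul, Real.norm_of_nonneg hξ.le]
    field_simp
  rw [h1, h2]
  field_simp

lemma gaussKernel_one_eq (z : Euc n) :
    ((gaussKernel 1 z : ℝ) : ℂ) =
      (1 / (2 * Real.pi) ^ ((n : ℝ) / 2) : ℝ) * Complex.exp (-(1 / 2 : ℂ) * ‖z‖ ^ 2) := by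
  unfold gaussKernel
  push_cast
  congr 2
  · simp
  · ring

lemma integrable_gaussKernel_one : Integrable (gaussKernel 1 : Euc n → ℝ) := by
  have h := (GaussianFourier.integrable_cexp_neg_mul_sq_norm_add (V := Euc n) (b := 1 / 2)
    (by norm_num) 0 0).const_mul ((1 / (2 * Real.pi) ^ ((n : ℝ) / 2) : ℝ) : ℂ)
  refine h.norm.congr (ae_of_all _ fun z => ?_)
  have := gaussKernel_one_eq z
  simp only [zero_mul, add_zero] at *
  rw [← this, Complex.norm_real, Real.norm_of_nonneg (gaussKernel_nonneg _ _)]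

/-- The standard Gaussian measure has the Gaussian kernel as its Lebesgue density. -/
lemma stdGaussian_eq_withDensity :
    stdGaussian (Euc n) = volume.withDensity fun z => ENNReal.ofReal (gaussKernel 1 z) := by
  have : IsFiniteMeasure ((volume : Measure (Euc n)).withDensity
      fun z => ENNReal.ofReal (gaussKernel 1 z)) :=
    isFiniteMeasure_withDensity_ofReal integrable_gaussKernel_one.2
  apply Measure.ext_of_charFun
  ext t
  rw [charFun_stdGaussian, charFun_apply, integral_withDensity_eq_integral_toReal_smul
    ((continuous_gaussKernel 1).measurable.ennreal_ofReal) (by simp)]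
  -- Both characteristic functions are explicit; the one of the density is a Gaussian Fourier
  -- integral at the complex parameter `I`.
  have h := GaussianFourier.integral_cexp_neg_mul_sq_norm_add (V := Euc n) (b := 1 / 2)
    (by norm_num) Complex.I t
  have h2 : ∀ z : Euc n, (ENNReal.ofReal (gaussKernel 1 z)).toReal •
      Complex.exp ((inner ℝ z t : ℝ) * Complex.I) =
      (1 / (2 * Real.pi) ^ ((n : ℝ) / 2) : ℝ) *
        Complex.exp (-(1 / 2 : ℂ) * ‖z‖ ^ 2 + Complex.I * (inner ℝ t z : ℝ)) := by
    intro z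
    rw [ENNReal.toReal_ofReal (gaussKernel_nonneg _ _), Complex.real_smul, gaussKernel_one_eq,
      Complex.exp_add, real_inner_comm, mul_assoc, mul_comm Complex.I]
  simp_rw [h2]
  rw [integral_const_mul, h, finrank_euclideanSpace_fin]
  have h3 : ((Real.pi : ℂ) / (1 / 2)) ^ ((n : ℂ) / 2) =
      (((2 * Real.pi) ^ ((n : ℝ) / 2) : ℝ) : ℂ) := by
    rw [Complex.ofReal_cpow (by positivity)]
    push_cast
    congr 1
    ring
  rw [h3, ← mul_assoc, ← Complex.ofReal_mul]
  have h4 : (0:ℝ) < (2 * Real.pi) ^ ((n : ℝ) / 2) := by positivity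
  rw [one_div_mul_cancel h4.ne', Complex.ofReal_one, one_mul]
  congr 1
  rw [Complex.I_sq]
  ring

section change

variable {E : Type*} [NormedAddCommGroup E] [NormedSpace ℝ E]

lemma integral_stdGaussian_eq (F : Euc n → E) :
    ∫ u, F u ∂(stdGaussian (Euc n)) = ∫ u, gaussKernel 1 u • F u := by
  rw [stdGaussian_eq_withDensity, integral_withDensity_eq_integral_toReal_smul
    ((continuous_gaussKernel 1).measurable.ennreal_ofReal) (by simp)]
  simp_rw [ENNReal.toReal_ofReal (gaussKernel_nonneg _ _)]

lemma integrable_stdGaussian_iff (F : Euc n → E) :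
    Integrable F (stdGaussian (Euc n)) ↔ Integrable (fun u => gaussKernel 1 u • F u) := by
  rw [stdGaussian_eq_withDensity, integrable_withDensity_iff_integrable_smul'
    ((continuous_gaussKernel 1).measurable.ennreal_ofReal) (by simp)]
  simp_rw [ENNReal.toReal_ofReal (gaussKernel_nonneg _ _)]

/-- Integration against the Gaussian kernel is integration against the Gaussian measure. -/
lemma integral_gaussKernel_smul {ξ : ℝ} (hξ : 0 < ξ) (F : Euc n → E) :
    ∫ w, gaussKernel ξ w • F w = ∫ u, F (ξ • u) ∂(stdGaussian (Euc n)) := by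
  have h := Measure.integral_comp_smul (volume : Measure (Euc n))
    (fun w => gaussKernel ξ w • F w) ξ
  rw [finrank_euclideanSpace_fin, abs_of_pos (by positivity)] at h
  simp_rw [gaussKernel_smul hξ, mul_smul] at h
  rw [integral_smul] at h
  rw [integral_stdGaussian_eq]
  exact (smul_right_injective E (show (ξ ^ n)⁻¹ ≠ 0 by positivity) h).symm

lemma integrable_gaussKernel_smul_iff {ξ : ℝ} (hξ : 0 < ξ) (F : Euc n → E) :
    Integrable (fun w => gaussKernel ξ w • F w) ↔
      Integrable (fun u => F (ξ • u)) (stdGaussian (Euc n)) := by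
  rw [integrable_stdGaussian_iff, ← integrable_comp_smul_iff volume _ hξ.ne']
  simp_rw [gaussKernel_smul hξ, mul_smul]
  exact integrable_smul_iff (show (ξ ^ n)⁻¹ ≠ 0 by positivity) _

lemma integral_gaussKernel_sub_smul {ξ : ℝ} (hξ : 0 < ξ) (x : Euc n) (F : Euc n → E) :
    ∫ z, gaussKernel ξ (x - z) • F z = ∫ u, F (x + ξ • u) ∂(stdGaussian (Euc n)) := by
  rw [← integral_add_left_eq_self _ x, ← integral_gaussKernel_smul hξ (fun w => F (x + w))]
  simp [gaussKernel_neg]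

lemma integrable_gaussKernel_sub_smul_iff {ξ : ℝ} (hξ : 0 < ξ) (x : Euc n) (F : Euc n → E) :
    Integrable (fun z => gaussKernel ξ (x - z) • F z) ↔
      Integrable (fun u => F (x + ξ • u)) (stdGaussian (Euc n)) := by
  rw [← integrable_gaussKernel_smul_iff hξ (fun w => F (x + w)),
    ← (measurePreserving_add_left volume x).integrable_comp_emb
      (MeasurableEquiv.addLeft x).measurableEmbedding]
  simp [Function.comp_def, gaussKernel_neg]

end change

/-- By `1 + s ≤ exp s` the claim reduces to `2ξ‖w‖ ≤ ‖w‖² + 2ξ²`. It makes the gradient of the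
kernel uniformly bounded. -/
lemma gaussKernel_le_one_mul {ξ : ℝ} (hξ : 0 < ξ) (w : Euc n) :
    ‖w‖ * gaussKernel ξ w ≤ ξ / (2 * Real.pi * ξ ^ 2) ^ ((n : ℝ) / 2) := by
  unfold gaussKernel
  have h : ‖w‖ * Real.exp (-‖w‖ ^ 2 / (2 * ξ ^ 2)) ≤ ξ := by
    rw [neg_div, Real.exp_neg, ← div_eq_mul_inv, div_le_iff₀ (Real.exp_pos _)]
    have h1 := Real.add_one_le_exp (‖w‖ ^ 2 / (2 * ξ ^ 2))
    have h2 : ‖w‖ ≤ ξ * (‖w‖ ^ 2 / (2 * ξ ^ 2) + 1) := by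
      have : ξ * (‖w‖ ^ 2 / (2 * ξ ^ 2) + 1) = (‖w‖ ^ 2 + 2 * ξ ^ 2) / (2 * ξ) := by
        field_simp
      rw [this, le_div_iff₀ (by positivity)]
      nlinarith [sq_nonneg (‖w‖ - ξ)]
    exact h2.trans (by gcongr)
  calc _ = (‖w‖ * Real.exp (-‖w‖ ^ 2 / (2 * ξ ^ 2))) / (2 * Real.pi * ξ ^ 2) ^ ((n : ℝ) / 2) := by
        ring
    _ ≤ _ := by gcongr

lemma hasGradientAt_gaussKernel {ξ : ℝ} (hξ : 0 < ξ) (w : Euc n) :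
    HasGradientAt (gaussKernel ξ) (-(gaussKernel ξ w / ξ ^ 2) • w) w := by
  rw [hasGradientAt_iff_hasFDerivAt]
  have h1 : HasFDerivAt (fun w : Euc n => -‖w‖ ^ 2 / (2 * ξ ^ 2))
      ((2 * ξ ^ 2)⁻¹ • (-((2 : ℕ) • (innerSL ℝ w : Euc n →L[ℝ] ℝ)))) w := by
    simp_rw [div_eq_inv_mul]
    exact (hasStrictFDerivAt_norm_sq w).hasFDerivAt.neg.const_mul _
  have h2 := (h1.exp).const_mul (1 / (2 * Real.pi * ξ ^ 2) ^ ((n : ℝ) / 2))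
  refine h2.congr_fderiv ?_
  ext v
  simp [gaussKernel]
  field_simp

lemma gradient_gaussKernel_sub {ξ : ℝ} (hξ : 0 < ξ) (x z : Euc n) :
    gradient (fun x' => gaussKernel ξ (x' - z)) x =
      gaussKernel ξ (x - z) • ((1 / ξ ^ 2) • (z - x)) := by
  have h : HasGradientAt (fun x' => gaussKernel ξ (x' - z))
      (-(gaussKernel ξ (x - z) / ξ ^ 2) • (x - z)) x := by
    have := (hasGradientAt_gaussKernel hξ (x - z)).hasFDerivAt
    rw [hasGradientAt_iff_hasFDerivAt]
    exact this.comp x ((hasFDerivAt_id x).sub_const z)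
  rw [h.gradient, ← neg_sub x z, smul_neg, smul_neg, smul_smul, neg_smul]
  congr 2
  ring

/-- The substitution `z = x + ξu` exhibits the inexact gradient as the mean of a single sample of
the estimator. -/
lemma inexactGrad_eq {ξ : ℝ} (hξ : 0 < ξ) (φ : Euc n → ℝ) (x : Euc n) :
    inexactGrad ξ φ x = ∫ u, φ (x + ξ • u) • ((1 / ξ) • u) ∂(stdGaussian (Euc n)) := by
  unfold inexactGrad
  simp_rw [gradient_gaussKernel_sub hξ]
  have := integral_gaussKernel_sub_smul hξ x (fun z => φ z • ((1 / ξ ^ 2) • (z - x)))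
  simp_rw [smul_comm (φ _) (gaussKernel ξ _)]
  rw [this]
  congr 1; ext1 u
  simp only [add_sub_cancel_left, smul_smul]
  congr 1
  field_simp

lemma smoothed_eq {ξ : ℝ} (hξ : 0 < ξ) (φ : Euc n → ℝ) (x : Euc n) :
    smoothed ξ φ x = ∫ u, φ (x + ξ • u) ∂(stdGaussian (Euc n)) := by
  rw [← integral_gaussKernel_sub_smul hξ]; rfl

lemma integrable_norm_pow_stdGaussian (k : ℕ) :
    Integrable (fun u : Euc n => ‖u‖ ^ k) (stdGaussian (Euc n)) := by
  have h : MemLp (id : Euc n → Euc n) k (stdGaussian (Euc n)) :=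
    IsGaussian.memLp_id _ _ (by simp)
  exact h.integrable_norm_pow'

lemma map_inner_stdGaussian (v : Euc n) :
    (stdGaussian (Euc n)).map (fun u => inner ℝ v u) = gaussianReal 0 (‖v‖ ^ 2).toNNReal := by
  have h := IsGaussian.map_eq_gaussianReal (μ := stdGaussian (Euc n)) (innerSL ℝ v)
  rw [integral_strongDual_stdGaussian, variance_dual_stdGaussian, innerSL_apply_norm] at h
  exact h

lemma integral_inner_sq_stdGaussian (v : Euc n) :
    ∫ u, (inner ℝ v u) ^ 2 ∂(stdGaussian (Euc n)) = ‖v‖ ^ 2 := by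
  have h := variance_dual_stdGaussian (E := Euc n) (innerSL ℝ v)
  rw [variance_of_integral_eq_zero (by fun_prop) (integral_strongDual_stdGaussian _),
    innerSL_apply_norm] at h
  exact h

lemma integrable_inner_sq_stdGaussian (v : Euc n) :
    Integrable (fun u => (inner ℝ v u) ^ 2) (stdGaussian (Euc n)) := by
  refine ((integrable_norm_pow_stdGaussian (n := n) 2).const_mul (‖v‖ ^ 2)).mono'
    (by fun_prop) (ae_of_all _ fun u => ?_)
  rw [Real.norm_eq_abs, abs_pow, ← mul_pow]
  gcongr
  exact abs_real_inner_le_norm v u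

lemma integral_norm_sq_stdGaussian :
    ∫ u : Euc n, ‖u‖ ^ 2 ∂(stdGaussian (Euc n)) = n := by
  have h : ∀ u : Euc n, ‖u‖ ^ 2 = ∑ i, (inner ℝ (EuclideanSpace.single i (1 : ℝ)) u) ^ 2 := by
    intro u
    simp [EuclideanSpace.norm_sq_eq, EuclideanSpace.inner_single_left]
  simp_rw [h]
  rw [integral_finsetSum _ fun i _ => integrable_inner_sq_stdGaussian _]
  simp_rw [integral_inner_sq_stdGaussian]
  simp

lemma integral_abs_gaussianReal : ∫ x, |x| ∂(gaussianReal 0 1) = Real.sqrt (2 / Real.pi) := by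
  rw [integral_gaussianReal_eq_integral_smul one_ne_zero]
  have h : ∀ x : ℝ, gaussianPDFReal 0 1 x • |x| =
      (fun y : ℝ => (Real.sqrt (2 * Real.pi))⁻¹ *
        (y ^ (1 : ℝ) * Real.exp (-(1 / 2) * y ^ (2 : ℝ)))) |x| := by
    intro x
    simp only [gaussianPDFReal, Real.rpow_one, Real.rpow_two, sq_abs, smul_eq_mul]
    simp
    ring_nf
  simp_rw [h]
  rw [integral_comp_abs (f := fun y : ℝ => (Real.sqrt (2 * Real.pi))⁻¹ *
        (y ^ (1 : ℝ) * Real.exp (-(1 / 2) * y ^ (2 : ℝ)))), integral_const_mul,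
    integral_rpow_mul_exp_neg_mul_rpow (by norm_num) (by norm_num) (by norm_num)]
  norm_num
  have h2 : Real.sqrt 2 * Real.sqrt 2 = 2 := Real.mul_self_sqrt (by norm_num)
  field_simp
  nlinarith

/-- A one-dimensional marginal is a centred Gaussian of standard deviation `‖v‖`; its absolute mean
is the source of `√(2/π)` in the convergence bound. -/
lemma integral_abs_inner_stdGaussian (v : Euc n) :
    ∫ u, |inner ℝ v u| ∂(stdGaussian (Euc n)) = ‖v‖ * Real.sqrt (2 / Real.pi) := by
  have h1 : ∫ u, |inner ℝ v u| ∂(stdGaussian (Euc n)) =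
      ∫ x, |x| ∂((stdGaussian (Euc n)).map (fun u => inner ℝ v u)) := by
    rw [integral_map (by fun_prop) (by fun_prop)]
  have h2 : (gaussianReal 0 1).map (‖v‖ * ·) = gaussianReal 0 (‖v‖ ^ 2).toNNReal := by
    rw [gaussianReal_map_const_mul]
    congr 1
    · simp
    · ext; simp
  rw [h1, map_inner_stdGaussian, ← h2, integral_map (by fun_prop) (by fun_prop)]
  simp_rw [abs_mul, abs_norm]
  rw [integral_const_mul, integral_abs_gaussianReal]

/-! ### Smoothness of the Gaussian convolution of a bounded function -/

/-- The second derivative of the Gaussian kernel at `w` in direction `v`. -/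
noncomputable def gaussSecond (ξ : ℝ) (v w : Euc n) : ℝ :=
  gaussKernel ξ w * ((inner ℝ v w) ^ 2 / ξ ^ 4 - ‖v‖ ^ 2 / ξ ^ 2)

lemma continuous_gaussSecond (ξ : ℝ) (v : Euc n) : Continuous (gaussSecond ξ v) := by
  unfold gaussSecond
  have := continuous_gaussKernel (n := n) ξ
  fun_prop

/-- After the triangle inequality the two terms each contribute `‖v‖²/ξ²`, the first through the
second moment of a Gaussian marginal. -/
lemma lintegral_gaussSecond_le {ξ : ℝ} (hξ : 0 < ξ) (v : Euc n) :
    ∫⁻ w, ‖gaussSecond ξ v w‖ₑ ≤ ENNReal.ofReal (2 * ‖v‖ ^ 2 / ξ ^ 2) := by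
  set F : Euc n → ℝ := fun w => (inner ℝ v w) ^ 2 / ξ ^ 4 + ‖v‖ ^ 2 / ξ ^ 2
  have hF : ∀ u, F (ξ • u) = (inner ℝ v u) ^ 2 / ξ ^ 2 + ‖v‖ ^ 2 / ξ ^ 2 := by
    intro u
    simp only [F, inner_smul_right]
    field_simp
  have hint : Integrable (fun w => gaussKernel ξ w • F w) := by
    rw [integrable_gaussKernel_smul_iff hξ]
    simp_rw [hF]
    exact ((integrable_inner_sq_stdGaussian v).div_const _).add (integrable_const _)
  have hval : ∫ w, gaussKernel ξ w • F w = 2 * ‖v‖ ^ 2 / ξ ^ 2 := by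
    rw [integral_gaussKernel_smul hξ]
    simp_rw [hF]
    rw [integral_add ((integrable_inner_sq_stdGaussian v).div_const _) (integrable_const _),
      integral_div, integral_inner_sq_stdGaussian]
    simp
    ring
  have hnn : ∀ w, 0 ≤ gaussKernel ξ w • F w := fun w =>
    mul_nonneg (gaussKernel_nonneg _ _) (by positivity)
  rw [← hval, ofReal_integral_eq_lintegral_ofReal hint (ae_of_all _ hnn)]
  refine lintegral_mono fun w => ?_
  rw [← ofReal_norm]
  refine ENNReal.ofReal_le_ofReal ?_
  rw [gaussSecond, norm_mul, Real.norm_of_nonneg (gaussKernel_nonneg _ _), smul_eq_mul]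
  refine mul_le_mul_of_nonneg_left ?_ (gaussKernel_nonneg _ _)
  refine (norm_sub_le _ _).trans ?_
  rw [Real.norm_of_nonneg (by positivity), Real.norm_of_nonneg (by positivity)]

/-- The first-order Taylor remainder of the Gaussian kernel at `w` in direction `v`. -/
noncomputable def gaussRemainder (ξ : ℝ) (v w : Euc n) : ℝ :=
  gaussKernel ξ (w + v) - gaussKernel ξ w + gaussKernel ξ w / ξ ^ 2 * inner ℝ w v

lemma gaussRemainder_eq {ξ : ℝ} (hξ : 0 < ξ) (v w : Euc n) :
    gaussRemainder ξ v w = ∫ s in Set.Ioc (0 : ℝ) 1, (1 - s) * gaussSecond ξ v (w + s • v) := by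
  have hp : ∀ s : ℝ, HasDerivAt (fun s : ℝ => gaussKernel ξ (w + s • v))
      (-(gaussKernel ξ (w + s • v) / ξ ^ 2) * inner ℝ (w + s • v) v) s := by
    intro s
    have h1 := (hasGradientAt_gaussKernel hξ (w + s • v)).hasFDerivAt
    have h2 : HasDerivAt (fun s : ℝ => w + s • v) v s := by
      simpa using ((hasDerivAt_id s).smul_const v).const_add w
    have := h1.comp_hasDerivAt s h2
    exact this.congr_deriv (by rw [InnerProductSpace.toDual_apply_apply, real_inner_smul_left])
  have hq : ∀ s : ℝ, HasDerivAt (fun s : ℝ => (inner ℝ (w + s • v) v : ℝ)) (‖v‖ ^ 2) s := by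
    intro s
    simp_rw [inner_add_left, inner_smul_left, real_inner_self_eq_norm_sq]
    simpa using ((hasDerivAt_id s).mul_const (‖v‖ ^ 2)).const_add (inner ℝ w v)
  -- Integration by parts in advance: with `p` the kernel along the segment, `(1 - s) p'(s) + p(s)`
  -- is a primitive of `(1 - s) p''(s)`.
  have hd : ∀ s : ℝ, HasDerivAt (fun s : ℝ => (1 - s) *
      (-(gaussKernel ξ (w + s • v) / ξ ^ 2) * inner ℝ (w + s • v) v) + gaussKernel ξ (w + s • v))
      ((1 - s) * gaussSecond ξ v (w + s • v)) s := by
    intro s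
    have h := (((hasDerivAt_id s).const_sub 1).mul
      ((((hp s).div_const (ξ ^ 2)).neg).mul (hq s))).add (hp s)
    refine h.congr_deriv ?_
    simp only [gaussSecond, Pi.neg_apply, Pi.mul_apply, id, real_inner_comm v]
    field_simp
    ring
  have hc : Continuous fun s : ℝ => (1 - s) * gaussSecond ξ v (w + s • v) := by
    have := continuous_gaussSecond ξ v
    fun_prop
  rw [← intervalIntegral.integral_of_le zero_le_one,
    intervalIntegral.integral_eq_sub_of_hasDerivAt (fun s _ => hd s) (hc.intervalIntegrable _ _)]
  simp [gaussRemainder]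
  ring

/-- Tonelli's theorem and translation invariance separate the integrals; `∫ (1 - s) ds = 1/2` over
the unit interval halves the bound on the second derivative. -/
lemma lintegral_gaussRemainder_le {ξ : ℝ} (hξ : 0 < ξ) (v : Euc n) :
    ∫⁻ w, ‖gaussRemainder ξ v w‖ₑ ≤ ENNReal.ofReal (‖v‖ ^ 2 / ξ ^ 2) := by
  have hc : Continuous fun p : Euc n × ℝ => (1 - p.2) * gaussSecond ξ v (p.1 + p.2 • v) := by
    have := continuous_gaussSecond ξ v
    fun_prop
  calc ∫⁻ w, ‖gaussRemainder ξ v w‖ₑ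
      ≤ ∫⁻ w, ∫⁻ s in Set.Ioc (0 : ℝ) 1, ‖(1 - s) * gaussSecond ξ v (w + s • v)‖ₑ := by
        refine lintegral_mono fun w => ?_
        rw [gaussRemainder_eq hξ]
        exact enorm_integral_le_lintegral_enorm _
    _ = ∫⁻ s in Set.Ioc (0 : ℝ) 1, ∫⁻ w, ‖(1 - s) * gaussSecond ξ v (w + s • v)‖ₑ :=
        lintegral_lintegral_swap (hc.measurable.enorm.aemeasurable)
    _ ≤ ∫⁻ s in Set.Ioc (0 : ℝ) 1, ENNReal.ofReal (1 - s) *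
          ENNReal.ofReal (2 * ‖v‖ ^ 2 / ξ ^ 2) := by
        refine setLIntegral_mono' measurableSet_Ioc fun s hs => ?_
        simp_rw [enorm_mul]
        rw [lintegral_const_mul' _ _ enorm_ne_top,
          Real.enorm_of_nonneg (by linarith [hs.2]),
          lintegral_add_right_eq_self (fun w => ‖gaussSecond ξ v w‖ₑ) (s • v)]
        gcongr
        exact lintegral_gaussSecond_le hξ v
    _ = ENNReal.ofReal (1 / 2) * ENNReal.ofReal (2 * ‖v‖ ^ 2 / ξ ^ 2) := by
        rw [lintegral_mul_const _ (by fun_prop), ← ofReal_integral_eq_lintegral_ofReal]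
        · rw [← intervalIntegral.integral_of_le zero_le_one]
          congr 2
          rw [intervalIntegral.integral_sub (by simp) (by simp)]
          norm_num
        · exact (Continuous.integrableOn_Icc (by fun_prop)).mono_set Set.Ioc_subset_Icc_self
        · exact (ae_restrict_mem measurableSet_Ioc).mono fun s hs => by simpa using hs.2
    _ = _ := by
        rw [← ENNReal.ofReal_mul (by norm_num)]
        congr 1; ring

section bounded

variable {ξ F : ℝ} {φ : Euc n → ℝ}

/-- As `φ` is only a.e. strongly measurable, the affine substitution must respect null sets and the
Gaussian must be absolutely continuous. -/
lemma integrable_comp_smul_stdGaussian (hφm : AEStronglyMeasurable φ volume)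
    (hφ : ∀ z, |φ z| ≤ F) (hξ : 0 < ξ) (x : Euc n) {E : Type*} [NormedAddCommGroup E]
    [NormedSpace ℝ E] {G : Euc n → E} (hG : Integrable G (stdGaussian (Euc n))) :
    Integrable (fun u => φ (x + ξ • u) • G u) (stdGaussian (Euc n)) := by
  refine hG.bdd_smul F ?_ (ae_of_all _ fun u => by simpa using hφ _)
  have hq : Measure.QuasiMeasurePreserving (fun u : Euc n => x + ξ • u) volume volume := by
    refine (measurePreserving_add_left volume x).quasiMeasurePreserving.comp ?_
    exact ⟨by fun_prop, by
      rw [Measure.map_addHaar_smul volume hξ.ne']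
      exact Measure.smul_absolutelyContinuous⟩
  have h := hφm.comp_quasiMeasurePreserving hq
  refine h.mono_ac ?_
  rw [stdGaussian_eq_withDensity]
  exact withDensity_absolutelyContinuous _ _

lemma integrable_id_stdGaussian : Integrable (fun u : Euc n => u) (stdGaussian (Euc n)) :=
  IsGaussian.integrable_id

/-- Quadratic bound for the first-order remainder of the Gaussian smoothing. -/
lemma abs_smoothed_sub_le (hφm : AEStronglyMeasurable φ volume)
    (hφ : ∀ z, |φ z| ≤ F) (hξ : 0 < ξ) (x v : Euc n) :
    |smoothed ξ φ (x + v) - smoothed ξ φ x - inner ℝ (inexactGrad ξ φ x) v| ≤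
      F / ξ ^ 2 * ‖v‖ ^ 2 := by
  have hF : 0 ≤ F := (abs_nonneg _).trans (hφ 0)
  have hi : ∀ y : Euc n, Integrable fun z => gaussKernel ξ (y - z) * φ z := by
    intro y
    have := (integrable_gaussKernel_sub_smul_iff hξ y φ).2 (by
      simpa using integrable_comp_smul_stdGaussian hφm hφ hξ y (G := fun _ => (1 : ℝ))
        (integrable_const _))
    exact this
  have hg : Integrable fun z => gaussKernel ξ (x - z) • (φ z • ((1 / ξ ^ 2) • (z - x))) := by
    rw [integrable_gaussKernel_sub_smul_iff hξ x (fun z => φ z • ((1 / ξ ^ 2) • (z - x)))]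
    simp_rw [add_sub_cancel_left]
    exact integrable_comp_smul_stdGaussian hφm hφ hξ x
      ((integrable_id_stdGaussian.smul ξ).smul (1 / ξ ^ 2))
  have hgrad : inexactGrad ξ φ x =
      ∫ z, gaussKernel ξ (x - z) • (φ z • ((1 / ξ ^ 2) • (z - x))) := by
    unfold inexactGrad
    simp_rw [gradient_gaussKernel_sub hξ, smul_comm (φ _) (gaussKernel ξ _)]
  have hrem : smoothed ξ φ (x + v) - smoothed ξ φ x - inner ℝ (inexactGrad ξ φ x) v =
      ∫ z, φ z * gaussRemainder ξ v (x - z) := by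
    rw [hgrad, real_inner_comm, ← integral_inner hg, smoothed, smoothed,
      ← integral_sub (hi _) (hi _), ← integral_sub (by exact (hi _).sub (hi _)) (hg.const_inner v)]
    congr 1; ext1 z
    have h1 : x + v - z = x - z + v := by abel
    have h2 : z - x = -(x - z) := by abel
    simp only [gaussRemainder, inner_smul_right, h1, h2, inner_neg_right, real_inner_comm v]
    ring
  rw [hrem, ← Real.norm_eq_abs]
  have hle : ‖∫ z, φ z * gaussRemainder ξ v (x - z)‖ₑ ≤
      ENNReal.ofReal F * ENNReal.ofReal (‖v‖ ^ 2 / ξ ^ 2) := by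
    refine (enorm_integral_le_lintegral_enorm _).trans ?_
    calc _ ≤ ∫⁻ z, ENNReal.ofReal F * ‖gaussRemainder ξ v (x - z)‖ₑ := by
          refine lintegral_mono fun z => ?_
          rw [enorm_mul]
          gcongr
          rw [← ofReal_norm]
          exact ENNReal.ofReal_le_ofReal (hφ z)
      _ = ENNReal.ofReal F * ∫⁻ w, ‖gaussRemainder ξ v w‖ₑ := by
          rw [lintegral_const_mul' _ _ ENNReal.ofReal_ne_top,
            lintegral_sub_left_eq_self (fun w => ‖gaussRemainder ξ v w‖ₑ) x]
      _ ≤ _ := by gcongr; exact lintegral_gaussRemainder_le hξ v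
  rw [← ENNReal.ofReal_mul hF, ← ofReal_norm] at hle
  have := (ENNReal.ofReal_le_ofReal_iff (by positivity)).1 hle
  calc _ ≤ _ := this
    _ = _ := by ring

/-- The quadratic remainder bound is itself the proof of differentiability; nothing is
differentiated under the integral sign. -/
lemma hasGradientAt_smoothed (hφm : AEStronglyMeasurable φ volume)
    (hφ : ∀ z, |φ z| ≤ F) (hξ : 0 < ξ) (x : Euc n) :
    HasGradientAt (smoothed ξ φ) (inexactGrad ξ φ x) x := by
  rw [hasGradientAt_iff_hasFDerivAt, hasFDerivAt_iff_isLittleO_nhds_zero]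
  have h : (fun v : Euc n => smoothed ξ φ (x + v) - smoothed ξ φ x -
      (InnerProductSpace.toDual ℝ (Euc n)) (inexactGrad ξ φ x) v) =O[𝓝 0] fun v => ‖v‖ ^ 2 := by
    refine Asymptotics.IsBigO.of_bound (F / ξ ^ 2) (Eventually.of_forall fun v => ?_)
    simpa using abs_smoothed_sub_le hφm hφ hξ x v
  exact h.trans_isLittleO (Asymptotics.isLittleO_norm_pow_id one_lt_two)

lemma abs_smoothed_le (hφ : ∀ z, |φ z| ≤ F) (hξ : 0 < ξ) (x : Euc n) :
    |smoothed ξ φ x| ≤ F := by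
  rw [smoothed_eq hξ]
  have := norm_integral_le_of_norm_le_const (μ := stdGaussian (Euc n))
    (ae_of_all _ fun u => (show ‖φ (x + ξ • u)‖ ≤ F from hφ _))
  simpa using this

/-- Pairing the gradient `G` with itself leaves `E|⟨G, u⟩| = √(2/π)‖G‖`, which avoids the
dimension-dependent `E‖u‖`. -/
lemma norm_inexactGrad_le (hφm : AEStronglyMeasurable φ volume)
    (hφ : ∀ z, |φ z| ≤ F) (hξ : 0 < ξ) (x : Euc n) :
    ‖inexactGrad ξ φ x‖ ≤ Real.sqrt (2 / Real.pi) * (F / ξ) := by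
  have hF : 0 ≤ F := (abs_nonneg _).trans (hφ 0)
  set G := inexactGrad ξ φ x with hG
  have h1 : inner ℝ G G = ∫ u, inner ℝ G (φ (x + ξ • u) • ((1 / ξ) • u))
      ∂(stdGaussian (Euc n)) := by
    rw [hG, inexactGrad_eq hξ, ← integral_inner (integrable_comp_smul_stdGaussian hφm hφ hξ x
      (by exact integrable_id_stdGaussian.smul (1 / ξ)))]
  have h2 : ‖G‖ ^ 2 ≤ F / ξ * (‖G‖ * Real.sqrt (2 / Real.pi)) := by
    rw [← real_inner_self_eq_norm_sq, h1, ← integral_abs_inner_stdGaussian, ← integral_const_mul]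
    refine (Real.le_norm_self _).trans ((norm_integral_le_integral_norm _).trans ?_)
    refine integral_mono_of_nonneg (ae_of_all _ fun u => norm_nonneg _)
      ((integrable_id_stdGaussian.const_inner G).abs.const_mul _) (ae_of_all _ fun u => ?_)
    simp only [inner_smul_right, Real.norm_eq_abs, abs_mul]
    rw [← mul_assoc, abs_of_pos (show 0 < 1 / ξ by positivity), div_eq_mul_one_div F]
    gcongr
    exact hφ _
  rcases eq_or_lt_of_le (norm_nonneg G) with h | h
  · rw [← h]; positivity
  · have : ‖G‖ * ‖G‖ ≤ (Real.sqrt (2 / Real.pi) * (F / ξ)) * ‖G‖ := by nlinarith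
    exact le_of_mul_le_mul_right this h

end bounded

/-! ### Averages of independent copies -/

section average

variable {α : Type*} [MeasurableSpace α] {γ : Measure α} [IsProbabilityMeasure γ]

lemma memLp_comp_eval_pi {E : Type*} [NormedAddCommGroup E] {p : ENNReal} {N : ℕ} {G : α → E}
    (hG : MemLp G p γ) (i : Fin N) :
    MemLp (fun u : Fin N → α => G (u i)) p (Measure.pi fun _ => γ) :=
  hG.comp_measurePreserving (measurePreserving_eval (fun _ : Fin N => γ) i)

lemma integral_comp_eval_pi {E : Type*} [NormedAddCommGroup E] [NormedSpace ℝ E] {N : ℕ}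
    {G : α → E} (hG : AEStronglyMeasurable G γ) (i : Fin N) :
    ∫ u : Fin N → α, G (u i) ∂(Measure.pi fun _ => γ) = ∫ a, G a ∂γ := by
  have h := measurePreserving_eval (fun _ : Fin N => γ) i
  have := integral_map h.measurable.aemeasurable (f := G) (by rwa [h.map_eq])
  rw [h.map_eq] at this
  exact this.symm

lemma integral_average_eq {N : ℕ} (hN : 0 < N) {G : α → Euc n} (hG : Integrable G γ) :
    ∫ u : Fin N → α, (1 / (N : ℝ)) • ∑ i, G (u i) ∂(Measure.pi fun _ => γ) = ∫ a, G a ∂γ := by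
  rw [integral_smul, integral_finsetSum _ fun i _ =>
    memLp_one_iff_integrable.1 (memLp_comp_eval_pi (memLp_one_iff_integrable.2 hG) i)]
  simp_rw [integral_comp_eval_pi hG.1]
  rw [Finset.sum_const, Finset.card_univ, Fintype.card_fin, ← Nat.cast_smul_eq_nsmul ℝ, smul_smul,
    one_div_mul_cancel (by positivity), one_smul]

lemma memLp_average_sub {N : ℕ} {G : α → Euc n} (hG : MemLp G 2 γ) (c : Euc n) :
    MemLp (fun u : Fin N → α => (1 / (N : ℝ)) • ∑ i, G (u i) - c) 2 (Measure.pi fun _ => γ) :=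
  have h1 : MemLp (fun u : Fin N → α => ∑ i, G (u i)) 2 (Measure.pi fun _ => γ) :=
    memLp_finsetSum _ fun i _ => memLp_comp_eval_pi hG i
  have h2 : MemLp (fun u : Fin N → α => (1 / (N : ℝ)) • ∑ i, G (u i)) 2
    (Measure.pi fun _ => γ) := h1.const_smul (1 / (N : ℝ))
  h2.sub (memLp_const c)

/-- The variance of a sum of independent copies is additive; the squared mean is then dropped. -/
lemma integral_average_sub_sq_le {N : ℕ} (hN : 0 < N) {X : α → ℝ} (hX : MemLp X 2 γ) :
    ∫ u : Fin N → α, ((1 / (N : ℝ)) * ∑ i, X (u i) - ∫ a, X a ∂γ) ^ 2 ∂(Measure.pi fun _ => γ) ≤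
      1 / N * ∫ a, X a ^ 2 ∂γ := by
  have hvar : Var[∑ i : Fin N, fun u : Fin N → α => X (u i); Measure.pi fun _ => γ] =
      N * Var[X; γ] := by
    rw [variance_sum_pi (X := fun _ => X) fun _ => hX]
    simp
  have hXi : ∀ i : Fin N, Integrable (fun u : Fin N → α => X (u i)) (Measure.pi fun _ => γ) :=
    fun i => (memLp_comp_eval_pi hX i).integrable one_le_two
  have hmean : ∫ u : Fin N → α, (∑ i : Fin N, fun u : Fin N → α => X (u i)) u
      ∂(Measure.pi fun _ => γ) = N * ∫ a, X a ∂γ := by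
    simp_rw [Finset.sum_apply]
    rw [integral_finsetSum _ fun i _ => hXi i]
    simp_rw [integral_comp_eval_pi hX.1]
    simp
  have hN' : (0 : ℝ) < N := by exact_mod_cast hN
  have h1 : ∫ u : Fin N → α, ((1 / (N : ℝ)) * ∑ i, X (u i) - ∫ a, X a ∂γ) ^ 2
      ∂(Measure.pi fun _ => γ) = 1 / N * Var[X; γ] := by
    rw [variance_eq_integral (memLp_finsetSum' _ fun i _ => memLp_comp_eval_pi hX i).1.aemeasurable,
      hmean] at hvar
    · have : ∀ u : Fin N → α, ((1 / (N : ℝ)) * ∑ i, X (u i) - ∫ a, X a ∂γ) ^ 2 =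
          (1 / (N : ℝ)) ^ 2 * ((∑ i : Fin N, fun u : Fin N → α => X (u i)) u -
            N * ∫ a, X a ∂γ) ^ 2 := by
        intro u
        rw [Finset.sum_apply]
        field_simp
      simp_rw [this]
      rw [integral_const_mul, hvar]
      field_simp
  rw [h1]
  gcongr
  rw [variance_eq_sub hX]
  simp only [Pi.pow_apply]
  linarith [sq_nonneg (∫ a, X a ∂γ)]

lemma integral_norm_average_sub_sq_le {N : ℕ} (hN : 0 < N) {G : α → Euc n} (hG : MemLp G 2 γ) :
    ∫ u : Fin N → α, ‖(1 / (N : ℝ)) • ∑ i, G (u i) - ∫ a, G a ∂γ‖ ^ 2 ∂(Measure.pi fun _ => γ) ≤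
      1 / N * ∫ a, ‖G a‖ ^ 2 ∂γ := by
  have hk : ∀ k : Fin n, MemLp (fun a => G a k) 2 γ := fun k =>
    (EuclideanSpace.proj (𝕜 := ℝ) k).comp_memLp' hG
  have hint : ∀ k : Fin n, (∫ a, G a ∂γ) k = ∫ a, G a k ∂γ := fun k =>
    ((EuclideanSpace.proj (𝕜 := ℝ) k).integral_comp_comm (hG.integrable one_le_two)).symm
  have hc : ∀ k : Fin n, MemLp (fun u : Fin N → α =>
      ((1 / (N : ℝ)) • ∑ i, G (u i) - ∫ a, G a ∂γ) k) 2 (Measure.pi fun _ => γ) := fun k =>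
    (EuclideanSpace.proj (𝕜 := ℝ) k).comp_memLp' (memLp_average_sub hG _)
  simp_rw [EuclideanSpace.norm_sq_eq, Real.norm_eq_abs, sq_abs]
  rw [integral_finsetSum _ fun k _ => (hc k).integrable_sq,
    integral_finsetSum _ fun k _ => (hk k).integrable_sq, Finset.mul_sum]
  refine Finset.sum_le_sum fun k _ => ?_
  have := integral_average_sub_sq_le hN (hk k)
  simpa [hint] using this

end average

/-! ### Mean and variance of the Monte Carlo estimator. -/

section estimator

variable {ξ F : ℝ} {φ : Euc n → ℝ}

lemma estimator_eq (φ : Euc n → ℝ) (N : ℕ) (x : Euc n) (u : Fin N → Euc n) :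
    estimator ξ φ N x u =
      (1 / (N : ℝ)) • ∑ i, (fun w => φ (x + ξ • w) • ((1 / ξ) • w)) (u i) := by
  simp only [estimator, Finset.smul_sum, smul_smul]
  refine Finset.sum_congr rfl fun i _ => ?_
  congr 1
  rw [one_div_mul_eq_div]
  field_simp

lemma memLp_sample (hφm : AEStronglyMeasurable φ volume) (hφ : ∀ z, |φ z| ≤ F) (hξ : 0 < ξ)
    (x : Euc n) :
    MemLp (fun w => φ (x + ξ • w) • ((1 / ξ) • w)) 2 (stdGaussian (Euc n)) := by
  have h : MemLp (fun w : Euc n => F / ξ * ‖w‖) 2 (stdGaussian (Euc n)) :=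
    (IsGaussian.memLp_id (stdGaussian (Euc n)) 2 (by simp)).norm.const_mul _
  refine h.mono' (integrable_comp_smul_stdGaussian hφm hφ hξ x
      (by exact integrable_id_stdGaussian.smul (1 / ξ))).1 (ae_of_all _ fun w => ?_)
  rw [norm_smul, norm_smul, Real.norm_of_nonneg (show 0 ≤ 1 / ξ by positivity), ← mul_assoc,
    div_eq_mul_one_div F]
  gcongr
  exact hφ _

lemma integral_norm_sample_sq_le (hφ : ∀ z, |φ z| ≤ F)
    (hξ : 0 < ξ) (x : Euc n) :
    ∫ w, ‖φ (x + ξ • w) • ((1 / ξ) • w)‖ ^ 2 ∂(stdGaussian (Euc n)) ≤ n * F ^ 2 / ξ ^ 2 := by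
  have hF : 0 ≤ F := (abs_nonneg _).trans (hφ 0)
  calc _ ≤ ∫ w : Euc n, (F / ξ) ^ 2 * ‖w‖ ^ 2 ∂(stdGaussian (Euc n)) := by
        refine integral_mono_of_nonneg (ae_of_all _ fun w => by positivity)
          ((integrable_norm_pow_stdGaussian 2).const_mul _) (ae_of_all _ fun w => ?_)
        simp only [norm_smul, Real.norm_of_nonneg (show 0 ≤ 1 / ξ by positivity)]
        rw [← mul_pow, ← mul_assoc, div_eq_mul_one_div F]
        gcongr
        exact hφ _
    _ = _ := by
        rw [integral_const_mul, integral_norm_sq_stdGaussian]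
        ring

lemma integrable_estimator (hφm : AEStronglyMeasurable φ volume) (hφ : ∀ z, |φ z| ≤ F)
    (hξ : 0 < ξ) (N : ℕ) (x : Euc n) :
    Integrable (estimator ξ φ N x) (Measure.pi fun _ : Fin N => stdGaussian (Euc n)) := by
  have h := (memLp_average_sub (N := N) (memLp_sample hφm hφ hξ x) 0).integrable one_le_two
  refine h.congr (ae_of_all _ fun u => ?_)
  simp only [estimator_eq, sub_zero]

lemma integral_estimator (hφm : AEStronglyMeasurable φ volume) (hφ : ∀ z, |φ z| ≤ F)
    (hξ : 0 < ξ) {N : ℕ} (hN : 0 < N) (x : Euc n) :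
    ∫ u, estimator ξ φ N x u ∂(Measure.pi fun _ : Fin N => stdGaussian (Euc n)) =
      inexactGrad ξ φ x := by
  simp_rw [estimator_eq]
  rw [integral_average_eq hN ((memLp_sample hφm hφ hξ x).integrable one_le_two),
    inexactGrad_eq hξ]

lemma integrable_norm_estimator_sub_sq (hφm : AEStronglyMeasurable φ volume)
    (hφ : ∀ z, |φ z| ≤ F) (hξ : 0 < ξ) (N : ℕ) (x c : Euc n) :
    Integrable (fun u => ‖estimator ξ φ N x u - c‖ ^ 2)
      (Measure.pi fun _ : Fin N => stdGaussian (Euc n)) := by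
  simp_rw [estimator_eq]
  exact (memLp_average_sub (memLp_sample hφm hφ hξ x) c).integrable_norm_pow two_ne_zero

lemma integral_norm_estimator_sub_sq_le (hφm : AEStronglyMeasurable φ volume)
    (hφ : ∀ z, |φ z| ≤ F) (hξ : 0 < ξ) {N : ℕ} (hN : 0 < N) (x : Euc n) :
    ∫ u, ‖estimator ξ φ N x u - inexactGrad ξ φ x‖ ^ 2
      ∂(Measure.pi fun _ : Fin N => stdGaussian (Euc n)) ≤ n * F ^ 2 / (N * ξ ^ 2) := by
  simp_rw [estimator_eq, inexactGrad_eq hξ]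
  refine (integral_norm_average_sub_sq_le hN (memLp_sample hφm hφ hξ x)).trans ?_
  calc _ ≤ 1 / (N : ℝ) * (n * F ^ 2 / ξ ^ 2) := by
        gcongr
        exact integral_norm_sample_sq_le hφ hξ x
    _ = _ := by field_simp

end estimator

/-! ### One step of the cubic-regularized Newton method -/

section cubic

variable {E : Type*} [NormedAddCommGroup E] [InnerProductSpace ℝ E]

/-- `G` and `H` are the gradient and the Hessian of `q`, and `H` is Lipschitz with constant `M`. -/
structure IsLipschitzHessian [CompleteSpace E] (q : E → ℝ) (G : E → E) (H : E → E →L[ℝ] E)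
    (M : ℝ) : Prop where
  hasGradientAt : ∀ y, HasGradientAt q (G y) y
  hasFDerivAt : ∀ y, HasFDerivAt G (H y) y
  symm : ∀ y v w, inner ℝ (H y v) w = inner ℝ v (H y w)
  lipschitz : ∀ y y', ‖H y - H y'‖ ≤ M * ‖y - y'‖

/-- Comparison with the primitive of `C t^k`. It serves for Taylor remainders along a segment: `k =
1` for the gradient, `k = 2` for the function. -/
lemma norm_le_of_deriv_bound {F : Type*} [NormedAddCommGroup F] [NormedSpace ℝ F]
    {f f' : ℝ → F} (C : ℝ) (k : ℕ) (hf : ∀ t, HasDerivAt f (f' t) t) (h0 : f 0 = 0)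
    (hb : ∀ t, 0 ≤ t → ‖f' t‖ ≤ C * t ^ k) : ‖f 1‖ ≤ C / (k + 1) := by
  have hB : ∀ t, HasDerivAt (fun t : ℝ => C / (k + 1) * t ^ (k + 1)) (C * t ^ k) t := by
    intro t
    refine ((hasDerivAt_pow (k + 1) t).const_mul (C / (k + 1))).congr_deriv ?_
    have : (k : ℝ) + 1 ≠ 0 := by positivity
    push_cast
    field_simp
  have := image_norm_le_of_norm_deriv_right_le_deriv_boundary (f := f) (a := 0) (b := 1)
    (fun t _ => (hf t).continuousAt.continuousWithinAt) (fun t _ => (hf t).hasDerivWithinAt)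
    (B := fun t : ℝ => C / (k + 1) * t ^ (k + 1)) (by simp [h0]) hB (fun t ht => hb t ht.1)
    (Set.right_mem_Icc.2 zero_le_one)
  simpa using this

variable {M : ℝ}

/-- First-order optimality condition for the cubic model. -/
lemma cubic_first_order {a s : E} {A : E →L[ℝ] E} (hA : ∀ v w, inner ℝ (A v) w = inner ℝ v (A w))
    (hs : ∀ t, inner ℝ a s + 1 / 2 * inner ℝ (A s) s + M / 6 * ‖s‖ ^ 3 ≤
      inner ℝ a t + 1 / 2 * inner ℝ (A t) t + M / 6 * ‖t‖ ^ 3) :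
    a + A s + (M / 2 * ‖s‖) • s = 0 := by
  have h1 : HasFDerivAt (fun t : E => (inner ℝ a t : ℝ)) (innerSL ℝ a : E →L[ℝ] ℝ) s :=
    (innerSL ℝ a : E →L[ℝ] ℝ).hasFDerivAt
  have h2 := (A.hasFDerivAt (x := s)).inner ℝ (hasFDerivAt_id s)
  have h3 : HasFDerivAt (fun t : E => ‖t‖ ^ 3) ((3 * ‖s‖) • (innerSL ℝ s : E →L[ℝ] ℝ)) s := by
    have := hasFDerivAt_norm_rpow s (p := 3) (by norm_num)
    norm_num at this
    exact_mod_cast this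
  have h4 := (h1.add (h2.const_mul (1 / 2))).add (h3.const_mul (M / 6))
  have hmin : IsLocalMin (fun t : E => inner ℝ a t + 1 / 2 * inner ℝ (A t) t + M / 6 * ‖t‖ ^ 3) s :=
    Eventually.of_forall hs
  have h5 := hmin.hasFDerivAt_eq_zero h4
  refine ext_inner_right ℝ fun v => ?_
  have h6 := congrArg (fun L : E →L[ℝ] ℝ => L v) h5
  simp [fderivInnerCLM_apply] at h6
  rw [inner_zero_left, inner_add_left, inner_add_left, real_inner_smul_left]
  rw [hA v s, real_inner_comm (A s) v] at h6
  linarith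

/-- Second-order optimality condition for global minimizers of the cubic model. -/
lemma cubic_second_order {a s : E} {A : E →L[ℝ] E} (hM : 0 < M)
    (hA : ∀ v w, inner ℝ (A v) w = inner ℝ v (A w))
    (hs : ∀ t, inner ℝ a s + 1 / 2 * inner ℝ (A s) s + M / 6 * ‖s‖ ^ 3 ≤
      inner ℝ a t + 1 / 2 * inner ℝ (A t) t + M / 6 * ‖t‖ ^ 3) (v : E) :
    -(M / 2 * ‖s‖) * ‖v‖ ^ 2 ≤ inner ℝ (A v) v := by
  have hfirst := cubic_first_order hA hs
  have ha : a = -(A s + (M / 2 * ‖s‖) • s) := by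
    rw [eq_neg_iff_add_eq_zero, ← add_assoc]; exact hfirst
  rcases eq_or_ne s 0 with rfl | hs0
  · have ha0 : a = 0 := by simpa using ha
    subst ha0
    simp only [inner_zero_left, norm_zero, mul_zero, neg_zero, zero_mul, zero_add, map_zero] at hs ⊢
    by_contra! hneg
    have hv : 0 < ‖v‖ := by
      rw [norm_pos_iff]; rintro rfl; simp at hneg
    set c := inner ℝ (A v) v
    -- For this step length the cubic term is `τ²(-c)/6`, too small to offset the quadratic term
    -- `τ²c/2`, so the model would be negative at `τ • v`.
    set τ : ℝ := -c / (M * ‖v‖ ^ 3)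
    have hτ : 0 < τ := div_pos (by linarith) (by positivity)
    have h1 := hs (τ • v)
    rw [map_smul, real_inner_smul_left, real_inner_smul_right, norm_smul, Real.norm_of_nonneg hτ.le]
      at h1
    have h2 : M * ‖v‖ ^ 3 * τ = -c := by
      simp only [τ]; field_simp
    have h3 : (τ * ‖v‖) ^ 3 * (M / 6) = τ ^ 2 * (-c) / 6 := by rw [← h2]; ring
    have h4 : 0 < τ ^ 2 * (-c) := mul_pos (by positivity) (by linarith)
    norm_num at h1
    nlinarith
  -- On the sphere through `s` the cubic terms cancel, and the first-order condition eliminates `a`.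
  · have hsph : ∀ t, ‖t‖ = ‖s‖ →
        0 ≤ inner ℝ (A (t - s)) (t - s) + M / 2 * ‖s‖ * ‖t - s‖ ^ 2 := by
      intro t ht
      have h1 := hs t
      rw [ht, ha] at h1
      have h2 : ‖t - s‖ ^ 2 = 2 * ‖s‖ ^ 2 - 2 * inner ℝ s t := by
        rw [norm_sub_sq_real, ht, real_inner_comm]; ring
      have h3 := hA s t
      rw [h2]
      simp only [inner_neg_left, inner_add_left, real_inner_smul_left, map_sub, inner_sub_left,
        inner_sub_right, real_inner_self_eq_norm_sq] at h1 ⊢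
      rw [real_inner_comm s (A t)] at *
      linarith
    have hnonorth : ∀ v, inner ℝ s v ≠ 0 →
        0 ≤ inner ℝ (A v) v + M / 2 * ‖s‖ * ‖v‖ ^ 2 := by
      intro v hv
      have hv0 : v ≠ 0 := by rintro rfl; simp at hv
      have hvn : 0 < ‖v‖ := norm_pos_iff.2 hv0
      -- With this `c`, `s + c • v` is the reflection of `s` in the hyperplane orthogonal to `v`,
      -- hence on the sphere.
      set c : ℝ := -2 * inner ℝ s v / ‖v‖ ^ 2
      have hc : c ≠ 0 := by simp only [c]; positivity
      have h1 : ‖s + c • v‖ = ‖s‖ := by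
        rw [← sq_eq_sq₀ (norm_nonneg _) (norm_nonneg _), norm_add_sq_real, norm_smul,
          real_inner_smul_right, mul_pow, Real.norm_eq_abs, sq_abs]
        simp only [c]
        field_simp
        ring
      have h2 := hsph _ h1
      rw [add_sub_cancel_left, map_smul, real_inner_smul_left, real_inner_smul_right, norm_smul,
        mul_pow, Real.norm_eq_abs, sq_abs] at h2
      have h3 : 0 ≤ c ^ 2 * (inner ℝ (A v) v + M / 2 * ‖s‖ * ‖v‖ ^ 2) := by
        calc _ ≤ _ := h2
          _ = _ := by ring
      exact nonneg_of_mul_nonneg_right h3 (by positivity)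
    suffices 0 ≤ inner ℝ (A v) v + M / 2 * ‖s‖ * ‖v‖ ^ 2 by linarith
    by_cases hv : inner ℝ s v = 0
    -- A direction orthogonal to `s` is the limit of the non-orthogonal directions `v + τ • s`.
    · have hcont : Tendsto (fun τ : ℝ => inner ℝ (A (v + τ • s)) (v + τ • s) +
          M / 2 * ‖s‖ * ‖v + τ • s‖ ^ 2) (𝓝[>] 0)
          (𝓝 (inner ℝ (A v) v + M / 2 * ‖s‖ * ‖v‖ ^ 2)) := by
        have : Continuous (fun τ : ℝ => inner ℝ (A (v + τ • s)) (v + τ • s) +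
          M / 2 * ‖s‖ * ‖v + τ • s‖ ^ 2) := by fun_prop
        simpa using (this.tendsto 0).mono_left nhdsWithin_le_nhds
      refine ge_of_tendsto hcont ?_
      filter_upwards [self_mem_nhdsWithin] with τ hτ
      apply hnonorth
      rw [inner_add_right, hv, zero_add, real_inner_smul_right, real_inner_self_eq_norm_sq]
      have : (0 : ℝ) < τ := hτ
      have : 0 < ‖s‖ := norm_pos_iff.2 hs0
      positivity
    · exact hnonorth v hv

/-- The infimum of the Rayleigh quotient of a symmetric operator in finite dimension is an
eigenvalue. -/
lemma symmetric_inner_ge [FiniteDimensional ℝ E] {A : E →L[ℝ] E}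
    (hA : ∀ v w, inner ℝ (A v) w = inner ℝ v (A w)) {c : ℝ}
    (hc : ∀ l : ℝ, Module.End.HasEigenvalue (A : E →ₗ[ℝ] E) l → c ≤ l) (v : E) :
    c * ‖v‖ ^ 2 ≤ inner ℝ (A v) v := by
  rcases eq_or_ne v 0 with rfl | hv
  · simp
  have : Nontrivial E := ⟨v, 0, hv⟩
  have hsym : (A : E →ₗ[ℝ] E).IsSymmetric := hA
  have h1 := hc _ hsym.hasEigenvalue_iInf_of_finiteDimensional
  have hb : BddBelow (Set.range fun x : { v : E // v ≠ 0 } =>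
      RCLike.re (inner ℝ ((A : E →ₗ[ℝ] E) (x : E)) (x : E)) / ‖(x : E)‖ ^ 2) := by
    refine ⟨-‖A‖, ?_⟩
    rintro _ ⟨x, rfl⟩
    have hx : 0 < ‖(x : E)‖ := norm_pos_iff.2 x.2
    simp only [ContinuousLinearMap.coe_coe, RCLike.re_to_real]
    rw [le_div_iff₀ (by positivity)]
    have h2 := (abs_le.1 (abs_real_inner_le_norm (A x) x)).1
    nlinarith [mul_le_mul_of_nonneg_right (A.le_opNorm x) hx.le]
  have h2 := h1.trans (ciInf_le hb ⟨v, hv⟩)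
  have hx : 0 < ‖v‖ := norm_pos_iff.2 hv
  rwa [le_div_iff₀ (by positivity)] at h2

variable [CompleteSpace E] {q : E → ℝ} {G : E → E} {H : E → E →L[ℝ] E}

lemma IsLipschitzHessian.norm_gradient_sub_le (h : IsLipschitzHessian q G H M) (y s : E) :
    ‖G (y + s) - G y - H y s‖ ≤ M / 2 * ‖s‖ ^ 2 := by
  have hc : ∀ t : ℝ, HasDerivAt (fun t : ℝ => y + t • s) s t := fun t => by
    simpa using ((hasDerivAt_id t).smul_const s).const_add y
  have hd : ∀ t : ℝ, HasDerivAt (fun t : ℝ => G (y + t • s) - G y - t • H y s)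
      (H (y + t • s) s - H y s) t := fun t => by
    have h1 := (h.hasFDerivAt (y + t • s)).comp_hasDerivAt t (hc t)
    have h2 := (hasDerivAt_id t).smul_const (H y s)
    exact ((h1.sub_const (G y)).sub h2).congr_deriv (by simp)
  have := norm_le_of_deriv_bound (M * ‖s‖ ^ 2) 1 hd (by simp) (fun t ht => by
    rw [← sub_apply]
    refine (ContinuousLinearMap.le_of_opNorm_le _ (h.lipschitz _ _) s).trans_eq ?_
    rw [add_sub_cancel_left, norm_smul, Real.norm_of_nonneg ht]
    ring)
  simp only [one_smul] at this
  refine this.trans_eq ?_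
  norm_num
  ring

lemma IsLipschitzHessian.abs_sub_le (h : IsLipschitzHessian q G H M) (y s : E) :
    |q (y + s) - q y - inner ℝ (G y) s - 1 / 2 * inner ℝ (H y s) s| ≤ M / 6 * ‖s‖ ^ 3 := by
  have hc : ∀ t : ℝ, HasDerivAt (fun t : ℝ => y + t • s) s t := fun t => by
    simpa using ((hasDerivAt_id t).smul_const s).const_add y
  have hd : ∀ t : ℝ, HasDerivAt (fun t : ℝ => q (y + t • s) - q y - t * inner ℝ (G y) s -
      t ^ 2 * (1 / 2 * inner ℝ (H y s) s)) (inner ℝ (G (y + t • s) - G y - H y (t • s)) s) t :=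
    fun t => by
    have h1 := (h.hasGradientAt (y + t • s)).hasFDerivAt.comp_hasDerivAt t (hc t)
    have h2 := (hasDerivAt_id t).mul_const (inner ℝ (G y) s)
    have h3 := (hasDerivAt_pow 2 t).mul_const (1 / 2 * inner ℝ (H y s) s)
    refine (((h1.sub_const (q y)).sub h2).sub h3).congr_deriv ?_
    rw [InnerProductSpace.toDual_apply_apply, map_smul, inner_sub_left, inner_sub_left,
      real_inner_smul_left]
    norm_num
    ring
  have := norm_le_of_deriv_bound (M / 2 * ‖s‖ ^ 3) 2 hd (by simp) (fun t ht => by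
    refine (norm_inner_le_norm _ _).trans ?_
    refine (mul_le_mul_of_nonneg_right (h.norm_gradient_sub_le y (t • s))
      (norm_nonneg s)).trans_eq ?_
    rw [norm_smul, Real.norm_of_nonneg ht]
    ring)
  simp only [one_smul, Real.norm_eq_abs, one_mul, one_pow] at this
  refine this.trans_eq ?_
  norm_num
  ring

/-- Sufficient decrease in one step. -/
lemma IsLipschitzHessian.cubic_decrease (h : IsLipschitzHessian q G H M) (hM : 0 < M) {y s : E}
    (hs : ∀ t, inner ℝ (G y) s + 1 / 2 * inner ℝ (H y s) s + M / 6 * ‖s‖ ^ 3 ≤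
      inner ℝ (G y) t + 1 / 2 * inner ℝ (H y t) t + M / 6 * ‖t‖ ^ 3) :
    q (y + s) ≤ q y - M / 12 * ‖s‖ ^ 3 := by
  have h1 := (abs_le.1 (h.abs_sub_le y s)).2
  have h2 := cubic_second_order hM (h.symm y) hs s
  have h3 := congrArg (fun v => inner ℝ v s) (cubic_first_order (h.symm y) hs)
  simp only [inner_add_left, real_inner_smul_left, real_inner_self_eq_norm_sq, inner_zero_left]
    at h3
  nlinarith

/-- The first-order condition says that the linearized gradient at `y + s` is `-(M/2)‖s‖ s`; the
linearization error is another `(M/2)‖s‖²`. -/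
lemma IsLipschitzHessian.norm_gradient_next_le (h : IsLipschitzHessian q G H M) (hM : 0 < M)
    {y s : E} (hs : ∀ t, inner ℝ (G y) s + 1 / 2 * inner ℝ (H y s) s + M / 6 * ‖s‖ ^ 3 ≤
      inner ℝ (G y) t + 1 / 2 * inner ℝ (H y t) t + M / 6 * ‖t‖ ^ 3) :
    ‖G (y + s)‖ ≤ M * ‖s‖ ^ 2 := by
  have h1 := cubic_first_order (h.symm y) hs
  have h2 : G (y + s) = (G (y + s) - G y - H y s) - (M / 2 * ‖s‖) • s := by
    have : (M / 2 * ‖s‖) • s = -(G y + H y s) := by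
      rw [eq_neg_iff_add_eq_zero, add_comm]; exact h1
    rw [this]; abel
  rw [h2]
  refine (norm_sub_le _ _).trans ?_
  have h3 := h.norm_gradient_sub_le y s
  rw [norm_smul, Real.norm_of_nonneg (by positivity)]
  nlinarith

lemma IsLipschitzHessian.inner_hessian_ge (h : IsLipschitzHessian q G H M) (y y' v : E) :
    inner ℝ (H y v) v - M * ‖y' - y‖ * ‖v‖ ^ 2 ≤ inner ℝ (H y' v) v := by
  have h1 := ContinuousLinearMap.le_of_opNorm_le _ (h.lipschitz y' y) v
  have h2 := (abs_le.1 (abs_real_inner_le_norm ((H y' - H y) v) v)).1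
  rw [sub_apply, inner_sub_left] at h2
  rw [sub_apply] at h1
  have := mul_le_mul_of_nonneg_right h1 (norm_nonneg v)
  nlinarith

/-- Near a nondegenerate minimizer, the distance to it contracts in each step. -/
lemma IsLipschitzHessian.cubic_contraction (h : IsLipschitzHessian q G H M) (hM : 0 < M)
    {y s z : E} {μ : ℝ} (hz : G z = 0)
    (hH : ∀ v, μ * ‖v‖ ^ 2 ≤ inner ℝ (H z v) v) (hyz : ‖y - z‖ ≤ μ / (2 * M))
    (hs : ∀ t, inner ℝ (G y) s + 1 / 2 * inner ℝ (H y s) s + M / 6 * ‖s‖ ^ 3 ≤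
      inner ℝ (G y) t + 1 / 2 * inner ℝ (H y t) t + M / 6 * ‖t‖ ^ 3) :
    ‖y + s - z‖ ≤ 3 / 4 * ‖y - z‖ := by
  have h1 := cubic_first_order (h.symm y) hs
  set e := y - z with he
  set w := y + s - z with hw
  have hwe : w = e + s := by simp only [hw, he]; abel
  have h2 := h.norm_gradient_sub_le y (-e)
  have hyez : y + -e = z := by simp [he]
  rw [hyez, hz, norm_neg] at h2
  set d := 0 - G y - H y (-e) with hd
  -- The first-order condition in terms of the old error `e` and the new error `w`; here `d` is a
  -- Taylor remainder with `‖d‖ ≤ (M/2)‖e‖²`.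
  have h3 : H y w + (M / 2 * ‖s‖) • w = d + (M / 2 * ‖s‖) • e := by
    have h1' : G y = -(H y s + (M / 2 * ‖s‖) • s) := by
      rw [eq_neg_iff_add_eq_zero, ← add_assoc]; exact h1
    rw [hd, h1', hwe, map_add, map_neg, smul_add]
    abel
  have h4 := congrArg (fun v => inner ℝ v w) h3
  simp only [inner_add_left, real_inner_smul_left, real_inner_self_eq_norm_sq] at h4
  have h5 := h.inner_hessian_ge z y w
  have h6 := hH w
  have h7 : inner ℝ d w ≤ M / 2 * ‖e‖ ^ 2 * ‖w‖ :=
    (real_inner_le_norm d w).trans (mul_le_mul_of_nonneg_right h2 (norm_nonneg w))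
  have h8 := real_inner_le_norm e w
  have h9 : ‖w‖ ≤ ‖e‖ + ‖s‖ := by rw [hwe]; exact norm_add_le _ _
  have h10 : ‖s‖ ≤ ‖e‖ + ‖w‖ := by
    have : s = w - e := by rw [hwe]; abel
    rw [this]; linarith [norm_sub_le w e]
  have hMe : 2 * M * ‖e‖ ≤ μ := by
    rw [le_div_iff₀ (by positivity)] at hyz; linarith
  have hr := norm_nonneg s
  have hen := norm_nonneg e
  rcases eq_or_lt_of_le (norm_nonneg w) with h0 | h0
  · rw [← h0]; positivity
  -- Tested against `w`, with the Hessian at `y` bounded below by `μ - M‖e‖ ≥ M‖e‖`.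
  have h11 : (2 * ‖e‖ + ‖s‖) * ‖w‖ ≤ ‖e‖ * (‖e‖ + ‖s‖) := by
    have hp : M / 2 * ‖s‖ * inner ℝ e w ≤ M / 2 * ‖s‖ * (‖e‖ * ‖w‖) := by gcongr
    have hq : (μ - M * ‖e‖ + M / 2 * ‖s‖) * ‖w‖ ^ 2 ≤
        (M / 2 * ‖e‖ ^ 2 + M / 2 * ‖s‖ * ‖e‖) * ‖w‖ := by
      rw [← he] at h5
      linarith
    have hq2 : (M * ‖e‖ + M / 2 * ‖s‖) * ‖w‖ ^ 2 ≤ (μ - M * ‖e‖ + M / 2 * ‖s‖) * ‖w‖ ^ 2 := by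
      gcongr; linarith
    have hq3 : (M / 2 * ‖w‖) * ((2 * ‖e‖ + ‖s‖) * ‖w‖) ≤
        (M / 2 * ‖w‖) * (‖e‖ * (‖e‖ + ‖s‖)) := by nlinarith
    exact le_of_mul_le_mul_left hq3 (by positivity)
  -- This first bound yields `‖s‖ ≤ 2‖e‖`, for which `(‖e‖ + ‖s‖)/(2‖e‖ + ‖s‖)` is at most `3/4`.
  have h12 : ‖w‖ ≤ ‖e‖ := by
    by_contra! hlt
    have : 0 < 2 * ‖e‖ + ‖s‖ := by linarith
    nlinarith
  by_contra! hlt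
  have : 0 < 2 * ‖e‖ + ‖s‖ := by linarith
  nlinarith

/-- The linear part has norm at least `μ‖y - z‖`, and on this ball the remainder `(M/2)‖y - z‖²`
takes away at most a quarter of it. -/
lemma IsLipschitzHessian.norm_gradient_ge (h : IsLipschitzHessian q G H M) (hM : 0 < M)
    {y z : E} {μ : ℝ} (hz : G z = 0)
    (hH : ∀ v, μ * ‖v‖ ^ 2 ≤ inner ℝ (H z v) v) (hyz : ‖y - z‖ ≤ μ / (2 * M)) :
    3 / 4 * μ * ‖y - z‖ ≤ ‖G y‖ := by
  set e := y - z with he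
  have h2 := h.norm_gradient_sub_le z e
  rw [he, add_sub_cancel, ← he, hz, sub_zero] at h2
  have h3 : μ * ‖e‖ ≤ ‖H z e‖ := by
    rcases eq_or_lt_of_le (norm_nonneg e) with h0 | h0
    · rw [← h0]; simp
    have := (hH e).trans (real_inner_le_norm _ _)
    exact le_of_mul_le_mul_right (by nlinarith) h0
  have h4 : ‖H z e‖ ≤ ‖G y‖ + ‖G y - H z e‖ := by
    have := norm_sub_le (G y) (G y - H z e)
    simpa using this
  have hMe : 2 * M * ‖e‖ ≤ μ := by
    rw [le_div_iff₀ (by positivity)] at hyz; linarith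
  nlinarith [mul_le_mul_of_nonneg_right hMe (norm_nonneg e)]

end cubic

/-! ### Regularity of the lower-level problem -/

section regularity

variable {X : Set (Euc n)} {g : Euc n → Euc m → ℝ} {M : ℝ}

lemma contDiff_section (hg : ContDiffOn ℝ 2 (fun p : Euc n × Euc m => g p.1 p.2) (X ×ˢ Set.univ))
    {x : Euc n} (hx : x ∈ X) : ContDiff ℝ 2 (g x) := by
  rw [← contDiffOn_univ]
  exact hg.comp (f := fun y : Euc m => (x, y)) (by fun_prop) fun y _ => ⟨hx, trivial⟩

lemma inner_gradY (x : Euc n) (y v : Euc m) :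
    inner ℝ (gradY g x y) v = fderiv ℝ (g x) y v := by
  rw [gradY, gradient, InnerProductSpace.toDual_symm_apply]

lemma gradY_eq_sum (x : Euc n) (y : Euc m) :
    gradY g x y = ∑ i, (fderiv ℝ (g x) y (EuclideanSpace.single i 1)) •
      EuclideanSpace.single i (1 : ℝ) := by
  ext j
  simp_rw [← inner_gradY]
  simp [EuclideanSpace.inner_single_right, Pi.single_apply]

lemma isLipschitzHessian_section
    (hg : ContDiffOn ℝ 2 (fun p : Euc n × Euc m => g p.1 p.2) (X ×ˢ Set.univ))
    (hHess : ∀ x ∈ X, ∀ x' ∈ X, ∀ y y' : Euc m,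
      ‖hessY g x y - hessY g x' y'‖ ≤ M * Real.sqrt (‖x - x'‖ ^ 2 + ‖y - y'‖ ^ 2))
    {x : Euc n} (hx : x ∈ X) : IsLipschitzHessian (g x) (gradY g x) (hessY g x) M := by
  have hc := contDiff_section hg hx
  have hfd : ContDiff ℝ 1 (fderiv ℝ (g x)) := hc.fderiv_right (by norm_num)
  have hgrad : Differentiable ℝ (gradY g x) := by
    have h1 : gradY g x = fun y => ∑ i, (fderiv ℝ (g x) y (EuclideanSpace.single i 1)) •
      EuclideanSpace.single i (1 : ℝ) := funext fun y => gradY_eq_sum x y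
    have h2 := hfd.differentiable one_ne_zero
    rw [h1]
    fun_prop
  refine ⟨fun y => ((hc.differentiable two_ne_zero) y).hasGradientAt,
    fun y => (hgrad y).hasFDerivAt, fun y v w => ?_, fun y y' => ?_⟩
  · have hD : ∀ y, HasFDerivAt (fderiv ℝ (g x)) (fderiv ℝ (fderiv ℝ (g x)) y) y := fun y =>
      ((hfd.differentiable one_ne_zero) y).hasFDerivAt
    have hval : ∀ v w, inner ℝ (hessY g x y v) w = fderiv ℝ (fderiv ℝ (g x)) y v w := by
      intro v w
      have h1 := ((hgrad y).hasFDerivAt).inner ℝ (hasFDerivAt_const w y)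
      have h2 := (hD y).clm_apply (hasFDerivAt_const w y)
      have h3 : (fun y => inner ℝ (gradY g x y) w) = fun y => fderiv ℝ (g x) y w :=
        funext fun y => inner_gradY x y w
      rw [h3] at h1
      have h4 := congrArg (fun L : Euc m →L[ℝ] ℝ => L v) (h1.unique h2)
      simpa [fderivInnerCLM_apply, hessY] using h4
    rw [hval, real_inner_comm, hval]
    exact second_derivative_symmetric
      (fun y => ((hc.differentiable two_ne_zero) y).hasFDerivAt) (hD y) v w
  · simpa [Real.sqrt_sq (norm_nonneg _)] using hHess x hx x hx y y'

/-- `X` may have empty interior, so only derivatives within `X ×ˢ univ` are at hand. Any such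
derivative restricts to the true derivative in `y`, since the whole fibre `{x} × ℝ^m` lies in the
domain. -/
lemma continuousOn_gradY
    (hg : ContDiffOn ℝ 2 (fun p : Euc n × Euc m => g p.1 p.2) (X ×ˢ Set.univ)) :
    ContinuousOn (fun p : Euc n × Euc m => gradY g p.1 p.2) (X ×ˢ Set.univ) := by
  intro p hp
  have h1 := (hg p hp).of_le (show (1 : WithTop ℕ∞) ≤ 2 by norm_num)
  obtain ⟨u, hu, hus, -, f', hf', hcf'⟩ :=
    (contDiffWithinAt_succ_iff_hasFDerivWithinAt' (n := 0) (by simp)).1 (by simpa using h1)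
  rw [Set.insert_eq_of_mem hp] at hu hus
  have hfd : ∀ z ∈ u, ∀ v, fderiv ℝ (g z.1) z.2 v = f' z (0, v) := by
    intro z hz v
    have h2 : HasFDerivAt (fun y : Euc m => (z.1, y)) (ContinuousLinearMap.inr ℝ (Euc n) (Euc m))
        z.2 := hasFDerivAt_prodMk_right z.1 z.2
    have h3 : HasFDerivWithinAt (g z.1) ((f' z).comp (ContinuousLinearMap.inr ℝ _ _))
        Set.univ z.2 :=
      HasFDerivWithinAt.comp (g := fun p : Euc n × Euc m => g p.1 p.2) (t := X ×ˢ Set.univ)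
        z.2 (hf' z hz) h2.hasFDerivWithinAt fun y _ => ⟨(hus hz).1, trivial⟩
    rw [hasFDerivWithinAt_univ] at h3
    rw [h3.fderiv]
    simp
  have hc : ContinuousWithinAt (fun z : Euc n × Euc m =>
      ∑ i, f' z (0, EuclideanSpace.single i 1) • EuclideanSpace.single i (1 : ℝ))
      (X ×ˢ Set.univ) p := by
    have := hcf'.continuousWithinAt
    exact tendsto_finsetSum _ fun i _ =>
      (this.clm_apply continuousWithinAt_const).smul continuousWithinAt_const
  have heq : ∀ z ∈ u, gradY g z.1 z.2 =
      ∑ i, f' z (0, EuclideanSpace.single i 1) • EuclideanSpace.single i (1 : ℝ) := by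
    intro z hz
    rw [gradY_eq_sum]
    simp_rw [hfd z hz]
  refine hc.congr_of_eventuallyEq ?_ (heq p (mem_of_mem_nhdsWithin hp hu))
  filter_upwards [hu] with z hz using heq z hz

lemma continuousOn_hessY (hHess : ∀ x ∈ X, ∀ x' ∈ X, ∀ y y' : Euc m,
      ‖hessY g x y - hessY g x' y'‖ ≤ M * Real.sqrt (‖x - x'‖ ^ 2 + ‖y - y'‖ ^ 2)) :
    ContinuousOn (fun p : Euc n × Euc m => hessY g p.1 p.2) (X ×ˢ Set.univ) := by
  intro p hp
  rw [ContinuousWithinAt, tendsto_iff_norm_sub_tendsto_zero]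
  have hc : Tendsto (fun z : Euc n × Euc m =>
      M * Real.sqrt (‖z.1 - p.1‖ ^ 2 + ‖z.2 - p.2‖ ^ 2)) (𝓝[X ×ˢ Set.univ] p) (𝓝 0) := by
    have : Continuous (fun z : Euc n × Euc m =>
      M * Real.sqrt (‖z.1 - p.1‖ ^ 2 + ‖z.2 - p.2‖ ^ 2)) := by fun_prop
    simpa using (this.tendsto p).mono_left nhdsWithin_le_nhds
  refine squeeze_zero' (Eventually.of_forall fun _ => norm_nonneg _) ?_ hc
  filter_upwards [self_mem_nhdsWithin] with z hz
  exact hHess _ hz.1 _ hp.1 _ _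

end regularity

/-! ### The output of the lower-level method -/

section lower

variable {X : Set (Euc n)} {Y Y' : Set (Euc m)} {g : Euc n → Euc m → ℝ} {M : ℝ} {y₀ : Euc m}
  {yseq yhat : ℕ → Euc n → Euc m} {x : Euc n}

lemma minEigenvalue_ge {A : Euc m →L[ℝ] Euc m} {c : ℝ} (hc : 0 ≤ c)
    (hA : ∀ v, -c * ‖v‖ ^ 2 ≤ inner ℝ (A v) v) : -c ≤ minEigenvalue A := by
  unfold minEigenvalue
  rcases Set.eq_empty_or_nonempty
    {l : ℝ | Module.End.HasEigenvalue (A : Euc m →ₗ[ℝ] Euc m) l} with h | h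
  -- For `m = 0` there are no eigenvalues and `sInf ∅ = 0`; this is where `0 ≤ c` is needed.
  · rw [h, Real.sInf_empty]; linarith
  · refine le_csInf h fun l hl => ?_
    obtain ⟨v, hv⟩ := hl.exists_hasEigenvector
    have h1 := hA v
    have h2 : A v = l • v := hv.apply_eq_smul
    rw [h2, real_inner_smul_left, real_inner_self_eq_norm_sq] at h1
    exact le_of_mul_le_mul_right h1 (by have := norm_pos_iff.2 hv.2; positivity)

lemma minEigenvalue_mul_le {A : Euc m →L[ℝ] Euc m}
    (hA : ∀ v w, inner ℝ (A v) w = inner ℝ v (A w)) (v : Euc m) :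
    minEigenvalue A * ‖v‖ ^ 2 ≤ inner ℝ (A v) v := by
  refine symmetric_inner_ge hA (fun l hl => csInf_le ?_ hl) v
  refine ⟨-‖A‖, fun l hl => ?_⟩
  obtain ⟨v, hv⟩ := Module.End.HasEigenvalue.exists_hasEigenvector hl
  have h2 : A v = l • v := hv.apply_eq_smul
  have h3 := A.le_opNorm v
  rw [h2, norm_smul] at h3
  have := le_of_mul_le_mul_right h3 (norm_pos_iff.2 hv.2)
  exact (abs_le.1 this).1

lemma stationarity_nonneg (g : Euc n → Euc m → ℝ) (M : ℝ) (x : Euc n) (y : Euc m) :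
    0 ≤ stationarity g M x y := le_max_of_le_left (Real.sqrt_nonneg _)

variable (hM : 0 < M) (hL : IsLipschitzHessian (g x) (gradY g x) (hessY g x) M)
  (hx : x ∈ X) (hseq : IsCubicNewtonSeq X g M y₀ yseq)
  (hout : IsCubicNewtonOutput X g M yseq yhat)

include hM hL hx hseq in
lemma newton_decrease (k : ℕ) : g x (yseq (k + 1) x) ≤
    g x (yseq k x) - M / 12 * ‖yseq (k + 1) x - yseq k x‖ ^ 3 := by
  have := hL.cubic_decrease hM ((hseq x hx).2 k)
  rwa [add_sub_cancel] at this

include hM hL hx hseq in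
lemma newton_sum_le (K : ℕ) : M / 12 * ∑ k ∈ Finset.range K, ‖yseq (k + 1) x - yseq k x‖ ^ 3 ≤
    g x y₀ - g x (yseq K x) := by
  induction K with
  | zero => simp [(hseq x hx).1]
  | succ K ih =>
    rw [Finset.sum_range_succ, mul_add]
    linarith [newton_decrease hM hL hx hseq K]

include hM hL hx hseq in
lemma newton_value_le (k : ℕ) : g x (yseq k x) ≤ g x y₀ := by
  have h1 := newton_sum_le hM hL hx hseq k
  have : 0 ≤ M / 12 * ∑ k ∈ Finset.range k, ‖yseq (k + 1) x - yseq k x‖ ^ 3 := by positivity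
  linarith

include hM hL hx hseq in
-- The new gradient is at most `M‖s‖²`. The old Hessian is at least `-(M/2)‖s‖` and changes by at
-- most `M‖s‖`, which gives `-(3/2)M‖s‖`. The weights in `stationarity` turn both bounds into `‖s‖`.
lemma stationarity_succ_le (k : ℕ) :
    stationarity g M x (yseq (k + 1) x) ≤ ‖yseq (k + 1) x - yseq k x‖ := by
  have hs := (hseq x hx).2 k
  set s := yseq (k + 1) x - yseq k x with hsdef
  have hy : yseq (k + 1) x = yseq k x + s := by simp [hsdef]
  rw [hy]
  refine max_le ?_ ?_
  · refine Real.sqrt_le_iff.2 ⟨norm_nonneg _, ?_⟩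
    have := hL.norm_gradient_next_le hM hs
    rw [one_div_mul_eq_div, div_le_iff₀ hM]
    linarith
  · have h1 : -(3 / 2 * M * ‖s‖) ≤ minEigenvalue (hessY g x (yseq k x + s)) := by
      refine minEigenvalue_ge (by positivity) fun v => ?_
      have h2 := hL.inner_hessian_ge (yseq k x) (yseq k x + s) v
      have h3 := cubic_second_order hM (hL.symm _) hs v
      rw [add_sub_cancel_left] at h2
      linarith
    have h4 := mul_le_mul_of_nonneg_left h1 (show 0 ≤ 2 / (3 * M) by positivity)
    have h5 : 2 / (3 * M) * -(3 / 2 * M * ‖s‖) = -‖s‖ := by field_simp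
    linarith

include hM hL hx hseq hout in
-- The total decrease bounds the sum of the cubed step lengths, and each of the `K` steps is at
-- least as long as the smallest stationarity measure.
lemma output_stationarity_le {glow : ℝ} (hglow : ∀ y, glow ≤ g x y) (K : ℕ) :
    K * M * stationarity g M x (yhat K x) ^ 3 ≤ 12 * (g x y₀ - glow) := by
  obtain ⟨k, hk, hyk, hmin⟩ := hout x hx K
  rw [hyk]
  have h1 := newton_sum_le hM hL hx hseq K
  have h2 : (K : ℝ) * stationarity g M x (yseq k x) ^ 3 ≤
      ∑ k ∈ Finset.range K, ‖yseq (k + 1) x - yseq k x‖ ^ 3 := by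
    rw [← nsmul_eq_mul]
    refine (Finset.card_nsmul_le_sum (Finset.range K) _ (stationarity g M x (yseq k x) ^ 3)
      fun j hj => ?_).trans' (by rw [Finset.card_range])
    refine pow_le_pow_left₀ (stationarity_nonneg _ _ _ _) ?_ 3
    exact (hmin (j + 1) (by simpa using hj)).trans (stationarity_succ_le hM hL hx hseq j)
  have h3 := mul_le_mul_of_nonneg_left h2 (show 0 ≤ M / 12 by positivity)
  linarith [hglow (yseq K x)]

include hM hL hx hseq hout in
lemma output_value_le (K : ℕ) : g x (yhat K x) ≤ g x y₀ := by
  obtain ⟨k, -, hyk, -⟩ := hout x hx K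
  rw [hyk]
  exact newton_value_le hM hL hx hseq k

/-- If `t ≥ ε`, then `S ≥ √(ε/M)`, so `K ε^(3/2) ≤ 12 D √M`. The threshold has `256/9 > 12`, and the
slack settles the case `D > 0` while strictness settles `D = 0`. -/
lemma lt_of_stationarity {D M ε K S t : ℝ} (hM : 0 < M) (hε : 0 < ε) (hD : 0 ≤ D)
    (hK : 256 * D * Real.sqrt M / (9 * ε ^ (3 / 2 : ℝ)) < K) (hS : K * M * S ^ 3 ≤ 12 * D)
    (ht : Real.sqrt (1 / M * t) ≤ S) : t < ε := by
  by_contra! hle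
  -- Writing `ε = p²` and `M = q²` removes the fractional powers.
  obtain ⟨p, hp, rfl⟩ : ∃ p, 0 < p ∧ ε = p ^ 2 :=
    ⟨Real.sqrt ε, Real.sqrt_pos.2 hε, (Real.sq_sqrt hε.le).symm⟩
  obtain ⟨q, hq, rfl⟩ : ∃ q, 0 < q ∧ M = q ^ 2 :=
    ⟨Real.sqrt M, Real.sqrt_pos.2 hM, (Real.sq_sqrt hM.le).symm⟩
  have hp3 : (p ^ 2) ^ (3 / 2 : ℝ) = p ^ 3 := by
    rw [← Real.rpow_natCast p 2, ← Real.rpow_mul hp.le, ← Real.rpow_natCast p 3]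
    norm_num
  rw [hp3, Real.sqrt_sq hq.le, div_lt_iff₀ (by positivity)] at hK
  have h1 : p / q ≤ S := by
    refine le_trans ?_ ht
    refine Real.le_sqrt_of_sq_le ?_
    rw [div_pow, div_eq_mul_inv, mul_comm, one_div]
    gcongr
  have hK0 : 0 ≤ K := by
    by_contra! hneg
    have h3 : 0 ≤ 256 * D * q := by positivity
    have h4 : K * (9 * p ^ 3) < 0 := mul_neg_of_neg_of_pos hneg (by positivity)
    linarith
  have h2 : K * q ^ 2 * (p / q) ^ 3 ≤ 12 * D := by
    refine le_trans ?_ hS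
    gcongr
  have h3 : K * q ^ 2 * (p / q) ^ 3 = K * p ^ 3 / q := by field_simp
  rw [h3, div_le_iff₀ hq] at h2
  have : 0 ≤ D * q := by positivity
  linarith

include hM hL hseq hout in
/-- Outside the neighbourhood of the bifurcation set, sufficiently many steps bring the output close
to the only accumulation point of the sequence of iterates. -/
lemma exists_attainableSet_eq_singleton {μ : ℝ → ℝ} {α : ℝ → ℝ → ℝ} {δ ρ g0 glow : ℝ} {K : ℕ}
    (hx : x ∈ X \ bifurcationNhd X g δ) (hY : {y | g x y ≤ g x y₀} ⊆ Y) (hY' : IsCompact Y')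
    (hμ : IsEigenvalueBound X Y' g μ) (hα : IsGradientBound X Y Y' g α)
    (hglow : ∀ y, glow ≤ g x y) (hg0 : g x y₀ ≤ g0) (hρ : 0 < ρ) (hδ : 0 < δ)
    (hK : stepThreshold (g0 - glow) M μ α ρ δ < K) :
    ∃ z, attainableSet g yseq x = {z} ∧ g x z ≤ g x y₀ ∧ ‖yhat K x - z‖ ≤ 2 * ρ := by
  have hS := output_stationarity_le hM hL hx.1 hseq hout hglow K
  obtain ⟨k, -, hyk, -⟩ := hout x hx.1 K
  have hval := output_value_le hM hL hx.1 hseq hout K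
  set D := g0 - glow with hDdef
  have hD : 0 ≤ D := by linarith [hglow y₀]
  have hS : K * M * stationarity g M x (yhat K x) ^ 3 ≤ 12 * D := hS.trans (by linarith)
  set w := yhat K x with hw
  set S := stationarity g M x w
  obtain ⟨hμ0, hμe⟩ := hμ δ hδ
  set c := μ δ
  obtain ⟨hα0, hαe⟩ := hα δ (c / (2 * M)) hδ (by positivity)
  have hε : 0 < min (α δ (c / (2 * M))) (c ^ 2 / (4 * M)) := lt_min hα0 (by positivity)
  have hS0 : 0 ≤ S := stationarity_nonneg _ _ _ _
  have hT1 : 0 ≤ 256 * D * Real.sqrt M /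
      (9 * (min (α δ (c / (2 * M))) (c ^ 2 / (4 * M))) ^ (3 / 2 : ℝ)) := by positivity
  have hT3 : 0 ≤ 256 * D * Real.sqrt M / (9 * (c * ρ) ^ (3 / 2 : ℝ)) := by positivity
  unfold stepThreshold at hK
  have hsq : Real.sqrt (1 / M * ‖gradY g x w‖) ≤ S := le_max_left _ _
  have hG1 : ‖gradY g x w‖ < min (α δ (c / (2 * M))) (c ^ 2 / (4 * M)) :=
    lt_of_stationarity hM hε hD
      (by linarith [le_max_left (256 * D * Real.sqrt M / (9 * (min (α δ (c / (2 * M)))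
        (c ^ 2 / (4 * M))) ^ (3 / 2 : ℝ))) (768 * D * M ^ 2 / c ^ 3)]) hS hsq
  have hG2 : ‖gradY g x w‖ < c * ρ :=
    lt_of_stationarity hM (by positivity) hD
      (by linarith [le_max_left (256 * D * Real.sqrt M / (9 * (min (α δ (c / (2 * M)))
        (c ^ 2 / (4 * M))) ^ (3 / 2 : ℝ))) (768 * D * M ^ 2 / c ^ 3)]) hS hsq
  -- Otherwise `K c³ ≤ 12·27·D M²`, against the second entry of the maximum, whose constant is
  -- `768`. The bound on `S` makes the smallest eigenvalue at the output exceed `-c/2`.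
  have hS2 : S < c / (3 * M) := by
    have h1 : 768 * D * M ^ 2 / c ^ 3 < K := by
      linarith [le_max_right (256 * D * Real.sqrt M / (9 * (min (α δ (c / (2 * M)))
        (c ^ 2 / (4 * M))) ^ (3 / 2 : ℝ))) (768 * D * M ^ 2 / c ^ 3)]
    rw [div_lt_iff₀ (by positivity)] at h1
    by_contra! hle
    have h2 : K * M * (c / (3 * M)) ^ 3 ≤ 12 * D := le_trans (by gcongr) hS
    have h3 : K * M * (c / (3 * M)) ^ 3 = K * c ^ 3 / (27 * M ^ 2) := by field_simp; norm_num
    rw [h3, div_le_iff₀ (by positivity)] at h2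
    have : 0 ≤ D * M ^ 2 := by positivity
    linarith
  have hcont : Continuous (gradY g x) :=
    continuous_iff_continuousAt.2 fun y => (hL.hasFDerivAt y).continuousAt
  have hcrit : IsCompact (critSet Y' g x) :=
    hY'.inter_right (isClosed_eq hcont continuous_const)
  -- A point of `Y` farther than `c/(2M)` from the stationary points would have gradient at least `α
  -- δ (c/(2M))`, more than is left at `w`.
  have hthick : w ∈ Metric.cthickening (c / (2 * M)) (critSet Y' g x) := by
    by_contra hn
    have := hαe x hx w ⟨hY hval, hn⟩
    exact absurd (hG1.trans_le (min_le_left _ _)) this.not_gt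
  rw [hcrit.cthickening_eq_biUnion_closedBall (by positivity)] at hthick
  simp only [Set.mem_iUnion, Metric.mem_closedBall, dist_eq_norm] at hthick
  obtain ⟨z, hz, hwz⟩ := hthick
  have hmin : -(c / 2) < minEigenvalue (hessY g x w) := by
    have h1 : -(2 / (3 * M)) * minEigenvalue (hessY g x w) ≤ S := le_max_right _ _
    have h2 := h1.trans_lt hS2
    rw [lt_div_iff₀ (by positivity)] at h2
    have h3 : -(2 / (3 * M)) * minEigenvalue (hessY g x w) * (3 * M) =
        -2 * minEigenvalue (hessY g x w) := by field_simp
    linarith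
  -- Passing from `w` to `z` lowers eigenvalues by at most `M‖w - z‖ ≤ c/2`, so those at `z` exceed
  -- `-c`; as their modulus is at least `c`, they are at least `c`.
  have hH : ∀ v, c * ‖v‖ ^ 2 ≤ inner ℝ (hessY g x z v) v := by
    refine symmetric_inner_ge (hL.symm z) fun l hl => ?_
    have hl1 := hμe x hx z hz.1 hz.2 l hl
    obtain ⟨v, hv⟩ := hl.exists_hasEigenvector
    have h2 : hessY g x z v = l • v := hv.apply_eq_smul
    have h3 := hL.inner_hessian_ge w z v
    have h4 := minEigenvalue_mul_le (hL.symm w) v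
    rw [h2, real_inner_smul_left, real_inner_self_eq_norm_sq, norm_sub_rev] at h3
    have hvn : 0 < ‖v‖ ^ 2 := by have := norm_pos_iff.2 hv.2; positivity
    have h5 : M * ‖w - z‖ ≤ c / 2 := by
      rw [le_div_iff₀ (by positivity)] at hwz; linarith
    have h6 : M * ‖w - z‖ * ‖v‖ ^ 2 ≤ c / 2 * ‖v‖ ^ 2 := by gcongr
    have h7 : -(c / 2) * ‖v‖ ^ 2 < minEigenvalue (hessY g x w) * ‖v‖ ^ 2 := by gcongr
    have h8 : -c < l := lt_of_mul_lt_mul_right (by linarith) hvn.le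
    rcases abs_cases l with h | h <;> linarith
  have hdist : ‖w - z‖ ≤ 2 * ρ := by
    have h1 := (hL.norm_gradient_ge hM hz.2 hH hwz).trans_lt hG2
    have h2 : c * (3 / 4 * ‖w - z‖) < c * ρ := by linarith
    have h3 := lt_of_mul_lt_mul_left h2 hμ0.le
    linarith
  -- The output is the iterate of index `k`, so the contraction applies to the tail of the original
  -- sequence and forces its convergence to `z`.
  have hiter : ∀ j, ‖yseq (j + k) x - z‖ ≤ (3 / 4) ^ j * ‖w - z‖ := by
    intro j
    induction j with
    | zero => simp [hyk]
    | succ j ih =>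
      have h1 : ‖yseq (j + k) x - z‖ ≤ c / (2 * M) := by
        refine le_trans (ih.trans ?_) hwz
        exact mul_le_of_le_one_left (norm_nonneg _) (pow_le_one₀ (by norm_num) (by norm_num))
      have h2 := hL.cubic_contraction hM hz.2 hH h1 ((hseq x hx.1).2 (j + k))
      rw [add_sub_cancel] at h2
      rw [show j + 1 + k = j + k + 1 by ring, pow_succ']
      linarith
  have hlim : Tendsto (fun j => yseq j x) atTop (𝓝 z) := by
    rw [← tendsto_add_atTop_iff_nat k, tendsto_iff_norm_sub_tendsto_zero]
    refine squeeze_zero (fun _ => norm_nonneg _) hiter ?_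
    simpa using (tendsto_pow_atTop_nhds_zero_of_lt_one (r := (3 / 4 : ℝ)) (by norm_num)
      (by norm_num)).mul_const ‖w - z‖
  have huniq : ∀ a, MapClusterPt a atTop (fun j => yseq j x) ↔ a = z := by
    intro a
    refine ⟨fun ha => ?_, fun ha => ha ▸ hlim.mapClusterPt⟩
    have : ClusterPt a (𝓝 z) := ClusterPt.mono ha hlim
    exact eq_of_nhds_neBot this
  refine ⟨z, ?_, ?_, hdist⟩
  · ext a
    simp only [attainableSet, huniq, Set.mem_ofPred_eq, Set.mem_singleton_iff, forall_eq]
    exact ⟨fun h => h.1, fun h => ⟨h, h ▸ le_rfl⟩⟩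
  · have hgc : ContinuousAt (g x) z := (hL.hasGradientAt z).hasFDerivAt.continuousAt
    exact le_of_tendsto' (hgc.tendsto.comp hlim) fun j => newton_value_le hM hL hx.1 hseq j

end lower

/-! ### Volume of the neighbourhoods of a set of small Minkowski dimension -/

/-- Total boundedness makes the covering number finite, so the infimum is attained by a finite set
and `toNat` loses nothing. -/
lemma exists_finite_cover {A : Set (Euc n)} (hA : TotallyBounded A) {r : ℝ} (hr : 0 < r) :
    ∃ t : Finset (Euc n), (t.card : ℝ) = (Metric.externalCoveringNumber r.toNNReal A).toNat ∧
      ∀ a ∈ A, ∃ c ∈ t, dist a c ≤ r := by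
  have hfin : Metric.externalCoveringNumber r.toNNReal A ≠ ⊤ := by
    obtain ⟨t, ht, hcov⟩ := Metric.totallyBounded_iff.1 hA r hr
    have hc : Metric.IsCover r.toNNReal A t := by
      intro a ha
      obtain ⟨c, hc, hac⟩ := Set.mem_iUnion₂.1 (hcov ha)
      refine ⟨c, hc, ?_⟩
      change edist a c ≤ ENNReal.ofReal r
      rw [edist_dist]
      exact ENNReal.ofReal_le_ofReal (Metric.mem_ball.1 hac).le
    exact ne_top_of_le_ne_top (by simpa using ht) hc.externalCoveringNumber_le_encard
  obtain ⟨C, hC, hcard⟩ : ∃ C : Set (Euc n), Metric.IsCover r.toNNReal A C ∧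
      C.encard = Metric.externalCoveringNumber r.toNNReal A := by
    have h1 : Metric.externalCoveringNumber r.toNNReal A <
        Metric.externalCoveringNumber r.toNNReal A + 1 := ENat.lt_add_one_iff hfin |>.2 le_rfl
    conv_lhs at h1 => rw [Metric.externalCoveringNumber]
    obtain ⟨C, hC⟩ := iInf_lt_iff.1 h1
    obtain ⟨hC1, hC2⟩ := iInf_lt_iff.1 hC
    exact ⟨C, hC1, le_antisymm ((ENat.lt_add_one_iff hfin).1 hC2)
      hC1.externalCoveringNumber_le_encard⟩
  have hCf : C.Finite := by
    rw [← Set.encard_ne_top_iff, hcard]; exact hfin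
  refine ⟨hCf.toFinset, ?_, fun a ha => ?_⟩
  · rw [← hcard, hCf.encard_eq_coe_toFinset_card]
    simp
  · obtain ⟨c, hc, hac⟩ := hC ha
    refine ⟨c, by simpa using hc, ?_⟩
    change edist a c ≤ ENNReal.ofReal r at hac
    rw [edist_dist] at hac
    exact (ENNReal.ofReal_le_ofReal_iff hr.le).1 hac

lemma volume_cthickening_le {A : Set (Euc n)} (hA : TotallyBounded A) {r : ℝ} (hr : 0 < r) :
    volume (Metric.cthickening r A) ≤
      ENNReal.ofReal ((Metric.externalCoveringNumber r.toNNReal A).toNat * (3 * r) ^ n *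
        volume.real (Metric.ball (0 : Euc n) 1)) := by
  obtain ⟨t, ht, hcov⟩ := exists_finite_cover hA hr
  have hsub : Metric.cthickening r A ⊆ ⋃ c ∈ t, Metric.closedBall c (3 * r) := by
    intro a ha
    rw [Metric.mem_cthickening_iff] at ha
    -- The infimum distance need not be attained; the room between `r` and `2r` provides a point of
    -- `A`, and its covering ball adds another `r`.
    have h1 : Metric.infEDist a A < ENNReal.ofReal (2 * r) :=
      ha.trans_lt ((ENNReal.ofReal_lt_ofReal_iff (by positivity)).2 (by linarith))
    obtain ⟨b, hb, hab⟩ := Metric.infEDist_lt_iff.1 h1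
    obtain ⟨c, hc, hbc⟩ := hcov b hb
    refine Set.mem_iUnion₂.2 ⟨c, hc, ?_⟩
    rw [edist_dist, ENNReal.ofReal_lt_ofReal_iff (by positivity)] at hab
    rw [Metric.mem_closedBall]
    linarith [dist_triangle a b c]
  refine (measure_mono hsub).trans ((measure_biUnion_finset_le t _).trans ?_)
  have h2 : ∀ c : Euc n, volume (Metric.closedBall c (3 * r)) =
      ENNReal.ofReal ((3 * r) ^ n * volume.real (Metric.ball (0 : Euc n) 1)) := by
    intro c
    rw [Measure.addHaar_closedBall volume c (by positivity), finrank_euclideanSpace_fin,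
      ENNReal.ofReal_mul (by positivity), ofReal_measureReal (measure_ball_lt_top).ne]
  simp_rw [h2]
  rw [Finset.sum_const, nsmul_eq_mul, ← ht, mul_assoc, ENNReal.ofReal_mul (p := (t.card : ℝ)) (by positivity),
    ENNReal.ofReal_natCast]

/-- The measure of the `δ`-neighbourhood of a set of upper Minkowski dimension `d < n`. -/
lemma exists_volume_cthickening_le {A X : Set (Euc n)} (hX : IsCompact X) (hAX : A ⊆ X) {d : ℝ}
    (hd : upperMinkowskiDim A = (d : EReal)) (hdn : d < n) :
    ∃ C : ℝ, 0 < C ∧ ∀ δ : ℝ, 0 < δ →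
      volume.real (X ∩ Metric.cthickening δ A) ≤ C * δ ^ (((n : ℝ) - d) / 2) := by
  have hA : TotallyBounded A := hX.totallyBounded.subset hAX
  -- The covering number need not be `O(r^(-d))`, but any larger exponent works for small `r`. The
  -- midpoint `(n + d)/2` leaves `n - (n + d)/2 = (n - d)/2`.
  have hlim : upperMinkowskiDim A < (((n + d) / 2 : ℝ) : EReal) := by
    rw [hd, EReal.coe_lt_coe_iff]; linarith
  have hev := eventually_lt_of_limsup_lt hlim
  obtain ⟨r₀, hr₀, hr₀sub⟩ := mem_nhdsGT_iff_exists_Ioo_subset.1 hev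
  set r₁ := min r₀ 1 with hr₁
  have hr₁0 : 0 < r₁ := lt_min hr₀ one_pos
  set e : ℝ := ((n : ℝ) - d) / 2 with he
  set ω := volume.real (Metric.ball (0 : Euc n) 1)
  have hω : 0 ≤ ω := measureReal_nonneg
  have hV : 0 ≤ volume.real X := measureReal_nonneg
  -- The first summand serves small `δ`; the second serves `δ ≥ r₁`, where the volume of `X`
  -- suffices; the `1` ensures positivity.
  refine ⟨3 ^ n * ω + volume.real X / r₁ ^ e + 1, by positivity, fun δ hδ => ?_⟩
  rcases lt_or_ge δ r₁ with hlt | hge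
  · have hδ1 : δ < 1 := hlt.trans_le (min_le_right _ _)
    have hlog : Real.log δ < 0 := Real.log_neg hδ hδ1
    have h1 := hr₀sub ⟨hδ, hlt.trans_le (min_le_left _ _)⟩
    simp only [Set.mem_ofPred_eq, EReal.coe_lt_coe_iff] at h1
    set N := (Metric.externalCoveringNumber δ.toNNReal A).toNat
    rw [div_lt_iff₀ (by linarith)] at h1
    have hN : (N : ℝ) ≤ δ ^ (-((n + d) / 2)) := by
      rcases Nat.eq_zero_or_pos N with h0 | h0
      · rw [h0, Nat.cast_zero]; positivity
      · rw [← Real.log_le_log_iff (by exact_mod_cast h0) (by positivity), Real.log_rpow hδ]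
        linarith
    have h2 : volume.real (X ∩ Metric.cthickening δ A) ≤ N * (3 * δ) ^ n * ω := by
      refine ENNReal.toReal_le_of_le_ofReal (by positivity) ?_
      exact (measure_mono Set.inter_subset_right).trans (volume_cthickening_le hA hδ)
    have h3 : δ ^ (-((n + d) / 2)) * (3 * δ) ^ n * ω = 3 ^ n * ω * δ ^ e := by
      have : δ ^ e = δ ^ (-((n + d) / 2)) * δ ^ n := by
        rw [← Real.rpow_natCast δ n, ← Real.rpow_add hδ]
        congr 1
        rw [he]; ring
      rw [this, mul_pow]
      ring
    calc _ ≤ N * (3 * δ) ^ n * ω := h2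
      _ ≤ δ ^ (-((n + d) / 2)) * (3 * δ) ^ n * ω := by gcongr
      _ = 3 ^ n * ω * δ ^ e := h3
      _ ≤ _ := by
        gcongr
        have : 0 ≤ volume.real X / r₁ ^ e := by positivity
        linarith
  · have h1 : volume.real (X ∩ Metric.cthickening δ A) ≤ volume.real X :=
      measureReal_mono Set.inter_subset_left hX.measure_lt_top.ne
    have h2 : r₁ ^ e ≤ δ ^ e := Real.rpow_le_rpow hr₁0.le hge (by rw [he]; linarith)
    have h3 : 0 < r₁ ^ e := by positivity
    calc _ ≤ volume.real X := h1
      _ = volume.real X / r₁ ^ e * r₁ ^ e := by field_simp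
      _ ≤ volume.real X / r₁ ^ e * δ ^ e := by gcongr
      _ ≤ _ := by
        gcongr
        have : 0 ≤ 3 ^ n * ω := by positivity
        linarith

/-- The closure lies in every closed thickening, whose volume within `X` tends to `0`. A point of
`X` off the closure has positive distance to the set, which the pointwise convergence in
`tendsto_extendedValue` requires. -/
lemma volume_inter_closure_eq_zero {A X : Set (Euc n)} (hX : IsCompact X) (hAX : A ⊆ X) {d : ℝ}
    (hd : upperMinkowskiDim A = (d : EReal)) (hdn : d < n) :
    volume (X ∩ closure A) = 0 := by
  obtain ⟨C, -, hC⟩ := exists_volume_cthickening_le hX hAX hd hdn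
  have hfin : volume (X ∩ closure A) ≠ ⊤ :=
    ((measure_mono Set.inter_subset_left).trans_lt hX.measure_lt_top).ne
  rw [← measureReal_eq_zero_iff hfin]
  refine le_antisymm ?_ measureReal_nonneg
  have he : 0 < ((n : ℝ) - d) / 2 := by linarith
  have hlim : Tendsto (fun δ : ℝ => C * δ ^ (((n : ℝ) - d) / 2)) (𝓝[>] 0) (𝓝 0) := by
    have := (Real.continuousAt_rpow_const 0 _ (Or.inr he.le)).tendsto
    rw [Real.zero_rpow he.ne'] at this
    simpa using (this.mono_left nhdsWithin_le_nhds).const_mul C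
  refine ge_of_tendsto hlim ?_
  filter_upwards [self_mem_nhdsWithin] with δ hδ
  refine (measureReal_mono ?_ ((measure_mono Set.inter_subset_left).trans_lt
    hX.measure_lt_top).ne).trans (hC δ hδ)
  exact Set.inter_subset_inter_right _ (Metric.closure_subset_cthickening δ A)

/-! ### Existence of the constants -/

section constants

variable {X : Set (Euc n)} {Y Y' : Set (Euc m)} {f g : Euc n → Euc m → ℝ} {M : ℝ} {y₀ : Euc m}

/-- The points of `X` at distance at least `δ` from the bifurcation set. -/
def bifurcationFar (X : Set (Euc n)) (g : Euc n → Euc m → ℝ) (δ : ℝ) : Set (Euc n) :=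
  X ∩ {x | ENNReal.ofReal δ ≤ Metric.infEDist x (bifurcationSet X g)}

/-- Relaxing "distance greater than `δ`" to "at least `δ`" makes the parameter set compact, and it
still consists of Morse parameters. -/
lemma isCompact_bifurcationFar (hX : IsCompact X) (δ : ℝ) :
    IsCompact (bifurcationFar X g δ) :=
  hX.inter_right (isClosed_le continuous_const Metric.continuous_infEDist)

lemma diff_bifurcationNhd_subset (δ : ℝ) :
    X \ bifurcationNhd X g δ ⊆ bifurcationFar X g δ := by
  rintro x ⟨hx, hn⟩
  refine ⟨hx, ?_⟩
  by_contra! h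
  exact hn ⟨hx, Metric.mem_cthickening_iff.2 (not_le.1 h).le⟩

lemma isMorseAt_of_mem_bifurcationFar {δ : ℝ} (hδ : 0 < δ) {x : Euc n}
    (hx : x ∈ bifurcationFar X g δ) : IsMorseAt g x := by
  by_contra hn
  have h1 := hx.2
  rw [Set.mem_ofPred_eq, Metric.infEDist_zero_of_mem (show x ∈ bifurcationSet X g from ⟨hx.1, hn⟩)]
    at h1
  simp at h1
  linarith

lemma exists_norm_ge_of_det_ne_zero {A : Euc m →L[ℝ] Euc m}
    (hA : LinearMap.det (A : Euc m →ₗ[ℝ] Euc m) ≠ 0) {v : Euc m} (hv : v ≠ 0) : A v ≠ 0 := by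
  intro h
  have h1 := (LinearMap.equivOfDetNeZero (A : Euc m →ₗ[ℝ] Euc m) hA).map_eq_zero_iff (x := v)
  exact hv (h1.1 h)

/-- `‖∇²g v‖` is continuous and positive on the compact set of stationary pairs times the unit
sphere. -/
lemma exists_hessian_lower_bound (hX : IsCompact X) (hY' : IsCompact Y')
    (hgrad : ContinuousOn (fun p : Euc n × Euc m => gradY g p.1 p.2) (X ×ˢ Set.univ))
    (hhess : ContinuousOn (fun p : Euc n × Euc m => hessY g p.1 p.2) (X ×ˢ Set.univ))
    {δ : ℝ} (hδ : 0 < δ) :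
    ∃ c : ℝ, 0 < c ∧ ∀ x ∈ bifurcationFar X g δ, ∀ y ∈ Y', gradY g x y = 0 →
      ∀ v, c * ‖v‖ ≤ ‖hessY g x y v‖ := by
  have hK : IsCompact (bifurcationFar X g δ ×ˢ Y') := (isCompact_bifurcationFar hX δ).prod hY'
  have hsub : bifurcationFar X g δ ×ˢ Y' ⊆ X ×ˢ Set.univ := fun p hp => ⟨hp.1.1, trivial⟩
  have hS : IsCompact ((bifurcationFar X g δ ×ˢ Y') ∩
      (fun p : Euc n × Euc m => gradY g p.1 p.2) ⁻¹' {0}) :=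
    hK.of_isClosed_subset ((hgrad.mono hsub).preimage_isClosed_of_isClosed hK.isClosed
      isClosed_singleton) Set.inter_subset_left
  obtain ⟨c, hc, hcle⟩ := (hS.prod (isCompact_sphere (0 : Euc m) 1)).exists_forall_le'
    (f := fun p : (Euc n × Euc m) × Euc m => ‖hessY g p.1.1 p.1.2 p.2‖)
    (by
      refine ContinuousOn.norm (ContinuousOn.clm_apply ?_ continuousOn_snd)
      exact hhess.comp continuousOn_fst fun p hp => hsub hp.1.1)
    (a := 0) (by
      rintro ⟨⟨x, y⟩, v⟩ ⟨⟨hp, h0⟩, hv⟩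
      refine norm_pos_iff.2 (exists_norm_ge_of_det_ne_zero
        (isMorseAt_of_mem_bifurcationFar hδ hp.1 y h0) ?_)
      rintro rfl
      simp at hv)
  refine ⟨c, hc, fun x hx y hy h0 v => ?_⟩
  rcases eq_or_ne v 0 with rfl | hv
  · simp
  have hvn : 0 < ‖v‖ := norm_pos_iff.2 hv
  have := hcle ((x, y), ‖v‖⁻¹ • v) ⟨⟨⟨hx, hy⟩, h0⟩, by simp [norm_smul, hvn.ne']⟩
  simp only [map_smul, norm_smul, norm_inv, norm_norm] at this
  rwa [inv_mul_eq_div, le_div_iff₀ hvn] at this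

lemma exists_isEigenvalueBound (hX : IsCompact X) (hY' : IsCompact Y')
    (hgrad : ContinuousOn (fun p : Euc n × Euc m => gradY g p.1 p.2) (X ×ˢ Set.univ))
    (hhess : ContinuousOn (fun p : Euc n × Euc m => hessY g p.1 p.2) (X ×ˢ Set.univ)) :
    ∃ μ : ℝ → ℝ, IsEigenvalueBound X Y' g μ := by
  have h : ∀ δ : ℝ, ∃ c : ℝ, 0 < δ → 0 < c ∧ ∀ x ∈ bifurcationFar X g δ, ∀ y ∈ Y',
      gradY g x y = 0 → ∀ v, c * ‖v‖ ≤ ‖hessY g x y v‖ := fun δ => by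
    by_cases hδ : 0 < δ
    · obtain ⟨c, hc⟩ := exists_hessian_lower_bound hX hY' hgrad hhess hδ
      exact ⟨c, fun _ => hc⟩
    · exact ⟨0, fun h => absurd h hδ⟩
  choose μ hμ using h
  refine ⟨μ, fun δ hδ => ⟨(hμ δ hδ).1, fun x hx y hy h0 l hl => ?_⟩⟩
  obtain ⟨v, hv⟩ := hl.exists_hasEigenvector
  have h1 := (hμ δ hδ).2 x (diff_bifurcationNhd_subset δ hx) y hy h0 v
  have h2 : hessY g x y v = l • v := hv.apply_eq_smul
  rw [h2, norm_smul] at h1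
  exact le_of_mul_le_mul_right h1 (norm_pos_iff.2 hv.2)

/-- Stationary points at which the Hessian is invertible persist under perturbation of `x`. -/
lemma eventually_mem_cthickening_critSet (hM : 0 < M)
    (hL : ∀ x ∈ X, IsLipschitzHessian (g x) (gradY g x) (hessY g x) M)
    (hgrad : ContinuousOn (fun p : Euc n × Euc m => gradY g p.1 p.2) (X ×ˢ Set.univ))
    (hHess : ∀ x ∈ X, ∀ x' ∈ X, ∀ y y' : Euc m,
      ‖hessY g x y - hessY g x' y'‖ ≤ M * Real.sqrt (‖x - x'‖ ^ 2 + ‖y - y'‖ ^ 2))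
    {x : Euc n} (hx : x ∈ X) {y : Euc m} (hy : y ∈ interior Y') (h0 : gradY g x y = 0)
    (hdet : LinearMap.det (hessY g x y : Euc m →ₗ[ℝ] Euc m) ≠ 0) {c : ℝ} (hc : 0 < c)
    (hcH : ∀ v, c * ‖v‖ ≤ ‖hessY g x y v‖) {r : ℝ} (hr : 0 < r) :
    ∀ᶠ z : Euc n × Euc m in 𝓝[X ×ˢ Set.univ] (x, y),
      z.2 ∈ Metric.cthickening r (critSet Y' g z.1) := by
  obtain ⟨ε₀, hε₀, hball⟩ := Metric.isOpen_iff.1 isOpen_interior y hy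
  -- The three bounds keep the new stationary point in `Y'`, keep it within `r` of `z.2`, and keep
  -- the change of the Hessian below `c/2`.
  set ε := min (ε₀ / 2) (min (r / 2) (c / (4 * M))) with hε
  have hεpos : 0 < ε := lt_min (by positivity) (lt_min (by positivity) (by positivity))
  have hε1 : ε ≤ ε₀ / 2 := min_le_left _ _
  have hε2 : ε ≤ r / 2 := (min_le_right _ _).trans (min_le_left _ _)
  have hε3 : ε ≤ c / (4 * M) := (min_le_right _ _).trans (min_le_right _ _)
  let inv : (hessY g x y).NonlinearRightInverse :=
    { toFun := (LinearMap.equivOfDetNeZero (hessY g x y : Euc m →ₗ[ℝ] Euc m) hdet).symm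
      nnnorm := (c.toNNReal)⁻¹
      bound' := fun w => by
        have h1 := hcH ((LinearMap.equivOfDetNeZero (hessY g x y : Euc m →ₗ[ℝ] Euc m) hdet).symm w)
        have h2 : hessY g x y ((LinearMap.equivOfDetNeZero (hessY g x y : Euc m →ₗ[ℝ] Euc m)
          hdet).symm w) = w :=
          (LinearMap.equivOfDetNeZero (hessY g x y : Euc m →ₗ[ℝ] Euc m) hdet).apply_symm_apply w
        rw [h2] at h1
        rw [NNReal.coe_inv, Real.coe_toNNReal c hc.le, inv_mul_eq_div, le_div_iff₀ hc]
        linarith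
      right_inv' := fun w =>
        (LinearMap.equivOfDetNeZero (hessY g x y : Euc m →ₗ[ℝ] Euc m) hdet).apply_symm_apply w }
  have hcont : Tendsto (fun z : Euc n × Euc m => ‖gradY g z.1 y‖) (𝓝[X ×ˢ Set.univ] (x, y))
      (𝓝 0) := by
    have h1 : ContinuousWithinAt (fun z : Euc n × Euc m => gradY g z.1 y)
        (X ×ˢ Set.univ) (x, y) :=
      ContinuousWithinAt.comp (g := fun p : Euc n × Euc m => gradY g p.1 p.2)
        (f := fun z : Euc n × Euc m => (z.1, y)) (x := (x, y)) (t := X ×ˢ Set.univ)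
        (hgrad (x, y) ⟨hx, trivial⟩) (Continuous.continuousWithinAt (by fun_prop))
        fun z hz => ⟨hz.1, trivial⟩
    simpa [h0] using h1.norm.tendsto
  have hnear : ∀ᶠ z : Euc n × Euc m in 𝓝[X ×ˢ Set.univ] (x, y), dist z (x, y) < ε :=
    nhdsWithin_le_nhds (Metric.ball_mem_nhds _ hεpos)
  filter_upwards [self_mem_nhdsWithin, hnear, hcont.eventually (gt_mem_nhds
    (show 0 < c / 2 * ε by positivity))] with z hz hzd hzg
  rw [Prod.dist_eq, max_lt_iff] at hzd
  have happ : ApproximatesLinearOn (gradY g z.1) (hessY g x y) (Metric.closedBall y ε)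
      (c / 2).toNNReal := by
    intro a ha b hb
    rw [Real.coe_toNNReal _ (by positivity)]
    refine (convex_closedBall y ε).norm_image_sub_le_of_norm_hasFDerivWithin_le'
      (f' := hessY g z.1) (fun w _ => ((hL z.1 hz.1).hasFDerivAt w).hasFDerivWithinAt)
      (fun w hw => ?_) hb ha
    refine (hHess z.1 hz.1 x hx w y).trans ?_
    have h1 : ‖z.1 - x‖ ≤ ε := by rw [← dist_eq_norm]; exact hzd.1.le
    have h2 : ‖w - y‖ ≤ ε := by rw [← dist_eq_norm]; exact hw
    have h3 : Real.sqrt (‖z.1 - x‖ ^ 2 + ‖w - y‖ ^ 2) ≤ 2 * ε := by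
      refine Real.sqrt_le_iff.2 ⟨by positivity, ?_⟩
      nlinarith [norm_nonneg (z.1 - x), norm_nonneg (w - y)]
    calc _ ≤ M * (2 * (c / (4 * M))) := by gcongr; exact h3.trans (by linarith)
      _ = c / 2 := by field_simp; norm_num
  -- Quantitative inverse function theorem: the inverse Hessian has norm at most `1/c` and the
  -- nonlinear error is `c/2`, so the image of the `ε`-ball contains a ball of radius `(c/2)ε`, and
  -- with it the value `0`.
  have hsurj := happ.surjOn_closedBall_of_nonlinearRightInverse inv hεpos.le subset_rfl
  have hmem : (0 : Euc m) ∈ Metric.closedBall (gradY g z.1 y)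
      (((inv.nnnorm : ℝ)⁻¹ - ((c / 2).toNNReal : ℝ)) * ε) := by
    have h1 : (inv.nnnorm : ℝ)⁻¹ - ((c / 2).toNNReal : ℝ) = c / 2 := by
      change (((c.toNNReal)⁻¹ : NNReal) : ℝ)⁻¹ - _ = _
      rw [NNReal.coe_inv, inv_inv, Real.coe_toNNReal c hc.le, Real.coe_toNNReal _ (by positivity)]
      ring
    rw [h1, Metric.mem_closedBall, dist_zero_left]
    exact hzg.le
  obtain ⟨w, hw, hw0⟩ := hsurj hmem
  have hwY : w ∈ Y' := by
    refine interior_subset (hball ?_)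
    rw [Metric.mem_ball]
    exact lt_of_le_of_lt hw (by linarith)
  refine Metric.mem_cthickening_of_dist_le _ w _ _ ⟨hwY, hw0⟩ ?_
  have h3 := dist_triangle_right z.2 w y
  rw [Metric.mem_closedBall] at hw
  linarith [hzd.2]

/-- Local bounds combine by compactness. Near a non-stationary pair continuity suffices; near a
stationary one nothing has to be bounded, since persistence puts every nearby `y` within `r` of a
stationary point. -/
lemma exists_gradient_lower_bound (hM : 0 < M) (hX : IsCompact X) (hY : IsCompact Y)
    (hY' : IsCompact Y') (hYY' : Y ⊆ interior Y')
    (hL : ∀ x ∈ X, IsLipschitzHessian (g x) (gradY g x) (hessY g x) M)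
    (hgrad : ContinuousOn (fun p : Euc n × Euc m => gradY g p.1 p.2) (X ×ˢ Set.univ))
    (hHess : ∀ x ∈ X, ∀ x' ∈ X, ∀ y y' : Euc m,
      ‖hessY g x y - hessY g x' y'‖ ≤ M * Real.sqrt (‖x - x'‖ ^ 2 + ‖y - y'‖ ^ 2))
    {δ r : ℝ} (hδ : 0 < δ) (hr : 0 < r) :
    ∃ a : ℝ, 0 < a ∧ ∀ x ∈ bifurcationFar X g δ,
      ∀ y ∈ Y \ Metric.cthickening r (critSet Y' g x), a ≤ ‖gradY g x y‖ := by
  obtain ⟨c, hc, hcH⟩ := exists_hessian_lower_bound hX hY' hgrad (continuousOn_hessY hHess) hδ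
  have hK : IsCompact (bifurcationFar X g δ ×ˢ Y) := (isCompact_bifurcationFar hX δ).prod hY
  have hsub : bifurcationFar X g δ ×ˢ Y ⊆ X ×ˢ Set.univ := fun p hp => ⟨hp.1.1, trivial⟩
  suffices h : ∃ a : ℝ, 0 < a ∧ ∀ z ∈ bifurcationFar X g δ ×ˢ Y,
      z.2 ∉ Metric.cthickening r (critSet Y' g z.1) → a ≤ ‖gradY g z.1 z.2‖ by
    obtain ⟨a, ha, hle⟩ := h
    exact ⟨a, ha, fun x hx y hy => hle (x, y) ⟨hx, hy.1⟩ hy.2⟩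
  refine hK.induction_on (p := fun s => ∃ a : ℝ, 0 < a ∧ ∀ z ∈ s,
      z.2 ∉ Metric.cthickening r (critSet Y' g z.1) → a ≤ ‖gradY g z.1 z.2‖)
    ⟨1, one_pos, by simp⟩ ?_ ?_ ?_
  · rintro s t hst ⟨a, ha, hle⟩
    exact ⟨a, ha, fun z hz => hle z (hst hz)⟩
  · rintro s t ⟨a, ha, hale⟩ ⟨b, hb, hble⟩
    refine ⟨min a b, lt_min ha hb, fun z hz hn => ?_⟩
    rcases hz with hz | hz
    · exact (min_le_left _ _).trans (hale z hz hn)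
    · exact (min_le_right _ _).trans (hble z hz hn)
  · rintro ⟨x, y⟩ hp
    by_cases h0 : gradY g x y = 0
    · refine ⟨_, nhdsWithin_mono _ hsub (eventually_mem_cthickening_critSet hM hL hgrad hHess
        hp.1.1 (hYY' hp.2) h0 (isMorseAt_of_mem_bifurcationFar hδ hp.1 y h0) hc
        (hcH x hp.1 y (interior_subset (hYY' hp.2)) h0) hr), 1, one_pos, fun z hz hn => ?_⟩
      exact absurd hz hn
    · have h1 : 0 < ‖gradY g x y‖ := norm_pos_iff.2 h0
      have h2 := ((hgrad.mono hsub) (x, y) hp).norm.eventually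
        (lt_mem_nhds (show ‖gradY g x y‖ / 2 < ‖gradY g x y‖ by linarith))
      exact ⟨_, h2, ‖gradY g x y‖ / 2, by positivity, fun z hz _ => le_of_lt hz⟩

lemma exists_isGradientBound (hM : 0 < M) (hX : IsCompact X) (hY : IsCompact Y)
    (hY' : IsCompact Y') (hYY' : Y ⊆ interior Y')
    (hL : ∀ x ∈ X, IsLipschitzHessian (g x) (gradY g x) (hessY g x) M)
    (hgrad : ContinuousOn (fun p : Euc n × Euc m => gradY g p.1 p.2) (X ×ˢ Set.univ))
    (hHess : ∀ x ∈ X, ∀ x' ∈ X, ∀ y y' : Euc m,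
      ‖hessY g x y - hessY g x' y'‖ ≤ M * Real.sqrt (‖x - x'‖ ^ 2 + ‖y - y'‖ ^ 2)) :
    ∃ α : ℝ → ℝ → ℝ, IsGradientBound X Y Y' g α := by
  have h : ∀ δ r : ℝ, ∃ a : ℝ, 0 < δ → 0 < r → 0 < a ∧ ∀ x ∈ bifurcationFar X g δ,
      ∀ y ∈ Y \ Metric.cthickening r (critSet Y' g x), a ≤ ‖gradY g x y‖ := fun δ r => by
    by_cases hδ : 0 < δ
    · by_cases hr : 0 < r
      · obtain ⟨a, ha⟩ := exists_gradient_lower_bound hM hX hY hY' hYY' hL hgrad hHess hδ hr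
        exact ⟨a, fun _ _ => ha⟩
      · exact ⟨0, fun _ h => absurd h hr⟩
    · exact ⟨0, fun h => absurd h hδ⟩
  choose α hα using h
  exact ⟨α, fun δ r hδ hr => ⟨(hα δ r hδ hr).1, fun x hx =>
    (hα δ r hδ hr).2 x (diff_bifurcationNhd_subset δ hx)⟩⟩

end constants

/-! ### The bias of the inexact gradient -/

/-- An upper bound for the norm of the gradient of the Gaussian kernel. -/
noncomputable def gaussGradBound (n : ℕ) (ξ : ℝ) : ℝ :=
  ξ / (2 * Real.pi * ξ ^ 2) ^ ((n : ℝ) / 2) / ξ ^ 2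

lemma norm_gradient_gaussKernel_le {ξ : ℝ} (hξ : 0 < ξ) (x z : Euc n) :
    ‖gradient (fun x' => gaussKernel ξ (x' - z)) x‖ ≤ gaussGradBound n ξ := by
  rw [gradient_gaussKernel_sub hξ, norm_smul, norm_smul,
    Real.norm_of_nonneg (gaussKernel_nonneg _ _), Real.norm_of_nonneg (by positivity), norm_sub_rev]
  calc _ = ‖x - z‖ * gaussKernel ξ (x - z) / ξ ^ 2 := by ring
    _ ≤ _ := by
      unfold gaussGradBound
      gcongr
      exact gaussKernel_le_one_mul hξ _

lemma integrable_smul_gradient_gaussKernel {ξ F : ℝ} {φ : Euc n → ℝ} (hξ : 0 < ξ)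
    (hφm : AEStronglyMeasurable φ volume) (hφ : ∀ z, |φ z| ≤ F) (x : Euc n) :
    Integrable fun z => φ z • gradient (fun x' => gaussKernel ξ (x' - z)) x := by
  simp_rw [gradient_gaussKernel_sub hξ, smul_comm (φ _) (gaussKernel ξ _)]
  rw [integrable_gaussKernel_sub_smul_iff hξ x (fun z => φ z • ((1 / ξ ^ 2) • (z - x)))]
  simp_rw [add_sub_cancel_left]
  exact integrable_comp_smul_stdGaussian hφm hφ hξ x
    ((integrable_id_stdGaussian.smul ξ).smul (1 / ξ ^ 2))

/-- The gradient of the kernel is bounded, so an `L¹` bound on the difference of the values is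
enough. -/
lemma norm_inexactGrad_sub_le {ξ F a b : ℝ} {φ₁ φ₂ : Euc n → ℝ} {A S : Set (Euc n)} (hξ : 0 < ξ)
    (hφ₁m : AEStronglyMeasurable φ₁ volume) (hφ₁ : ∀ z, |φ₁ z| ≤ F)
    (hφ₂m : AEStronglyMeasurable φ₂ volume) (hφ₂ : ∀ z, |φ₂ z| ≤ F)
    (hA : MeasurableSet A) (hAf : volume A ≠ ⊤) (hS : MeasurableSet S) (hSf : volume S ≠ ⊤)
    (h : ∀ z, |φ₁ z - φ₂ z| ≤ A.indicator (fun _ => a) z + S.indicator (fun _ => b) z)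
    (x : Euc n) :
    ‖inexactGrad ξ φ₁ x - inexactGrad ξ φ₂ x‖ ≤
      gaussGradBound n ξ * (volume.real A * a + volume.real S * b) := by
  unfold inexactGrad
  rw [← integral_sub (integrable_smul_gradient_gaussKernel hξ hφ₁m hφ₁ x)
    (integrable_smul_gradient_gaussKernel hξ hφ₂m hφ₂ x)]
  have hi1 : Integrable (A.indicator fun _ => a) (volume : Measure (Euc n)) :=
    (integrable_indicator_iff hA).2 (integrableOn_const hAf)
  have hi2 : Integrable (S.indicator fun _ => b) (volume : Measure (Euc n)) :=
    (integrable_indicator_iff hS).2 (integrableOn_const hSf)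
  refine (norm_integral_le_of_norm_le ((hi1.add hi2).const_mul (gaussGradBound n ξ))
    (ae_of_all _ fun z => ?_)).trans_eq ?_
  · rw [← sub_smul, norm_smul, mul_comm, Real.norm_eq_abs]
    exact mul_le_mul (norm_gradient_gaussKernel_le hξ x z) (h z) (abs_nonneg _)
      ((norm_nonneg _).trans (norm_gradient_gaussKernel_le hξ x z))
  · rw [integral_const_mul]
    congr 1
    simp only [Pi.add_apply]
    rw [integral_add hi1 hi2, integral_indicator_const _ hA, integral_indicator_const _ hS]
    simp

section values

variable {X : Set (Euc n)} {f g : Euc n → Euc m → ℝ} {fbar : ℝ} {r : Euc n → Euc m}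

lemma abs_extendedValue_le (hfbar : 0 ≤ fbar) (h : ∀ x ∈ X, |f x (r x)| ≤ fbar) (z : Euc n) :
    |extendedValue X f fbar r z| ≤ fbar := by
  unfold extendedValue
  split_ifs with hz
  · exact h z hz
  · exact (abs_of_nonneg hfbar).le

lemma measurable_extendedValue (hX : MeasurableSet X)
    (hf : ContinuousOn (fun p : Euc n × Euc m => f p.1 p.2) (X ×ˢ Set.univ))
    (hr : Measurable fun x : X => r x) : Measurable (extendedValue X f fbar r) := by
  refine measurable_of_restrict_of_restrict_compl hX ?_ ?_
  · have h1 : X.domRestrict (extendedValue X f fbar r) =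
        (X ×ˢ Set.univ).domRestrict (fun p : Euc n × Euc m => f p.1 p.2) ∘
          fun x : X => ⟨((x : Euc n), r x), x.2, trivial⟩ := by
      ext x
      simp [extendedValue]
    rw [h1]
    exact hf.domRestrict.measurable.comp
      ((measurable_subtype_coe.prodMk hr).subtype_mk)
  · have h1 : (Xᶜ).domRestrict (extendedValue X f fbar r) = fun _ => fbar := by
      ext x
      simp [extendedValue, show (x : Euc n) ∉ X from x.2]
    rw [h1]
    exact measurable_const

end values

section bias

variable {X : Set (Euc n)} {Y Y' : Set (Euc m)} {f g : Euc n → Euc m → ℝ} {y₀ : Euc m}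
  {M Lf g0 glow fbar ξ : ℝ} {μ : ℝ → ℝ} {α : ℝ → ℝ → ℝ}
  {yseq yhat : ℕ → Euc n → Euc m} {ycd : Euc n → Euc m}

/-- Accumulation points stay in the closed sublevel set that contains all iterates. -/
lemma correspondence_value_le (hM : 0 < M)
    (hL : ∀ x ∈ X, IsLipschitzHessian (g x) (gradY g x) (hessY g x) M)
    (hseq : IsCubicNewtonSeq X g M y₀ yseq) (hcd : IsCorrespondence X f g yseq ycd)
    {x : Euc n} (hx : x ∈ X) : g x (ycd x) ≤ g x y₀ := by
  have hcont : Continuous (g x) :=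
    continuous_iff_continuousAt.2 fun y => ((hL x hx).hasGradientAt y).hasFDerivAt.continuousAt
  have hcl : IsClosed {y | g x y ≤ g x y₀} := isClosed_le hcont continuous_const
  have h1 : MapClusterPt (ycd x) atTop fun k => yseq k x := (hcd x hx).1.1
  have h2 : ClusterPt (ycd x) (𝓟 {y | g x y ≤ g x y₀}) := by
    refine ClusterPt.mono h1 ?_
    rw [le_principal_iff, mem_map]
    exact Eventually.of_forall fun k => newton_value_le hM (hL x hx) hx hseq k
  rw [← mem_closure_iff_clusterPt, hcl.closure_eq] at h2
  exact h2

variable (hM : 0 < M) (hL : ∀ x ∈ X, IsLipschitzHessian (g x) (gradY g x) (hessY g x) M)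
  (hglow : ∀ x ∈ X, ∀ y : Euc m, glow ≤ g x y)
  (hY : ∀ x ∈ X, {y | g x y ≤ g x y₀} ⊆ Y) (hY' : IsCompact Y')
  (hLf : ∀ x ∈ X, ∀ x' ∈ X, ∀ y y' : Euc m, g x y ≤ g x y₀ → g x' y' ≤ g x' y₀ →
      |f x y - f x' y'| ≤ Lf * Real.sqrt (‖x - x'‖ ^ 2 + ‖y - y'‖ ^ 2))
  (hg0 : ∀ x ∈ X, g x y₀ ≤ g0)
  (hμ : IsEigenvalueBound X Y' g μ) (hα : IsGradientBound X Y Y' g α)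
  (hseq : IsCubicNewtonSeq X g M y₀ yseq) (hout : IsCubicNewtonOutput X g M yseq yhat)
  (hcd : IsCorrespondence X f g yseq ycd)

include hM hL hglow hY hY' hLf hg0 hμ hα hseq hout hcd

lemma abs_extendedValue_sub_le {x : Euc n} {δ ρ : ℝ} {K : ℕ} (hρ : 0 < ρ) (hδ : 0 < δ)
    (hx : x ∈ X \ bifurcationNhd X g δ) (hK : stepThreshold (g0 - glow) M μ α ρ δ < K) :
    |extendedValue X f fbar (yhat K) x - extendedValue X f fbar ycd x| ≤ 2 * |Lf| * ρ := by
  obtain ⟨z, hz, hzv, hzd⟩ := exists_attainableSet_eq_singleton hM (hL x hx.1) hseq hout hx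
    (hY x hx.1) hY' hμ hα (hglow x hx.1) (hg0 x hx.1) hρ hδ hK
  have hcdz : ycd x = z := by
    have := (hcd x hx.1).1
    rwa [hz] at this
  simp only [extendedValue, hx.1, if_true, hcdz]
  refine (hLf x hx.1 x hx.1 _ _ (output_value_le hM (hL x hx.1) hx.1 hseq hout K) hzv).trans ?_
  simp only [sub_self, norm_zero, ne_eq, OfNat.ofNat_ne_zero, not_false_eq_true, zero_pow,
    zero_add, Real.sqrt_sq (norm_nonneg _)]
  calc _ ≤ |Lf| * (2 * ρ) := by
        gcongr
        exact le_abs_self _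
    _ = _ := by ring

lemma tendsto_extendedValue {x : Euc n} (hx : x ∉ X ∩ closure (bifurcationSet X g)) :
    Tendsto (fun K => extendedValue X f fbar (yhat K) x) atTop
      (𝓝 (extendedValue X f fbar ycd x)) := by
  by_cases hxX : x ∈ X
  · have hcl : x ∉ closure (bifurcationSet X g) := fun h => hx ⟨hxX, h⟩
    obtain ⟨δ, hδ, hxδ⟩ : ∃ δ : ℝ, 0 < δ ∧ x ∉ Metric.cthickening δ (bifurcationSet X g) := by
      by_contra! h
      exact hcl (Metric.closure_eq_iInter_cthickening (bifurcationSet X g) ▸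
        Set.mem_iInter₂.2 h)
    have hx' : x ∈ X \ bifurcationNhd X g δ := ⟨hxX, fun h => hxδ h.2⟩
    rw [Metric.tendsto_atTop]
    intro ε hε
    -- This `ρ` makes `2|Lf|ρ < ε`; the `+ 1` covers `Lf = 0`.
    have hρ : 0 < ε / (2 * (2 * |Lf| + 1)) := by positivity
    obtain ⟨K₀, hK₀⟩ := exists_nat_gt
      (stepThreshold (g0 - glow) M μ α (ε / (2 * (2 * |Lf| + 1))) δ)
    refine ⟨K₀, fun K hK => ?_⟩
    have h1 := abs_extendedValue_sub_le (fbar := fbar) hM hL hglow hY hY' hLf hg0 hμ hα hseq hout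
      hcd hρ hδ hx' (hK₀.trans_le (by exact_mod_cast hK))
    rw [Real.dist_eq]
    refine h1.trans_lt ?_
    rw [← mul_div_assoc, div_lt_iff₀ (by positivity)]
    nlinarith [abs_nonneg Lf]
  · simp only [extendedValue, hxX, if_false]
    exact tendsto_const_nhds

/-- The values along `ycd` are the a.e. limit of the measurable values along `yhat K`, so no
measurability of `ycd` itself is involved. -/
lemma aestronglyMeasurable_correspondence_value (hX : IsCompact X)
    (hf : ContinuousOn (fun p : Euc n × Euc m => f p.1 p.2) (X ×ˢ Set.univ))
    (hmeas : ∀ K, Measurable fun x : X => yhat K x)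
    (hnull : volume (X ∩ closure (bifurcationSet X g)) = 0) :
    AEStronglyMeasurable (extendedValue X f fbar ycd) volume := by
  refine aestronglyMeasurable_of_tendsto_ae atTop (f := fun K => extendedValue X f fbar (yhat K))
    (fun K => (measurable_extendedValue hX.measurableSet hf (hmeas K)).aestronglyMeasurable) ?_
  have : ∀ᵐ x ∂(volume : Measure (Euc n)), x ∉ X ∩ closure (bifurcationSet X g) :=
    measure_eq_zero_iff_ae_notMem.1 hnull
  filter_upwards [this] with x hx
  exact tendsto_extendedValue hM hL hglow hY hY' hLf hg0 hμ hα hseq hout hcd hx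

lemma norm_inexactGrad_sub_correspondence_le (hX : IsCompact X)
    (hf : ContinuousOn (fun p : Euc n × Euc m => f p.1 p.2) (X ×ˢ Set.univ))
    (hmeas : ∀ K, Measurable fun x : X => yhat K x)
    (hnull : volume (X ∩ closure (bifurcationSet X g)) = 0) (hξ : 0 < ξ) (hfbar0 : 0 ≤ fbar)
    (hfbar : ∀ x ∈ X, ∀ y, g x y ≤ g x y₀ → |f x y| ≤ fbar)
    {C e : ℝ} (hvol : ∀ δ : ℝ, 0 < δ →
      volume.real (X ∩ Metric.cthickening δ (bifurcationSet X g)) ≤ C * δ ^ e)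
    {δ ρ : ℝ} {K : ℕ} (hρ : 0 < ρ) (hδ : 0 < δ)
    (hK : stepThreshold (g0 - glow) M μ α ρ δ < K) (x : Euc n) :
    ‖inexactGrad ξ (extendedValue X f fbar (yhat K)) x -
        inexactGrad ξ (extendedValue X f fbar ycd) x‖ ≤
      (gaussGradBound n ξ * volume.real X * (2 * |Lf|) + 1) * ρ +
        (gaussGradBound n ξ * C * (2 * fbar) + 1) * δ ^ e := by
  have hb1 : ∀ z, |extendedValue X f fbar (yhat K) z| ≤ fbar :=
    abs_extendedValue_le hfbar0 fun x hx =>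
      hfbar x hx _ (output_value_le hM (hL x hx) hx hseq hout K)
  have hb2 : ∀ z, |extendedValue X f fbar ycd z| ≤ fbar :=
    abs_extendedValue_le hfbar0 fun x hx =>
      hfbar x hx _ (correspondence_value_le hM hL hseq hcd hx)
  have hXf : volume X ≠ ⊤ := hX.measure_lt_top.ne
  have hB : 0 ≤ gaussGradBound n ξ := by unfold gaussGradBound; positivity
  refine (norm_inexactGrad_sub_le (A := bifurcationNhd X g δ) (S := X) (a := 2 * fbar)
    (b := 2 * |Lf| * ρ) hξ
    (measurable_extendedValue hX.measurableSet hf (hmeas K)).aestronglyMeasurable hb1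
    (aestronglyMeasurable_correspondence_value hM hL hglow hY hY' hLf hg0 hμ hα hseq hout hcd
      hX hf hmeas hnull) hb2
    (hX.measurableSet.inter Metric.isClosed_cthickening.measurableSet)
    (measure_ne_top_of_subset Set.inter_subset_left hXf) hX.measurableSet hXf
    (fun z => ?_) x).trans ?_
  · have h2 : 0 ≤ X.indicator (fun _ => 2 * |Lf| * ρ) z :=
      Set.indicator_nonneg (fun _ _ => by positivity) z
    have h3 : 0 ≤ (bifurcationNhd X g δ).indicator (fun _ => 2 * fbar) z :=
      Set.indicator_nonneg (fun _ _ => by positivity) z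
    by_cases hz : z ∈ bifurcationNhd X g δ
    · rw [Set.indicator_of_mem hz]
      have := (abs_sub _ _).trans (add_le_add (hb1 z) (hb2 z))
      linarith
    · by_cases hzX : z ∈ X
      · rw [Set.indicator_of_mem hzX]
        have := abs_extendedValue_sub_le (fbar := fbar) hM hL hglow hY hY' hLf hg0 hμ hα hseq hout
          hcd hρ hδ ⟨hzX, hz⟩ hK
        linarith
      · simp only [extendedValue, hzX, if_false, sub_self, abs_zero]
        linarith
  · have h1 := hvol δ hδ
    have h2 : 0 ≤ δ ^ e := by positivity
    have h3 : gaussGradBound n ξ * (volume.real (bifurcationNhd X g δ) * (2 * fbar)) ≤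
        gaussGradBound n ξ * (C * δ ^ e * (2 * fbar)) := by
      unfold bifurcationNhd
      gcongr
    linarith

end bias

/-! ### The metric projection -/

section projection

variable {X : Set (Euc n)}

lemma proj_spec (hne : X.Nonempty) (hX : IsCompact X) (z : Euc n) :
    proj X z ∈ X ∧ ∀ q ∈ X, ‖z - proj X z‖ ≤ ‖z - q‖ := by
  have h : ∃ p ∈ X, ∀ q ∈ X, ‖z - p‖ ≤ ‖z - q‖ := by
    obtain ⟨p, hp, hmin⟩ := hX.exists_isMinOn hne
      (show ContinuousOn (fun q => ‖z - q‖) X by fun_prop)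
    exact ⟨p, hp, fun q hq => hmin hq⟩
  unfold proj
  rw [dif_pos h]
  exact h.choose_spec

lemma inner_sub_proj_le (hne : X.Nonempty) (hX : IsCompact X) (hc : Convex ℝ X) (z : Euc n)
    {w : Euc n} (hw : w ∈ X) : inner ℝ (z - proj X z) (w - proj X z) ≤ 0 := by
  obtain ⟨hp, hmin⟩ := proj_spec hne hX z
  have : Nonempty X := hne.to_subtype
  refine (norm_eq_iInf_iff_real_inner_le_zero hc hp).1 (le_antisymm
    (le_ciInf fun q => hmin q q.2) ?_) w hw
  exact ciInf_le (f := fun q : X => ‖z - q‖) ⟨0, by rintro _ ⟨q, rfl⟩; positivity⟩ ⟨_, hp⟩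

lemma norm_proj_sub_proj_le (hne : X.Nonempty) (hX : IsCompact X) (hc : Convex ℝ X)
    (z w : Euc n) : ‖proj X z - proj X w‖ ≤ ‖z - w‖ := by
  have h1 := inner_sub_proj_le hne hX hc z (proj_spec hne hX w).1
  have h2 := inner_sub_proj_le hne hX hc w (proj_spec hne hX z).1
  set p := proj X z
  set q := proj X w
  have h3 : ‖p - q‖ ^ 2 ≤ inner ℝ (z - w) (p - q) := by
    have h4 : inner ℝ (z - p) (q - p) + inner ℝ (w - q) (p - q) =
        ‖p - q‖ ^ 2 - inner ℝ (z - w) (p - q) := by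
      rw [← neg_sub p q, inner_neg_right, ← real_inner_self_eq_norm_sq,
        show z - p = (z - w) + (w - q) - (p - q) by abel, inner_sub_left, inner_add_left]
      ring
    linarith
  have h5 := h3.trans (real_inner_le_norm _ _)
  rcases eq_or_lt_of_le (norm_nonneg (p - q)) with h | h
  · rw [← h]; positivity
  · exact le_of_mul_le_mul_right (by nlinarith) h

lemma continuous_proj (hne : X.Nonempty) (hX : IsCompact X) (hc : Convex ℝ X) :
    Continuous (proj X) :=
  (LipschitzWith.of_dist_le_mul (K := 1) fun z w => by
    simpa [dist_eq_norm] using norm_proj_sub_proj_le hne hX hc z w).continuous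

/-- The projected gradient mapping at `x` with step length `b` and direction `G`. -/
noncomputable def gradMapping (X : Set (Euc n)) (b : ℝ) (x G : Euc n) : Euc n :=
  (1 / b) • (x - proj X (x - b • G))

/-- The obtuse-angle inequality of the projection, tested at `x` itself; hence the condition `x ∈
X`. -/
lemma norm_gradMapping_sq_le (hne : X.Nonempty) (hX : IsCompact X) (hc : Convex ℝ X) {b : ℝ}
    (hb : 0 < b) {x : Euc n} (hx : x ∈ X) (G : Euc n) :
    ‖gradMapping X b x G‖ ^ 2 ≤ inner ℝ G (gradMapping X b x G) := by
  have h1 := inner_sub_proj_le hne hX hc (x - b • G) hx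
  unfold gradMapping
  set p := proj X (x - b • G)
  rw [show x - b • G - p = (x - p) - b • G by abel, inner_sub_left, real_inner_smul_left,
    real_inner_self_eq_norm_sq] at h1
  rw [norm_smul, real_inner_smul_right, Real.norm_of_nonneg (by positivity), mul_pow]
  have h2 : (1 / b) ^ 2 * ‖x - p‖ ^ 2 ≤ (1 / b) ^ 2 * (b * inner ℝ G (x - p)) := by
    gcongr; linarith
  calc _ ≤ _ := h2
    _ = _ := by field_simp

lemma norm_gradMapping_le (hne : X.Nonempty) (hX : IsCompact X) (hc : Convex ℝ X) {b : ℝ}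
    (hb : 0 < b) {x : Euc n} (hx : x ∈ X) (G : Euc n) : ‖gradMapping X b x G‖ ≤ ‖G‖ := by
  have h1 := (norm_gradMapping_sq_le hne hX hc hb hx G).trans (real_inner_le_norm _ _)
  rcases eq_or_lt_of_le (norm_nonneg (gradMapping X b x G)) with h | h
  · rw [← h]; positivity
  · exact le_of_mul_le_mul_right (by nlinarith) h

lemma norm_gradMapping_sub_le (hne : X.Nonempty) (hX : IsCompact X) (hc : Convex ℝ X) {b : ℝ}
    (hb : 0 < b) (x G D : Euc n) :
    ‖gradMapping X b x G - gradMapping X b x D‖ ≤ ‖G - D‖ := by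
  unfold gradMapping
  rw [← smul_sub, norm_smul, Real.norm_of_nonneg (by positivity), sub_sub_sub_cancel_left]
  have h1 := norm_proj_sub_proj_le hne hX hc (x - b • D) (x - b • G)
  rw [sub_sub_sub_cancel_left, ← smul_sub, norm_smul, Real.norm_of_nonneg hb.le] at h1
  calc _ ≤ 1 / b * (b * ‖G - D‖) := by gcongr
    _ = _ := by field_simp

/-- Descent in one step of the projected gradient method with an inexact gradient. -/
lemma gradMapping_descent (hne : X.Nonempty) (hX : IsCompact X) (hc : Convex ℝ X) {b L : ℝ}
    (hb : 0 < b) {x : Euc n} (hx : x ∈ X) {S : Euc n → ℝ} {D : Euc n} (G : Euc n)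
    (hS : ∀ v, S (x + v) ≤ S x + inner ℝ D v + L * ‖v‖ ^ 2) :
    (b - L * b ^ 2) * ‖gradMapping X b x G‖ ^ 2 ≤
      S x - S (proj X (x - b • G)) +
        b * (inner ℝ (G - D) (gradMapping X b x D) + ‖G - D‖ ^ 2) := by
  have h1 := norm_gradMapping_sq_le hne hX hc hb hx G
  have h2 := norm_gradMapping_sub_le hne hX hc hb x G D
  set q := gradMapping X b x G with hq
  set r := gradMapping X b x D
  have hp : proj X (x - b • G) = x + -(b • q) := by
    rw [hq, gradMapping, smul_smul, mul_one_div_cancel hb.ne', one_smul]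
    abel
  have h3 := hS (-(b • q))
  rw [← hp, norm_neg, norm_smul, Real.norm_of_nonneg hb.le, inner_neg_right,
    real_inner_smul_right] at h3
  -- Replaces `q`, which depends on the fresh samples, by `r`, which depends on `x` only and can be
  -- paired with the mean of `G - D`.
  have h4 : inner ℝ (G - D) (q - r) ≤ ‖G - D‖ ^ 2 := by
    refine (real_inner_le_norm _ _).trans ?_
    rw [sq]
    gcongr
  rw [inner_sub_right, inner_sub_left G D q] at h4
  have h5 : b * (‖q‖ ^ 2 - inner ℝ D q) ≤ b * (inner ℝ (G - D) r + ‖G - D‖ ^ 2) := by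
    gcongr
    linarith
  linarith

end projection

/-! ### The stochastic projected gradient method -/

section sgd

variable {X : Set (Euc n)} {ξ : ℝ} {φ : ℕ → Euc n → ℝ} {N : ℕ → ℕ} {β : ℕ → ℝ} {x₀ : Euc n}

lemma sgd_congr {U V : ℕ → ℕ → Euc n} {t : ℕ} (h : ∀ s < t, ∀ i < N s, U s i = V s i) :
    sgd X ξ φ N β x₀ U t = sgd X ξ φ N β x₀ V t := by
  induction t with
  | zero => rfl
  | succ t ih =>
    have h1 := ih fun s hs => h s (hs.trans (Nat.lt_succ_self t))
    have h2 : (fun i : Fin (N t) => U t i) = fun i : Fin (N t) => V t i :=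
      funext fun i => h t (Nat.lt_succ_self t) i i.2
    simp only [sgd, h1, h2]

lemma sgd_succ_mem (hne : X.Nonempty) (hX : IsCompact X) {t : ℕ} (ht : 1 ≤ t)
    (U : ℕ → ℕ → Euc n) : sgd X ξ φ N β x₀ U t ∈ X := by
  obtain ⟨t, rfl⟩ := Nat.exists_eq_add_of_le' ht
  exact (proj_spec hne hX _).1

lemma projGradMap_eq (U : ℕ → ℕ → Euc n) (t : ℕ) :
    projGradMap X ξ φ N β x₀ U t = gradMapping X (β t) (sgd X ξ φ N β x₀ U t)
      (estimator ξ (φ t) (N t) (sgd X ξ φ N β x₀ U t) fun i => U t i) := rfl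

lemma measurable_estimator {α : Type*} [MeasurableSpace α] {h : Euc n → ℝ} (hm : Measurable h)
    {k : ℕ} {a : α → Euc n} (ha : Measurable a) {w : α → Fin k → Euc n} (hw : Measurable w) :
    Measurable fun p => estimator ξ h k (a p) (w p) := by
  have h1 : Measurable fun p => ∑ i, h (a p + ξ • w p i) • w p i := by
    refine Finset.measurable_fun_sum _ fun i _ => ?_
    have hwi : Measurable fun p => w p i := (measurable_pi_apply i).comp hw
    exact (hm.comp (ha.add (hwi.const_smul ξ))).smul hwi
  exact h1.const_smul (1 / (k * ξ))

lemma measurable_sgd (hne : X.Nonempty) (hX : IsCompact X) (hc : Convex ℝ X)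
    (hφ : ∀ t, Measurable (φ t)) (t : ℕ) :
    Measurable fun U : ℕ → ℕ → Euc n => sgd X ξ φ N β x₀ U t := by
  induction t with
  | zero => exact measurable_const
  | succ t ih =>
    have hw : Measurable fun (U : ℕ → ℕ → Euc n) (i : Fin (N t)) => U t i := by fun_prop
    have h1 := measurable_estimator (ξ := ξ) (hφ t) ih hw
    simp only [sgd]
    exact (continuous_proj hne hX hc).measurable.comp (ih.sub (h1.const_smul (β t)))

lemma measurable_projGradMap (hne : X.Nonempty) (hX : IsCompact X) (hc : Convex ℝ X)
    (hφ : ∀ t, Measurable (φ t)) (t : ℕ) :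
    Measurable fun U : ℕ → ℕ → Euc n => projGradMap X ξ φ N β x₀ U t := by
  have h0 := measurable_sgd (ξ := ξ) (N := N) (β := β) (x₀ := x₀) hne hX hc hφ t
  have hw : Measurable fun (U : ℕ → ℕ → Euc n) (i : Fin (N t)) => U t i := by fun_prop
  have h1 := measurable_estimator (ξ := ξ) (hφ t) h0 hw
  have h2 := (continuous_proj hne hX hc).measurable.comp (h0.sub (h1.const_smul (β t)))
  exact (h0.sub h2).const_smul (1 / β t)

variable {Ω : Type*} [MeasurableSpace Ω] {P : Measure Ω} {u : ℕ → ℕ → Ω → Euc n}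

lemma map_sample_eq_pi [IsProbabilityMeasure P] (hm : ∀ t i, Measurable (u t i))
    (hmap : ∀ t i, P.map (u t i) = stdGaussian (Euc n))
    (hind : iIndepFun (fun (p : ℕ × ℕ) (ω : Ω) => u p.1 p.2 ω) P) (t k : ℕ) :
    P.map (fun ω (i : Fin k) => u t i ω) = Measure.pi fun _ : Fin k => stdGaussian (Euc n) := by
  have h1 : iIndepFun (fun (i : Fin k) (ω : Ω) => u t i ω) P :=
    hind.precomp (g := fun i : Fin k => (t, (i : ℕ))) fun i j hij => by
      simpa [Fin.ext_iff] using hij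
  have h2 := (iIndepFun_iff_map_fun_eq_pi_map
    fun i : Fin k => (hm t i).aemeasurable (μ := P)).1 h1
  simpa [hmap] using h2

/-- The iterate `t` depends on the finitely many samples drawn before iteration `t`, a block of
indices disjoint from that of the fresh samples. -/
lemma indepFun_sgd_sample (hne : X.Nonempty) (hX : IsCompact X) (hc : Convex ℝ X)
    (hφ : ∀ t, Measurable (φ t)) (hm : ∀ t i, Measurable (u t i))
    (hind : iIndepFun (fun (p : ℕ × ℕ) (ω : Ω) => u p.1 p.2 ω) P) (t : ℕ) :
    IndepFun (fun ω => sgd X ξ φ N β x₀ (fun t i => u t i ω) t)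
      (fun ω (i : Fin (N t)) => u t i ω) P := by
  classical
  set A : Finset (ℕ × ℕ) := (Finset.range t).sigma (fun s => Finset.range (N s)) |>.image
    fun p => (p.1, p.2) with hA
  set B : Finset (ℕ × ℕ) := (Finset.range (N t)).image fun i => (t, i) with hB
  have hAmem : ∀ s i, (s, i) ∈ A ↔ s < t ∧ i < N s := by
    intro s i
    simp [hA]
  have hdisj : Disjoint A B := by
    rw [Finset.disjoint_left]
    rintro ⟨s, i⟩ hp hq
    have h1 := ((hAmem s i).1 hp).1
    simp [hB] at hq
    omega
  have h1 := hind.indepFun_finset A B hdisj fun p => hm p.1 p.2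
  -- Samples outside the block are set to `0`, which does not change the iterate, by `sgd_congr`.
  let ext : (A → Euc n) → ℕ → ℕ → Euc n := fun a s i =>
    if h : (s, i) ∈ A then a ⟨(s, i), h⟩ else 0
  have hext : Measurable ext := by
    refine measurable_pi_lambda _ fun s => measurable_pi_lambda _ fun i => ?_
    by_cases h : (s, i) ∈ A
    · simp only [ext, h, dif_pos]
      fun_prop
    · simp only [ext, h, dif_neg, not_false_eq_true]
      fun_prop
  have hsel : Measurable fun (b : B → Euc n) (i : Fin (N t)) =>
      b ⟨(t, (i : ℕ)), by simp [hB]⟩ := by fun_prop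
  have h2 := h1.comp ((measurable_sgd (ξ := ξ) (N := N) (β := β) (x₀ := x₀) hne hX hc hφ t).comp
    hext) hsel
  have h3 : (fun ω => sgd X ξ φ N β x₀ (fun t i => u t i ω) t) =
      (((fun U => sgd X ξ φ N β x₀ U t) ∘ ext) ∘ fun ω (p : A) => u p.1.1 p.1.2 ω) := by
    ext1 ω
    refine sgd_congr fun s hs i hi => ?_
    simp [ext, (hAmem s i).2 ⟨hs, hi⟩]
  rw [h3]
  exact h2

end sgd

/-! ### The error term of the descent inequality. -/

section noise

variable {X : Set (Euc n)} {ξ F b Δ : ℝ} {φ ψ : Euc n → ℝ} {k : ℕ}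

/-- The error term in the descent inequality, at the point `x` and for the samples `U`. -/
noncomputable def noise (X : Set (Euc n)) (ξ b : ℝ) (φ ψ : Euc n → ℝ) (k : ℕ) (x : Euc n)
    (U : Fin k → Euc n) : ℝ :=
  inner ℝ (estimator ξ φ k x U - inexactGrad ξ ψ x) (gradMapping X b x (inexactGrad ξ ψ x)) +
    ‖estimator ξ φ k x U - inexactGrad ξ ψ x‖ ^ 2

/-- It is the derivative of the smoothed function up to Riesz duality, and derivatives are
measurable. -/
lemma measurable_inexactGrad (hξ : 0 < ξ) (hψm : AEStronglyMeasurable ψ volume)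
    (hψ : ∀ z, |ψ z| ≤ F) : Measurable (inexactGrad ξ ψ) := by
  have h1 : inexactGrad ξ ψ = fun x => (InnerProductSpace.toDual ℝ (Euc n)).symm
      (fderiv ℝ (smoothed ξ ψ) x) :=
    funext fun x => ((hasGradientAt_smoothed hψm hψ hξ x).gradient).symm
  rw [h1]
  exact (InnerProductSpace.toDual ℝ (Euc n)).symm.continuous.measurable.comp
    (measurable_fderiv ℝ _)

lemma measurable_noise (hne : X.Nonempty) (hX : IsCompact X) (hc : Convex ℝ X) (hξ : 0 < ξ)
    (hφ : Measurable φ) (hψm : AEStronglyMeasurable ψ volume) (hψ : ∀ z, |ψ z| ≤ F) :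
    Measurable fun p : Euc n × (Fin k → Euc n) => noise X ξ b φ ψ k p.1 p.2 := by
  have h1 : Measurable fun p : Euc n × (Fin k → Euc n) => estimator ξ φ k p.1 p.2 :=
    measurable_estimator hφ measurable_fst measurable_snd
  have h2 := measurable_inexactGrad hξ hψm hψ
  have h3 := (continuous_proj hne hX hc).measurable
  unfold noise gradMapping
  fun_prop

lemma norm_estimator_le (hξ : 0 < ξ) (hφ : ∀ z, |φ z| ≤ F) (x : Euc n) (U : Fin k → Euc n) :
    ‖estimator ξ φ k x U‖ ≤ F / (k * ξ) * ∑ i, ‖U i‖ := by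
  unfold estimator
  rw [norm_smul, Real.norm_of_nonneg (by positivity), div_eq_mul_one_div F, mul_comm F, mul_assoc,
    Finset.mul_sum]
  gcongr
  refine (norm_sum_le _ _).trans (Finset.sum_le_sum fun i _ => ?_)
  rw [norm_smul]
  gcongr
  exact hφ _

lemma memLp_sum_norm_pi (c : ℝ) :
    MemLp (fun U : Fin k → Euc n => c * ∑ i, ‖U i‖) 2
      (Measure.pi fun _ : Fin k => stdGaussian (Euc n)) := by
  have h1 : MemLp (fun v : Euc n => ‖v‖) 2 (stdGaussian (Euc n)) :=
    (IsGaussian.memLp_id (stdGaussian (Euc n)) 2 (by simp)).norm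
  have h2 : MemLp (fun U : Fin k → Euc n => ∑ i, ‖U i‖) 2
      (Measure.pi fun _ : Fin k => stdGaussian (Euc n)) :=
    memLp_finsetSum _ fun i _ => memLp_comp_eval_pi h1 i
  exact h2.const_mul c

/-- A bound uniform in `x ∈ X` and integrable in the samples; it allows Fubini's theorem on the
joint law. -/
lemma abs_noise_le (hne : X.Nonempty) (hX : IsCompact X) (hc : Convex ℝ X) (hξ : 0 < ξ)
    (hb : 0 < b) (hφ : ∀ z, |φ z| ≤ F) {C : ℝ} {x : Euc n} (hx : x ∈ X)
    (hC : ‖inexactGrad ξ ψ x‖ ≤ C) (U : Fin k → Euc n) :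
    |noise X ξ b φ ψ k x U| ≤
      2 * (F / (k * ξ) * ∑ i, ‖U i‖ + C) ^ 2 := by
  have h1 := norm_estimator_le hξ hφ x U
  have h2 := norm_gradMapping_le hne hX hc hb hx (inexactGrad ξ ψ x)
  set s := F / (k * ξ) * ∑ i, ‖U i‖
  have hs : 0 ≤ s := (norm_nonneg _).trans h1
  have h3 : ‖estimator ξ φ k x U - inexactGrad ξ ψ x‖ ≤ s + C :=
    (norm_sub_le _ _).trans (add_le_add h1 hC)
  unfold noise
  refine (abs_add_le _ _).trans ?_
  have h4 := (abs_real_inner_le_norm (estimator ξ φ k x U - inexactGrad ξ ψ x)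
    (gradMapping X b x (inexactGrad ξ ψ x)))
  have h5 : ‖estimator ξ φ k x U - inexactGrad ξ ψ x‖ *
      ‖gradMapping X b x (inexactGrad ξ ψ x)‖ ≤ (s + C) * (s + C) := by
    have hC0 : 0 ≤ C := (norm_nonneg _).trans hC
    gcongr
    linarith
  have h6 : ‖estimator ξ φ k x U - inexactGrad ξ ψ x‖ ^ 2 ≤ (s + C) ^ 2 := by gcongr
  rw [abs_of_nonneg (sq_nonneg ‖estimator ξ φ k x U - inexactGrad ξ ψ x‖)]
  linarith

lemma integral_noise_le (hne : X.Nonempty) (hX : IsCompact X) (hc : Convex ℝ X) (hξ : 0 < ξ)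
    (hb : 0 < b) (hk : 0 < k) (hφm : Measurable φ) (hφ : ∀ z, |φ z| ≤ F)
    (hψm : AEStronglyMeasurable ψ volume) (hψ : ∀ z, |ψ z| ≤ F) {x : Euc n} (hx : x ∈ X)
    (hΔ : ‖inexactGrad ξ φ x - inexactGrad ξ ψ x‖ ≤ Δ) :
    ∫ U, noise X ξ b φ ψ k x U ∂(Measure.pi fun _ : Fin k => stdGaussian (Euc n)) ≤
      Real.sqrt (2 / Real.pi) * (F / ξ) * Δ + (n * F ^ 2 / (k * ξ ^ 2) + Δ ^ 2) := by
  set ν := Measure.pi fun _ : Fin k => stdGaussian (Euc n)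
  set D := inexactGrad ξ ψ x with hD
  set μ := inexactGrad ξ φ x with hμ
  set w := gradMapping X b x D with hw
  have hφa := hφm.aestronglyMeasurable (μ := volume)
  have hest := integrable_estimator hφa hφ hξ k x
  have hmean := integral_estimator hφa hφ hξ hk x
  have hvar := integral_norm_estimator_sub_sq_le hφa hφ hξ hk x
  have hsq := integrable_norm_estimator_sub_sq hφa hφ hξ k x μ
  have hlin : Integrable (fun U => inner ℝ (w + (2 : ℝ) • (μ - D)) (estimator ξ φ k x U - μ)) ν :=
    (hest.sub (integrable_const μ)).const_inner _
  have hlin0 : ∫ U, inner ℝ (w + (2 : ℝ) • (μ - D)) (estimator ξ φ k x U - μ) ∂ν = 0 := by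
    rw [integral_inner (by exact hest.sub (integrable_const μ)),
      integral_sub hest (integrable_const μ), hmean, ← hμ]
    simp
  have heq : ∀ U, noise X ξ b φ ψ k x U = inner ℝ (w + (2 : ℝ) • (μ - D)) (estimator ξ φ k x U - μ) +
      ‖estimator ξ φ k x U - μ‖ ^ 2 + (inner ℝ (μ - D) w + ‖μ - D‖ ^ 2) := by
    intro U
    unfold noise
    rw [← hD, ← hw, show estimator ξ φ k x U - D = (estimator ξ φ k x U - μ) + (μ - D) by abel,
      norm_add_sq_real, inner_add_left, inner_add_left, real_inner_smul_left,
      real_inner_comm w, real_inner_comm (μ - D)]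
    ring
  simp_rw [heq]
  rw [integral_add (by exact hlin.add hsq) (integrable_const _), integral_add hlin hsq, hlin0]
  have hDn := norm_inexactGrad_le hψm hψ hξ x
  have hwn : ‖w‖ ≤ Real.sqrt (2 / Real.pi) * (F / ξ) :=
    (norm_gradMapping_le hne hX hc hb hx D).trans hDn
  have hΔ0 : 0 ≤ Δ := (norm_nonneg _).trans hΔ
  have h1 : inner ℝ (μ - D) w ≤ Δ * (Real.sqrt (2 / Real.pi) * (F / ξ)) :=
    (real_inner_le_norm _ _).trans (by gcongr)
  have h2 : ‖μ - D‖ ^ 2 ≤ Δ ^ 2 := by gcongr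
  simp only [integral_const, probReal_univ, one_smul, zero_add]
  linarith

end noise

/-! ### The convergence bound, first for each iteration and then for the random index. -/

section convergence

variable {X : Set (Euc n)} {ξ F : ℝ} {φ : ℕ → Euc n → ℝ} {ψ : Euc n → ℝ} {N : ℕ → ℕ}
  {β Δ : ℕ → ℝ} {x₀ : Euc n} {Ω : Type*} [MeasurableSpace Ω] {P : Measure Ω}
  [IsProbabilityMeasure P] {u : ℕ → ℕ → Ω → Euc n}

/-- By independence the joint law of iterate and fresh samples is a product, so the bound for a
fixed `x` integrates over the iterates. `t ≥ 1` is required because `x₀` may lie outside `X`. -/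
lemma integral_noise_sgd_le (hne : X.Nonempty) (hX : IsCompact X) (hc : Convex ℝ X) (hξ : 0 < ξ)
    (hβ : ∀ t, 0 < β t) (hN : ∀ t, 0 < N t) (hφm : ∀ t, Measurable (φ t))
    (hφ : ∀ t z, |φ t z| ≤ F) (hψm : AEStronglyMeasurable ψ volume) (hψ : ∀ z, |ψ z| ≤ F)
    (hΔ : ∀ t x, ‖inexactGrad ξ (φ t) x - inexactGrad ξ ψ x‖ ≤ Δ t)
    (hm : ∀ t i, Measurable (u t i)) (hmap : ∀ t i, P.map (u t i) = stdGaussian (Euc n))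
    (hind : iIndepFun (fun (p : ℕ × ℕ) (ω : Ω) => u p.1 p.2 ω) P) {t : ℕ} (ht : 1 ≤ t) :
    Integrable (fun ω => noise X ξ (β t) (φ t) ψ (N t) (sgd X ξ φ N β x₀ (fun t i => u t i ω) t)
      fun i => u t i ω) P ∧
    ∫ ω, noise X ξ (β t) (φ t) ψ (N t) (sgd X ξ φ N β x₀ (fun t i => u t i ω) t)
      (fun i => u t i ω) ∂P ≤
      Real.sqrt (2 / Real.pi) * (F / ξ) * Δ t + (n * F ^ 2 / (N t * ξ ^ 2) + Δ t ^ 2) := by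
  set xt : Ω → Euc n := fun ω => sgd X ξ φ N β x₀ (fun t i => u t i ω) t with hxt
  set ut : Ω → Fin (N t) → Euc n := fun ω i => u t i ω with hut
  have hxm : Measurable xt := (measurable_sgd hne hX hc hφm t).comp
    (measurable_pi_lambda _ fun t => measurable_pi_lambda _ fun i => hm t i)
  have hum : Measurable ut := measurable_pi_lambda _ fun i => hm t i
  have hlaw : P.map (fun ω => (xt ω, ut ω)) =
      (P.map xt).prod (Measure.pi fun _ : Fin (N t) => stdGaussian (Euc n)) := by
    rw [(indepFun_iff_map_prod_eq_prod_map_map hxm.aemeasurable hum.aemeasurable).1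
      (indepFun_sgd_sample hne hX hc hφm hm hind t), map_sample_eq_pi hm hmap hind]
  have : IsProbabilityMeasure (P.map xt) := Measure.isProbabilityMeasure_map hxm.aemeasurable
  have hnm := measurable_noise (k := N t) (b := β t) hne hX hc hξ (hφm t) hψm hψ
  have hxX : ∀ᵐ x ∂(P.map xt), x ∈ X :=
    (ae_map_iff hxm.aemeasurable hX.measurableSet).2
      (ae_of_all _ fun ω => sgd_succ_mem hne hX ht _)
  have hint : Integrable (fun p : Euc n × (Fin (N t) → Euc n) =>
      noise X ξ (β t) (φ t) ψ (N t) p.1 p.2)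
      ((P.map xt).prod (Measure.pi fun _ : Fin (N t) => stdGaussian (Euc n))) := by
    have h1 : Integrable (fun U : Fin (N t) → Euc n =>
        2 * (F / (N t * ξ) * ∑ i, ‖U i‖ + Real.sqrt (2 / Real.pi) * (F / ξ)) ^ 2)
        (Measure.pi fun _ : Fin (N t) => stdGaussian (Euc n)) :=
      (((memLp_sum_norm_pi _).add (memLp_const _)).integrable_sq).const_mul 2
    refine (h1.comp_snd (P.map xt)).mono' hnm.aestronglyMeasurable ?_
    filter_upwards [Measure.quasiMeasurePreserving_fst.ae hxX] with p hp
    exact abs_noise_le hne hX hc hξ (hβ t) (hφ t) hp (norm_inexactGrad_le hψm hψ hξ _) _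
  have hpair : Measurable fun ω => (xt ω, ut ω) := hxm.prodMk hum
  refine ⟨?_, ?_⟩
  · rw [← hlaw] at hint
    exact hint.comp_measurable hpair
  · have h2 := integral_map (μ := P) hpair.aemeasurable (f := fun p : Euc n × (Fin (N t) → Euc n) =>
      noise X ξ (β t) (φ t) ψ (N t) p.1 p.2) hnm.aestronglyMeasurable
    rw [← h2, hlaw, integral_prod _ hint]
    refine (integral_mono_ae hint.integral_prod_left (integrable_const
      (Real.sqrt (2 / Real.pi) * (F / ξ) * Δ t + (n * F ^ 2 / (N t * ξ ^ 2) + Δ t ^ 2)))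
      ?_).trans_eq (by simp)
    filter_upwards [hxX] with x hx
    exact integral_noise_le hne hX hc hξ (hβ t) (hN t) (hφm t) (hφ t) hψm hψ hx (hΔ t x)

lemma integrable_projGradMap_sq (hne : X.Nonempty) (hX : IsCompact X) (hc : Convex ℝ X)
    (hξ : 0 < ξ) (hβ : ∀ t, 0 < β t) (hφm : ∀ t, Measurable (φ t))
    (hφ : ∀ t z, |φ t z| ≤ F)
    (hm : ∀ t i, Measurable (u t i)) (hmap : ∀ t i, P.map (u t i) = stdGaussian (Euc n))
    (hind : iIndepFun (fun (p : ℕ × ℕ) (ω : Ω) => u p.1 p.2 ω) P) {t : ℕ} (ht : 1 ≤ t) :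
    Integrable (fun ω => ‖projGradMap X ξ φ N β x₀ (fun t i => u t i ω) t‖ ^ 2) P := by
  have hum : Measurable fun ω (i : Fin (N t)) => u t i ω := measurable_pi_lambda _ fun i => hm t i
  have h1 := (memLp_sum_norm_pi (n := n) (k := N t) (F / (N t * ξ))).integrable_sq
  rw [← map_sample_eq_pi hm hmap hind t (N t)] at h1
  refine (h1.comp_measurable hum).mono' ?_ (ae_of_all _ fun ω => ?_)
  · exact (((measurable_projGradMap hne hX hc hφm t).comp
      (measurable_pi_lambda _ fun t => measurable_pi_lambda _ fun i => hm t i)).norm.pow_const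
        2).aestronglyMeasurable
  · rw [Real.norm_of_nonneg (by positivity), projGradMap_eq]
    simp only [Function.comp_apply]
    gcongr
    exact (norm_gradMapping_le hne hX hc (hβ t) (sgd_succ_mem hne hX ht _) _).trans
      (norm_estimator_le hξ (hφ t) _ _)

/-- The convergence bound, before the random choice of the index. -/
lemma sum_integral_projGradMap_sq_le (hne : X.Nonempty) (hX : IsCompact X) (hc : Convex ℝ X)
    (hξ : 0 < ξ) (hβ : ∀ t, 0 < β t) (hN : ∀ t, 0 < N t) (hφm : ∀ t, Measurable (φ t))
    (hφ : ∀ t z, |φ t z| ≤ F) (hψm : AEStronglyMeasurable ψ volume) (hψ : ∀ z, |ψ z| ≤ F)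
    (hΔ : ∀ t x, ‖inexactGrad ξ (φ t) x - inexactGrad ξ ψ x‖ ≤ Δ t)
    (hm : ∀ t i, Measurable (u t i)) (hmap : ∀ t i, P.map (u t i) = stdGaussian (Euc n))
    (hind : iIndepFun (fun (p : ℕ × ℕ) (ω : Ω) => u p.1 p.2 ω) P) (T : ℕ) :
    ∑ t ∈ Finset.Icc 1 T, (β t - F / ξ ^ 2 * β t ^ 2) *
        ∫ ω, ‖projGradMap X ξ φ N β x₀ (fun t i => u t i ω) t‖ ^ 2 ∂P ≤
      2 * F + ∑ t ∈ Finset.Icc 1 T, Real.sqrt (2 / Real.pi) * (F / ξ) * Δ t * β t +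
        ∑ t ∈ Finset.Icc 1 T, (n * F ^ 2 / (N t * ξ ^ 2) + Δ t ^ 2) * β t := by
  set x : ℕ → Ω → Euc n := fun t ω => sgd X ξ φ N β x₀ (fun t i => u t i ω) t with hx
  set A : ℕ → Ω → ℝ := fun t ω => ‖projGradMap X ξ φ N β x₀ (fun t i => u t i ω) t‖ ^ 2 with hA
  set Z : ℕ → Ω → ℝ := fun t ω => noise X ξ (β t) (φ t) ψ (N t) (x t ω) fun i => u t i ω with hZ
  have hAi : ∀ t ∈ Finset.Icc 1 T, Integrable (A t) P := fun t ht =>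
    integrable_projGradMap_sq hne hX hc hξ hβ hφm hφ hm hmap hind (Finset.mem_Icc.1 ht).1
  have hZi : ∀ t ∈ Finset.Icc 1 T, Integrable (Z t) P ∧ ∫ ω, Z t ω ∂P ≤
      Real.sqrt (2 / Real.pi) * (F / ξ) * Δ t + (n * F ^ 2 / (N t * ξ ^ 2) + Δ t ^ 2) :=
    fun t ht => integral_noise_sgd_le hne hX hc hξ hβ hN hφm hφ hψm hψ hΔ hm hmap hind
      (Finset.mem_Icc.1 ht).1
  -- Descent is summed path by path; the values telescope, and both end values are at most `F` in
  -- modulus.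
  have hpath : ∀ ω, ∑ t ∈ Finset.Icc 1 T, (β t - F / ξ ^ 2 * β t ^ 2) * A t ω ≤
      2 * F + ∑ t ∈ Finset.Icc 1 T, β t * Z t ω := by
    intro ω
    have h1 : ∀ t ∈ Finset.Icc 1 T, (β t - F / ξ ^ 2 * β t ^ 2) * A t ω ≤
        (smoothed ξ ψ (x t ω) - smoothed ξ ψ (x (t + 1) ω)) + β t * Z t ω := by
      intro t ht
      refine gradMapping_descent hne hX hc (hβ t) (sgd_succ_mem hne hX (Finset.mem_Icc.1 ht).1 _)
        _ fun v => ?_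
      have := (abs_le.1 (abs_smoothed_sub_le hψm hψ hξ (x t ω) v)).2
      linarith
    have h2 : ∑ t ∈ Finset.Icc 1 T, (smoothed ξ ψ (x t ω) - smoothed ξ ψ (x (t + 1) ω)) =
        smoothed ξ ψ (x 1 ω) - smoothed ξ ψ (x (T + 1) ω) := by
      rw [← Finset.Ico_add_one_right_eq_Icc, Finset.sum_Ico_eq_sum_range]
      have := Finset.sum_range_sub' (fun t => smoothed ξ ψ (x (1 + t) ω)) T
      simp only [add_tsub_cancel_right, add_zero, ← add_assoc] at this ⊢
      rw [this, add_comm 1 T]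
    refine (Finset.sum_le_sum h1).trans ?_
    rw [Finset.sum_add_distrib, h2]
    have h3 := (abs_le.1 (abs_smoothed_le hψ hξ (x 1 ω))).2
    have h4 := (abs_le.1 (abs_smoothed_le hψ hξ (x (T + 1) ω))).1
    linarith
  calc ∑ t ∈ Finset.Icc 1 T, (β t - F / ξ ^ 2 * β t ^ 2) * ∫ ω, A t ω ∂P
      = ∫ ω, ∑ t ∈ Finset.Icc 1 T, (β t - F / ξ ^ 2 * β t ^ 2) * A t ω ∂P := by
        rw [integral_finsetSum _ fun t ht => (hAi t ht).const_mul _]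
        simp_rw [integral_const_mul]
    _ ≤ ∫ ω, 2 * F + ∑ t ∈ Finset.Icc 1 T, β t * Z t ω ∂P :=
        integral_mono (integrable_finsetSum _ fun t ht => (hAi t ht).const_mul _)
          ((integrable_const _).add (integrable_finsetSum _ fun t ht => (hZi t ht).1.const_mul _))
          hpath
    _ = 2 * F + ∑ t ∈ Finset.Icc 1 T, β t * ∫ ω, Z t ω ∂P := by
        rw [integral_add (integrable_const _)
          (integrable_finsetSum _ fun t ht => (hZi t ht).1.const_mul _),
          integral_finsetSum _ fun t ht => (hZi t ht).1.const_mul _]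
        simp_rw [integral_const_mul]
        simp
    _ ≤ 2 * F + ∑ t ∈ Finset.Icc 1 T, (Real.sqrt (2 / Real.pi) * (F / ξ) * Δ t * β t +
          (n * F ^ 2 / (N t * ξ ^ 2) + Δ t ^ 2) * β t) := by
        gcongr with t ht
        have := mul_le_mul_of_nonneg_left (hZi t ht).2 (hβ t).le
        linarith
    _ = _ := by rw [Finset.sum_add_distrib, add_assoc]

/-- The convergence bound for the random output index. -/
theorem integral_projGradMap_randomIndex_le (hne : X.Nonempty) (hX : IsCompact X)
    (hc : Convex ℝ X) (hξ : 0 < ξ) (hβ : ∀ t, 0 < β t) (hβL : ∀ t, F / ξ ^ 2 * β t < 1)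
    (hN : ∀ t, 0 < N t) (hφm : ∀ t, Measurable (φ t))
    (hφ : ∀ t z, |φ t z| ≤ F) (hψm : AEStronglyMeasurable ψ volume) (hψ : ∀ z, |ψ z| ≤ F)
    (hΔ : ∀ t x, ‖inexactGrad ξ (φ t) x - inexactGrad ξ ψ x‖ ≤ Δ t) {T : ℕ} (hT : 1 ≤ T)
    {R : Ω → ℕ} (hs : IsSampling P (F / ξ ^ 2) β T u R) :
    Integrable (fun ω => ‖projGradMap X ξ φ N β x₀ (fun t i => u t i ω) (R ω)‖ ^ 2) P ∧
    ∫ ω, ‖projGradMap X ξ φ N β x₀ (fun t i => u t i ω) (R ω)‖ ^ 2 ∂P ≤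
      (2 * F + ∑ t ∈ Finset.Icc 1 T, Real.sqrt (2 / Real.pi) * (F / ξ) * Δ t * β t +
        ∑ t ∈ Finset.Icc 1 T, (n * F ^ 2 / (N t * ξ ^ 2) + Δ t ^ 2) * β t) /
        ∑ t ∈ Finset.Icc 1 T, (β t - F / ξ ^ 2 * β t ^ 2) := by
  set W : ℝ := ∑ t ∈ Finset.Icc 1 T, (β t - F / ξ ^ 2 * β t ^ 2) with hW
  set A : ℕ → Ω → ℝ := fun t ω => ‖projGradMap X ξ φ N β x₀ (fun t i => u t i ω) t‖ ^ 2 with hA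
  have hWpos : 0 < W := by
    refine Finset.sum_pos (fun t _ => ?_) ⟨1, Finset.mem_Icc.2 ⟨le_rfl, hT⟩⟩
    have h1 := mul_pos (hβ t) (sub_pos.2 (hβL t))
    linarith
  have hAi : ∀ t ∈ Finset.Icc 1 T, Integrable (A t) P := fun t ht =>
    integrable_projGradMap_sq hne hX hc hξ hβ hφm hφ hs.measurable_sample hs.map_sample
      hs.indep_sample (Finset.mem_Icc.1 ht).1
  have hRm : ∀ t, MeasurableSet (R ⁻¹' {t}) := fun t => hs.measurable_index (measurableSet_singleton t)
  -- The prescribed masses on `1, …, T` sum to one, so no mass is left elsewhere.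
  have hsupp : ∀ᵐ ω ∂P, R ω ∈ Finset.Icc 1 T := by
    have h1 : P.real (R ⁻¹' (Finset.Icc 1 T : Finset ℕ)) = 1 := by
      have h2 : R ⁻¹' (Finset.Icc 1 T : Finset ℕ) = ⋃ t ∈ Finset.Icc 1 T, R ⁻¹' {t} := by
        ext ω; simp
      rw [h2, measureReal_biUnion_finset (fun s _ t _ hst => Disjoint.preimage R (by simpa using hst))
        (fun t _ => hRm t), Finset.sum_congr rfl hs.index_law, ← Finset.sum_div, div_self hWpos.ne']
    have h3 := (prob_compl_eq_zero_iff (hs.measurable_index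
      (Finset.measurableSet (Finset.Icc 1 T)))).2 (by
        rw [← ofReal_measureReal (μ := P) (measure_ne_top _ _), h1, ENNReal.ofReal_one])
    filter_upwards [measure_eq_zero_iff_ae_notMem.1 h3] with ω hω
    simpa using hω
  have hind : ∀ t ∈ Finset.Icc 1 T, Integrable (fun ω => (R ⁻¹' {t}).indicator (A t) ω) P ∧
      ∫ ω, (R ⁻¹' {t}).indicator (A t) ω ∂P =
        (β t - F / ξ ^ 2 * β t ^ 2) / W * ∫ ω, A t ω ∂P := by
    intro t ht
    refine ⟨(hAi t ht).indicator (hRm t), ?_⟩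
    have hmeasA : Measurable fun U : ℕ × ℕ → Euc n =>
        ‖projGradMap X ξ φ N β x₀ (fun t i => U (t, i)) t‖ ^ 2 :=
      ((measurable_projGradMap hne hX hc hφm t).comp (measurable_pi_lambda _ fun t =>
        measurable_pi_lambda _ fun i => measurable_pi_apply (t, i))).norm.pow_const 2
    have h1 := hs.indep_index.comp (φ := fun r : ℕ => if r = t then (1 : ℝ) else 0)
      (Measurable.of_discrete) hmeasA
    have h2 := h1.integral_mul_eq_mul_integral
      ((Measurable.of_discrete.comp hs.measurable_index).aestronglyMeasurable)
      ((hmeasA.comp (measurable_pi_lambda _ fun p => hs.measurable_sample p.1 p.2)).aestronglyMeasurable)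
    have h3 : ∀ ω, (R ⁻¹' {t}).indicator (A t) ω =
        (((fun r : ℕ => if r = t then (1 : ℝ) else 0) ∘ R) *
          ((fun U : ℕ × ℕ → Euc n => ‖projGradMap X ξ φ N β x₀ (fun t i => U (t, i)) t‖ ^ 2) ∘
            fun ω p => u p.1 p.2 ω)) ω := by
      intro ω
      by_cases h : R ω = t <;> simp [hA, h]
    have h4 : ∫ ω, ((fun r : ℕ => if r = t then (1 : ℝ) else 0) ∘ R) ω ∂P = P.real (R ⁻¹' {t}) := by
      rw [← integral_indicator_one (hRm t)]
      congr 1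
      ext ω
      by_cases h : R ω = t <;> simp [h]
    rw [integral_congr_ae (ae_of_all _ h3), h2, h4, hs.index_law t ht]
    rfl
  have hae : (fun ω => A (R ω) ω) =ᵐ[P]
      fun ω => ∑ t ∈ Finset.Icc 1 T, (R ⁻¹' {t}).indicator (A t) ω := by
    filter_upwards [hsupp] with ω hω
    rw [Finset.sum_eq_single_of_mem (R ω) hω]
    · simp
    · intro t _ hne'
      exact Set.indicator_of_notMem (by simpa using hne'.symm) _
  refine ⟨(integrable_finsetSum _ fun t ht => (hind t ht).1).congr hae.symm, ?_⟩
  change ∫ ω, A (R ω) ω ∂P ≤ _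
  rw [integral_congr_ae hae, integral_finsetSum _ fun t ht => (hind t ht).1,
    Finset.sum_congr rfl fun t ht => (hind t ht).2, le_div_iff₀ hWpos, Finset.sum_mul]
  refine le_trans (le_of_eq ?_) (sum_integral_projGradMap_sq_le (x₀ := x₀) hne hX hc hξ hβ hN hφm hφ hψm hψ hΔ
    hs.measurable_sample hs.map_sample hs.indep_sample T)
  refine Finset.sum_congr rfl fun t _ => ?_
  field_simp
  rfl

end convergence

/-! ### The rate -/

/-- The increment satisfies `1/(T+2) ≤ log((T+2)/(T+1))`, from `1 - 1/x ≤ log x`. -/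
lemma sum_one_div_add_one_le_log (T : ℕ) :
    ∑ t ∈ Finset.Icc 1 T, 1 / ((t : ℝ) + 1) ≤ Real.log (T + 1) := by
  induction T with
  | zero => simp
  | succ T ih =>
    rw [Finset.sum_Icc_succ_top (by omega)]
    have h1 := Real.one_sub_inv_le_log_of_pos (x := ((T : ℝ) + 2) / (T + 1)) (by positivity)
    rw [Real.log_div (by positivity) (by positivity)] at h1
    have h2 : 1 - (((T : ℝ) + 2) / (T + 1))⁻¹ = 1 / (T + 2) := by
      field_simp
      ring
    have h3 : ((T + 1 : ℕ) : ℝ) + 1 = T + 2 := by push_cast; ring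
    rw [h3]
    linarith

lemma sum_one_div_add_one_le {T : ℕ} (hT : 2 ≤ T) :
    ∑ t ∈ Finset.Icc 1 T, 1 / ((t : ℝ) + 1) ≤ 2 * Real.log T := by
  refine (sum_one_div_add_one_le_log T).trans ?_
  have h1 : (2 : ℝ) ≤ T := by exact_mod_cast hT
  have h2 : 2 * Real.log T = Real.log ((T : ℝ) ^ 2) := by rw [Real.log_pow]; norm_num
  rw [h2]
  exact Real.log_le_log (by positivity) (by nlinarith)

/-- As `1/(t+1) ≤ 1`, the squared bias also decays like `1/(t+1)`, so the numerator is a constant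
plus a harmonic sum; the constant `2F` is absorbed through `log 2 ≤ log T`. -/
lemma rate_le {F a B C b L : ℝ} (hF : 0 ≤ F) (ha : 0 ≤ a) (hB : 0 ≤ B) (hC : 0 ≤ C) (hb : 0 < b)
    (hL : L * b < 1) {Δ v : ℕ → ℝ} (hΔ : ∀ t, Δ t = C * (1 / ((t : ℝ) + 1)))
    (hv : ∀ t, v t = B * (1 / ((t : ℝ) + 1))) {T : ℕ} (hT : 2 ≤ T) :
    (2 * F + ∑ t ∈ Finset.Icc 1 T, a * Δ t * b + ∑ t ∈ Finset.Icc 1 T, (v t + Δ t ^ 2) * b) /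
        ∑ _t ∈ Finset.Icc 1 T, (b - L * b ^ 2) ≤
      (2 * F / Real.log 2 + 2 * ((a * C + B + C ^ 2) * b)) / (b - L * b ^ 2) *
        (Real.log T / T) := by
  have hT0 : (2 : ℝ) ≤ T := by exact_mod_cast hT
  have hden : 0 < b - L * b ^ 2 := by nlinarith
  have hlog2 : 0 < Real.log 2 := Real.log_pos one_lt_two
  have hlogT : Real.log 2 ≤ Real.log T := Real.log_le_log two_pos hT0
  have h1 : ∑ t ∈ Finset.Icc 1 T, a * Δ t * b + ∑ t ∈ Finset.Icc 1 T, (v t + Δ t ^ 2) * b ≤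
      (a * C + B + C ^ 2) * b * ∑ t ∈ Finset.Icc 1 T, 1 / ((t : ℝ) + 1) := by
    rw [← Finset.sum_add_distrib, Finset.mul_sum]
    refine Finset.sum_le_sum fun t _ => ?_
    rw [hΔ, hv]
    set s := 1 / ((t : ℝ) + 1)
    have hs0 : 0 ≤ s := by positivity
    have hs1 : s ≤ 1 := by
      rw [div_le_one (by positivity)]
      linarith [(Nat.cast_nonneg t : (0 : ℝ) ≤ t)]
    have h2 : (C * s) ^ 2 ≤ C ^ 2 * s := by
      rw [mul_pow]
      gcongr
      nlinarith
    nlinarith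
  have h3 : (a * C + B + C ^ 2) * b * ∑ t ∈ Finset.Icc 1 T, 1 / ((t : ℝ) + 1) ≤
      (a * C + B + C ^ 2) * b * (2 * Real.log T) := by
    gcongr
    exact sum_one_div_add_one_le hT
  have h4 : 2 * F ≤ 2 * F / Real.log 2 * Real.log T := by
    rw [div_mul_eq_mul_div, le_div_iff₀ hlog2]
    gcongr
  rw [Finset.sum_const, Nat.card_Icc, add_tsub_cancel_right, nsmul_eq_mul,
    div_le_iff₀ (by positivity)]
  have h5 : (2 * F / Real.log 2 + 2 * ((a * C + B + C ^ 2) * b)) / (b - L * b ^ 2) *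
      (Real.log T / T) * (T * (b - L * b ^ 2)) =
      (2 * F / Real.log 2 + 2 * ((a * C + B + C ^ 2) * b)) * Real.log T := by
    have hT' : (T : ℝ) ≠ 0 := by positivity
    generalize b - L * b ^ 2 = w at hden
    field_simp
  rw [h5]
  linarith

end Scinbio

/-! ### Assembly of the main theorem. -/

theorem mainTheorem5 {n m : ℕ} (X : Set (Scinbio.Euc n)) (Y Y' : Set (Scinbio.Euc m))
    (f g : Scinbio.Euc n → Scinbio.Euc m → ℝ) (y₀ : Scinbio.Euc m) (M Lf glow ξ d : ℝ)
    (hX_ne : X.Nonempty) (hX_convex : Convex ℝ X) (hX_compact : IsCompact X)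
    (hf : ContinuousOn (fun p : Scinbio.Euc n × Scinbio.Euc m => f p.1 p.2) (X ×ˢ Set.univ))
    (hg : ContDiffOn ℝ 2 (fun p : Scinbio.Euc n × Scinbio.Euc m => g p.1 p.2) (X ×ˢ Set.univ))
    -- the Hessian in `y` is Lipschitz with constant `M > 0`
    (hM : 0 < M)
    (hHess : ∀ x ∈ X, ∀ x' ∈ X, ∀ y y' : Scinbio.Euc m,
      ‖Scinbio.hessY g x y - Scinbio.hessY g x' y'‖
        ≤ M * Real.sqrt (‖x - x'‖ ^ 2 + ‖y - y'‖ ^ 2))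
    (hglow : ∀ x ∈ X, ∀ y : Scinbio.Euc m, glow ≤ g x y)
    -- all initial level sets lie in the compact set `Y`, and `Y'` is a compact enlargement of `Y`
    (hY_compact : IsCompact Y)
    (hY : ∀ x ∈ X, {y | g x y ≤ g x y₀} ⊆ Y)
    (hY'_compact : IsCompact Y') (hY' : Y ⊆ interior Y')
    -- `f` is Lipschitz with constant `Lf` over the initial level sets
    (hLf : ∀ x ∈ X, ∀ x' ∈ X, ∀ y y' : Scinbio.Euc m, g x y ≤ g x y₀ → g x' y' ≤ g x' y₀ →
      |f x y - f x' y'| ≤ Lf * Real.sqrt (‖x - x'‖ ^ 2 + ‖y - y'‖ ^ 2))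
    -- the bifurcation set has upper Minkowski dimension `d < n`
    (hd : Scinbio.upperMinkowskiDim (Scinbio.bifurcationSet X g) = (d : EReal))
    (hdn : d < n)
    (hξ : 0 < ξ) :
    -- the constants that enter the statement exist
    (∃ (g0 fbar : ℝ) (μ : ℝ → ℝ) (α : ℝ → ℝ → ℝ),
      (∀ x ∈ X, g x y₀ ≤ g0) ∧
      (∀ x ∈ X, ∀ y, g x y ≤ g x y₀ → |f x y| ≤ fbar) ∧
      Scinbio.IsEigenvalueBound X Y' g μ ∧ Scinbio.IsGradientBound X Y Y' g α) ∧
    -- and for any choice of them the following holds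
    ∀ fbar : ℝ, (∀ x ∈ X, ∀ y, g x y ≤ g x y₀ → |f x y| ≤ fbar) →
    ∃ C₁ C₂ : ℝ, 0 < C₁ ∧ 0 < C₂ ∧ ∃ C₃ : ℝ → ℝ,
    ∀ (g0 : ℝ) (μ : ℝ → ℝ) (α : ℝ → ℝ → ℝ),
      (∀ x ∈ X, g x y₀ ≤ g0) →
      Scinbio.IsEigenvalueBound X Y' g μ → Scinbio.IsGradientBound X Y Y' g α →
    ∀ (yseq yhat : ℕ → Scinbio.Euc n → Scinbio.Euc m) (ycd : Scinbio.Euc n → Scinbio.Euc m),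
      Scinbio.IsCubicNewtonSeq X g M y₀ yseq →
      Scinbio.IsCubicNewtonOutput X g M yseq yhat →
      (∀ K, Measurable (fun x : X => yhat K x)) →
      Scinbio.IsCorrespondence X f g yseq ycd →
      MeasureTheory.volume {x ∈ X \ Scinbio.bifurcationSet X g |
        ¬ ContinuousWithinAt ycd (X \ Scinbio.bifurcationSet X g) x} = 0 →
    -- the smoothed hyperfunction is differentiable
    Differentiable ℝ (Scinbio.smoothed ξ (Scinbio.extendedValue X f fbar ycd)) ∧
    -- bias bound
    (∀ (ρ δ : ℝ) (K N : ℕ) (x : Scinbio.Euc n), 0 < ρ → 0 < δ → 0 < N →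
      Scinbio.stepThreshold (g0 - glow) M μ α ρ δ < K →
      MeasureTheory.Integrable
        (Scinbio.estimator ξ (Scinbio.extendedValue X f fbar (yhat K)) N x)
        (MeasureTheory.Measure.pi
          (fun _ : Fin N => ProbabilityTheory.stdGaussian (Scinbio.Euc n))) ∧
      ∫ u, Scinbio.estimator ξ (Scinbio.extendedValue X f fbar (yhat K)) N x u
          ∂(MeasureTheory.Measure.pi
            (fun _ : Fin N => ProbabilityTheory.stdGaussian (Scinbio.Euc n)))
        = Scinbio.inexactGrad ξ (Scinbio.extendedValue X f fbar (yhat K)) x ∧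
      ‖Scinbio.inexactGrad ξ (Scinbio.extendedValue X f fbar (yhat K)) x
          - gradient (Scinbio.smoothed ξ (Scinbio.extendedValue X f fbar ycd)) x‖
        ≤ C₁ * ρ + C₂ * δ ^ (((n : ℝ) - d) / 2)) ∧
    -- variance bound
    (∀ (K N : ℕ) (x : Scinbio.Euc n), 0 < N →
      MeasureTheory.Integrable
        (fun u => ‖Scinbio.estimator ξ (Scinbio.extendedValue X f fbar (yhat K)) N x u
          - Scinbio.inexactGrad ξ (Scinbio.extendedValue X f fbar (yhat K)) x‖ ^ 2)
        (MeasureTheory.Measure.pi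
          (fun _ : Fin N => ProbabilityTheory.stdGaussian (Scinbio.Euc n))) ∧
      ∫ u, ‖Scinbio.estimator ξ (Scinbio.extendedValue X f fbar (yhat K)) N x u
          - Scinbio.inexactGrad ξ (Scinbio.extendedValue X f fbar (yhat K)) x‖ ^ 2
          ∂(MeasureTheory.Measure.pi
            (fun _ : Fin N => ProbabilityTheory.stdGaussian (Scinbio.Euc n)))
        ≤ n * fbar ^ 2 / (N * ξ ^ 2)) ∧
    -- convergence bound for the random output index
    (∀ (ρ δ β : ℕ → ℝ) (N K : ℕ → ℕ) (x₀ : Scinbio.Euc n),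
      (∀ t, 0 < ρ t) → (∀ t, 0 < δ t) → (∀ t, 0 < N t) →
      (∀ t, Scinbio.stepThreshold (g0 - glow) M μ α (ρ t) (δ t) < K t) →
      (∀ t, 0 < β t) → (∀ t, fbar / ξ ^ 2 * β t < 1) →
      ∀ (Ω : Type*) [MeasurableSpace Ω] (P : MeasureTheory.Measure Ω)
        [MeasureTheory.IsProbabilityMeasure P] (T : ℕ)
        (u : ℕ → ℕ → Ω → Scinbio.Euc n) (R : Ω → ℕ), 1 ≤ T →
      Scinbio.IsSampling P (fbar / ξ ^ 2) β T u R →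
      MeasureTheory.Integrable (fun ω =>
        ‖Scinbio.projGradMap X ξ (fun t => Scinbio.extendedValue X f fbar (yhat (K t))) N β x₀
          (fun t i => u t i ω) (R ω)‖ ^ 2) P ∧
      ∫ ω, ‖Scinbio.projGradMap X ξ (fun t => Scinbio.extendedValue X f fbar (yhat (K t))) N β x₀
          (fun t i => u t i ω) (R ω)‖ ^ 2 ∂P
        ≤ (2 * fbar
            + ∑ t ∈ Finset.Icc 1 T, Real.sqrt (2 / Real.pi) * (fbar / ξ)
                * (C₁ * ρ t + C₂ * δ t ^ (((n : ℝ) - d) / 2)) * β t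
            + ∑ t ∈ Finset.Icc 1 T, (n * fbar ^ 2 / (N t * ξ ^ 2)
                + (C₁ * ρ t + C₂ * δ t ^ (((n : ℝ) - d) / 2)) ^ 2) * β t)
          / ∑ t ∈ Finset.Icc 1 T, (β t - fbar / ξ ^ 2 * β t ^ 2)) ∧
    -- the rate for the special choice of the parameters
    (∀ (β : ℝ) (K : ℕ → ℕ) (x₀ : Scinbio.Euc n), 0 < β → fbar / ξ ^ 2 * β < 1 →
      (∀ t : ℕ, Scinbio.stepThreshold (g0 - glow) M μ α (1 / ((t : ℝ) + 1))
        (1 / ((t : ℝ) + 1) ^ (2 / ((n : ℝ) - d))) < K t) →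
      ∀ (Ω : Type*) [MeasurableSpace Ω] (P : MeasureTheory.Measure Ω)
        [MeasureTheory.IsProbabilityMeasure P] (T : ℕ)
        (u : ℕ → ℕ → Ω → Scinbio.Euc n) (R : Ω → ℕ), 2 ≤ T →
      Scinbio.IsSampling P (fbar / ξ ^ 2) (fun _ => β) T u R →
      MeasureTheory.Integrable (fun ω =>
        ‖Scinbio.projGradMap X ξ (fun t => Scinbio.extendedValue X f fbar (yhat (K t)))
          (fun t => t + 1) (fun _ => β) x₀ (fun t i => u t i ω) (R ω)‖ ^ 2) P ∧
      ∫ ω, ‖Scinbio.projGradMap X ξ (fun t => Scinbio.extendedValue X f fbar (yhat (K t)))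
          (fun t => t + 1) (fun _ => β) x₀ (fun t i => u t i ω) (R ω)‖ ^ 2 ∂P
        ≤ C₃ β * (Real.log T / T)) := by
  have hgrad := Scinbio.continuousOn_gradY hg
  have hL : ∀ x ∈ X, Scinbio.IsLipschitzHessian (g x) (Scinbio.gradY g x) (Scinbio.hessY g x) M :=
    fun x hx => Scinbio.isLipschitzHessian_section hg hHess hx
  refine ⟨?_, ?_⟩
  · obtain ⟨μ, hμ⟩ := Scinbio.exists_isEigenvalueBound hX_compact hY'_compact hgrad
      (Scinbio.continuousOn_hessY hHess)
    obtain ⟨α, hα⟩ := Scinbio.exists_isGradientBound hM hX_compact hY_compact hY'_compact hY' hL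
      hgrad hHess
    obtain ⟨fbar, hfbar⟩ := (hX_compact.prod hY_compact).exists_bound_of_continuousOn
      (hf.mono (Set.prod_mono_right (Set.subset_univ Y)))
    obtain ⟨g0, hg0⟩ := (hX_compact.prod (isCompact_singleton (x := y₀))).exists_bound_of_continuousOn
      (hg.continuousOn.mono (Set.prod_mono_right (Set.subset_univ {y₀})))
    exact ⟨g0, fbar, μ, α, fun x hx => (le_abs_self _).trans (hg0 (x, y₀) ⟨hx, rfl⟩),
      fun x hx y hy => hfbar (x, y) ⟨hx, hY x hx hy⟩, hμ, hα⟩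
  intro fbar hfbar
  have hfbar0 : 0 ≤ fbar := by
    obtain ⟨x, hx⟩ := hX_ne
    exact (abs_nonneg _).trans (hfbar x hx y₀ le_rfl)
  have hsub : Scinbio.bifurcationSet X g ⊆ X := fun x hx => hx.1
  obtain ⟨C, hC, hvol⟩ := Scinbio.exists_volume_cthickening_le hX_compact hsub hd hdn
  have hnull := Scinbio.volume_inter_closure_eq_zero hX_compact hsub hd hdn
  have hB : 0 ≤ Scinbio.gaussGradBound n ξ := by unfold Scinbio.gaussGradBound; positivity
  -- The summand `1` keeps the constants positive when `Lf`, `fbar` or the volume of `X` vanishes.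
  -- They involve neither `g0`, `μ`, `α` nor the iterates.
  set C₁ : ℝ := Scinbio.gaussGradBound n ξ * volume.real X * (2 * |Lf|) + 1
  set C₂ : ℝ := Scinbio.gaussGradBound n ξ * C * (2 * fbar) + 1
  have hC₁ : 0 < C₁ := by positivity
  have hC₂ : 0 < C₂ := by positivity
  refine ⟨C₁, C₂, hC₁, hC₂, fun b => (2 * fbar / Real.log 2 + 2 * ((Real.sqrt (2 / Real.pi) *
    (fbar / ξ) * (C₁ + C₂) + n * fbar ^ 2 / ξ ^ 2 + (C₁ + C₂) ^ 2) * b)) /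
    (b - fbar / ξ ^ 2 * b ^ 2), ?_⟩
  intro g0 μ α hg0 hμ hα yseq yhat ycd hseq hout hmeas hcd _
  have hφm : ∀ K, Measurable (Scinbio.extendedValue X f fbar (yhat K)) := fun K =>
    Scinbio.measurable_extendedValue hX_compact.measurableSet hf (hmeas K)
  have hφ : ∀ K z, |Scinbio.extendedValue X f fbar (yhat K) z| ≤ fbar := fun K =>
    Scinbio.abs_extendedValue_le hfbar0 fun x hx =>
      hfbar x hx _ (Scinbio.output_value_le hM (hL x hx) hx hseq hout K)
  have hψm : AEStronglyMeasurable (Scinbio.extendedValue X f fbar ycd) volume :=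
    Scinbio.aestronglyMeasurable_correspondence_value hM hL hglow hY hY'_compact hLf hg0 hμ hα
      hseq hout hcd hX_compact hf hmeas hnull
  have hψ : ∀ z, |Scinbio.extendedValue X f fbar ycd z| ≤ fbar :=
    Scinbio.abs_extendedValue_le hfbar0 fun x hx =>
      hfbar x hx _ (Scinbio.correspondence_value_le hM hL hseq hcd hx)
  have hbias : ∀ (ρ δ : ℝ) (K : ℕ), 0 < ρ → 0 < δ →
      Scinbio.stepThreshold (g0 - glow) M μ α ρ δ < K → ∀ x,
      ‖Scinbio.inexactGrad ξ (Scinbio.extendedValue X f fbar (yhat K)) x -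
        Scinbio.inexactGrad ξ (Scinbio.extendedValue X f fbar ycd) x‖ ≤
        C₁ * ρ + C₂ * δ ^ (((n : ℝ) - d) / 2) := fun ρ δ K hρ hδ hK x =>
    Scinbio.norm_inexactGrad_sub_correspondence_le hM hL hglow hY hY'_compact hLf hg0 hμ hα
      hseq hout hcd hX_compact hf hmeas hnull hξ hfbar0 hfbar hvol hρ hδ hK x
  refine ⟨fun x => (Scinbio.hasGradientAt_smoothed hψm hψ hξ x).differentiableAt, ?_, ?_, ?_, ?_⟩
  · intro ρ δ K N x hρ hδ hN hK
    refine ⟨Scinbio.integrable_estimator (hφm K).aestronglyMeasurable (hφ K) hξ N x,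
      Scinbio.integral_estimator (hφm K).aestronglyMeasurable (hφ K) hξ hN x, ?_⟩
    rw [(Scinbio.hasGradientAt_smoothed hψm hψ hξ x).gradient]
    exact hbias ρ δ K hρ hδ hK x
  · intro K N x hN
    exact ⟨Scinbio.integrable_norm_estimator_sub_sq (hφm K).aestronglyMeasurable (hφ K) hξ N x _,
      Scinbio.integral_norm_estimator_sub_sq_le (hφm K).aestronglyMeasurable (hφ K) hξ hN x⟩
  · intro ρ δ β N K x₀ hρ hδ hN hK hβ hβL Ω _ P _ T u R hT hs
    exact Scinbio.integral_projGradMap_randomIndex_le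
      (φ := fun t => Scinbio.extendedValue X f fbar (yhat (K t)))
      (Δ := fun t => C₁ * ρ t + C₂ * δ t ^ (((n : ℝ) - d) / 2)) hX_ne hX_compact hX_convex hξ hβ
      hβL hN (fun t => hφm (K t)) (fun t => hφ (K t)) hψm hψ
      (fun t x => hbias (ρ t) (δ t) (K t) (hρ t) (hδ t) (hK t) x) hT hs
  · intro β K x₀ hβ hβL hK Ω _ P _ T u R hT hs
    -- The exponents are reciprocal, so both parts of the bias bound become multiples of `1/(t+1)`.
    have hpow : ∀ t : ℕ, (1 / ((t : ℝ) + 1) ^ (2 / ((n : ℝ) - d))) ^ (((n : ℝ) - d) / 2) =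
        1 / ((t : ℝ) + 1) := by
      intro t
      have ht : (0 : ℝ) < (t : ℝ) + 1 := by positivity
      have hnd : (n : ℝ) - d ≠ 0 := by linarith
      rw [Real.div_rpow zero_le_one (by positivity), Real.one_rpow, ← Real.rpow_mul ht.le,
        div_mul_div_cancel₀ hnd, div_self two_ne_zero, Real.rpow_one]
    have h := Scinbio.integral_projGradMap_randomIndex_le (x₀ := x₀) (N := fun t => t + 1)
      (φ := fun t => Scinbio.extendedValue X f fbar (yhat (K t)))
      (Δ := fun t => (C₁ + C₂) * (1 / ((t : ℝ) + 1))) hX_ne hX_compact hX_convex hξ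
      (fun _ => hβ) (fun _ => hβL) (fun t => Nat.succ_pos t) (fun t => hφm (K t))
      (fun t => hφ (K t)) hψm hψ
      (fun t x => by
        have := hbias _ _ (K t) (by positivity) (by positivity) (hK t) x
        rw [hpow] at this
        linarith) (le_trans one_le_two hT) hs
    refine ⟨h.1, h.2.trans ?_⟩
    exact Scinbio.rate_le hfbar0 (by positivity) (by positivity) (by positivity) hβ hβL
      (fun t => rfl) (fun t => by push_cast; field_simp) hT
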